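/- **Setting.** Let $(a_n)_{n\ge1}$ be a decreasing sequence of positive numbers with $\sum_n a_n<\infty$, and put $b_0=0$, $b_n=\sum_{j=1}^n 8a_j$, $b=\lim_n b_n$. For $a>0$ let $$V_a(x)=y_1\delta(x-a)+y_2\delta(x-2a)+y_2\delta(x-3a)+y_1\delta(x-4a)+y_2\delta(x-5a)+y_1\delta(x-6a)+y_1\delta(x-7a)+y_2\delta(x-8a),$$ with $y_1=a^{-3/2}-a^{-1}$, $y_2=a^{-1/2}-a^{-1}$, and let $V_0(x)=\sum_{n\ge1}V_{a_n}(x-b_{n-1})$ on $(0,b)$. Let $(g_n^\omega)_{n\ge1}$ be independent real random variables on a probability space with measure $\nu$ (expectation $\mathbb E$) such that, for some $\lambda>0$ and some constants $C_1,C_4,\epsilon>0$, for all $n\ge1$, $$\mathbb E(g_n^2)=\lambda^2n^{-1},\qquad \mathbb E(g_n^4)\le C_4\lambda^4n^{-2},\qquad \mathbb E(g_n)=0,\qquad \sup_\omega|g_n^\omega|\le C_1n^{-1/3-\epsilon}.$$ Set $V_\omega(x)=V_0(x)+\sum_{n\ge1}g_n^\omega\,\delta(x-b_n)$. A solution of $-u''+V_\omega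 u=Eu$ is a real function $u$, continuous on $[0,b)$, which satisfies $-u''=Eu$ off the points of the comb, and whose derivative jumps by $c\,u(x_0)$ at each point $x_0$ of the comb, where $c$ is the total strength of the delta distributions of $V_\omega$ at $x_0$; the value of $u'$ at $0$ and at points of the comb is its limit from the right. Fix $\phi\in(0,\pi)$ with $\phi\ne\frac\pi4,\frac\pi2,\frac{3\pi}4$, and let $E$ be given by $\cos\phi=1-\frac56E$. The Prüfer variables $R_n>0$, $\theta_n\in\mathbb R$ $(n\ge0)$ of a nonzero solution $u$ are defined by $$\begin{pmatrix}u(b_n)\\u'(b_n)\end{pmatrix}=iR_ne^{i\theta_n}\begin{pmatrix}1\\1-e^{-i\phi}\end{pmatrix}-iR_ne^{-i\theta_n}\begin{pmatrix}1\\1-e^{i\phi}\end{pmatrix}.$$ **Proposition.** For $\nu$-a.e. $\omega$ there are an initial angle $\theta_\omega\in[0,2\pi)$ and a solution $u=u_{\theta_\omega}$ of $-u''+V_\omega u=Eu$ with $u(0)^2+u'(0)^2=1$ and $\theta_0=\theta_\omega$ whose Prüfer radii satisfy $$\lim_{n\to\infty}\frac{\ln R_n}{\ln n}=-\frac{\lambda^2}{8\sin^2\phi}.$$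 Moreover this solution is decaying, in the sense that $R_n\to0$, and subordinate at $b$: for every solution $v$ of the same equation that is linearly independent of $u$, $$\lim_{L\to b}\frac{\|u\|_L}{\|v\|_L}=0,\qquad \|w\|_L=\Big(\int_0^L|w(x)|^2\,dx\Big)^{1/2}.$$ -/

import Mathlib

/-!
One-dimensional Schrödinger operators `-d²/dx² + V` on `[0, b)`, where the potential `V` is a signed
comb of delta distributions accumulating only at `b`.

Indexing: cells are numbered from `0`, so `a n`, `g n` are the `(n+1)`-st spacing and the `(n+1)`-st
random coupling constant, and cell `n` is the interval from `combNode a n` to `combNode a (n + 1)`.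
-/

namespace DeltaComb

open Set Filter Topology

noncomputable section

/-- The endpoint `bₙ = 8 a₁ + ⋯ + 8 aₙ` of the first `n` cells; in particular `b₀ = 0`. -/
def combNode (a : ℕ → ℝ) (n : ℕ) : ℝ := ∑ j ∈ Finset.range n, 8 * a j

/-- The right endpoint `b = ∑ 8 aₙ` of the interval. -/
def combEnd (a : ℕ → ℝ) : ℝ := ∑' j, 8 * a j

/-- `y₁(s) = s^(-3/2) - s^(-1)`. -/
def y₁ (s : ℝ) : ℝ := s ^ (-(3 / 2) : ℝ) - s ^ (-1 : ℝ)

/-- `y₂(s) = s^(-1/2) - s^(-1)`. -/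
def y₂ (s : ℝ) : ℝ := s ^ (-(1 / 2) : ℝ) - s ^ (-1 : ℝ)

/-- The strength of the delta distribution of `V_s` at the point `(k + 1) s`, `k = 0, …, 7`. -/
def cellStrength (s : ℝ) : Fin 8 → ℝ :=
  ![y₁ s, y₂ s, y₂ s, y₁ s, y₂ s, y₁ s, y₁ s, y₂ s]

/-- The point `bₙ + (k + 1) aₙ` of the comb: the `k`-th delta of cell `n`. -/
def combPoint (a : ℕ → ℝ) (i : ℕ × Fin 8) : ℝ :=
  combNode a i.1 + ((i.2 : ℕ) + 1 : ℝ) * a i.1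

/-- The total strength at `combPoint a i` of the comb
`V = V₀ + ∑ₙ gₙ δ(x - bₙ)`, where `V₀` consists of the translated cells `V_{aₙ}`. The perturbation
sits on the last point of each cell, which is the node `combNode a (n + 1)`. -/
def combStrength (a g : ℕ → ℝ) (i : ℕ × Fin 8) : ℝ :=
  cellStrength (a i.1) i.2 + if i.2 = 7 then g i.1 else 0

/-- The perturbation is indeed located at the nodes `bₙ`. -/
theorem combPoint_last (a : ℕ → ℝ) (n : ℕ) : combPoint a (n, 7) = combNode a (n + 1) := by
  simp only [combPoint, combNode, Finset.sum_range_succ, Fin.isValue, Fin.coe_ofNat_eq_mod]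
  norm_num

/-- `u`, with derivative `u'`, is a (real) solution on `[0, b)` of `-u'' + V u = E u`, where `V` is
the signed delta comb `∑ᵢ c i • δ(x - p i)`: `u` is continuous, it satisfies the free equation off
the points `p i`, and at `p i` its derivative jumps by `c i * u (p i)`. By convention the value of
`u'` at a point of the comb (and at `0`) is its limit from the right. -/
structure IsSolution {ι : Type*} (b : ℝ) (p c : ι → ℝ) (E : ℝ) (u u' : ℝ → ℝ) : Prop where
  continuousOn : ContinuousOn u (Ico 0 b)
  hasDerivAt : ∀ x ∈ Ioo 0 b, x ∉ range p → HasDerivAt u (u' x) x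
  hasDerivAt_deriv : ∀ x ∈ Ioo 0 b, x ∉ range p → HasDerivAt u' (-E * u x) x
  right_continuous : ∀ x ∈ Ico 0 b, ContinuousWithinAt u' (Ici x) x
  jump : ∀ i, Tendsto u' (𝓝[<] p i) (𝓝 (u' (p i) - c i * u (p i)))

/-- Solution on `[0, b)` of `-u'' + V u = E u` with `V = V₀ + ∑ₙ gₙ δ(x - bₙ)`. -/
def IsCombSolution (a g : ℕ → ℝ) (E : ℝ) (u u' : ℝ → ℝ) : Prop :=
  IsSolution (combEnd a) (combPoint a) (combStrength a g) E u u'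

/-- The eigenvector `f₊ = (1, 1 - e^{-iφ})`. -/
def fPlus (φ : ℝ) : Fin 2 → ℂ := ![1, 1 - Complex.exp (-(Complex.I * φ))]

/-- The eigenvector `f₋ = (1, 1 - e^{iφ})`. -/
def fMinus (φ : ℝ) : Fin 2 → ℂ := ![1, 1 - Complex.exp (Complex.I * φ)]

/-- `R n > 0` and `θ n` are Prüfer variables of the solution `u`: one has
`(u(bₙ), u'(bₙ)) = pₙ f₊ + qₙ f₋` with `pₙ = i Rₙ e^{iθₙ}` and `qₙ = -i Rₙ e^{-iθₙ}`. -/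
def IsPrufer (a : ℕ → ℝ) (φ : ℝ) (u u' : ℝ → ℝ) (R θ : ℕ → ℝ) : Prop :=
  ∀ n, 0 < R n ∧
    (![(u (combNode a n) : ℂ), (u' (combNode a n) : ℂ)] : Fin 2 → ℂ) =
      (Complex.I * R n * Complex.exp (Complex.I * θ n)) • fPlus φ +
        (-Complex.I * R n * Complex.exp (-(Complex.I * θ n))) • fMinus φ

/-- The norm `‖u‖_L = (∫₀ᴸ |u|²)^{1/2}`. -/
def normUpTo (u : ℝ → ℝ) (L : ℝ) : ℝ := √(∫ x in (0 : ℝ)..L, |u x| ^ 2)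

/-- `u` and `v` are linearly independent as functions on `[0, b)`. -/
def LinIndepOn (b : ℝ) (u v : ℝ → ℝ) : Prop :=
  LinearIndependent ℝ ![(Ico 0 b).domRestrict u, (Ico 0 b).domRestrict v]

/-- The solution `u` is subordinate at `b`: `‖u‖_L / ‖v‖_L → 0` as `L → b`, for every solution `v`
(of the same equation) linearly independent of `u`. -/
def IsSubordinate (a g : ℕ → ℝ) (E : ℝ) (u : ℝ → ℝ) : Prop :=
  ∀ v v' : ℝ → ℝ, IsCombSolution a g E v v' → LinIndepOn (combEnd a) u v →
    Tendsto (fun L => normUpTo u L / normUpTo v L) (𝓝[<] combEnd a) (𝓝 0)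

end

end DeltaComb

namespace DeltaComb

open Filter Topology Asymptotics Finset

/-! ### Summation by parts and logarithmic averages -/

/-! Write h = √aₙ. Single deltas of a cell have strength up to order h⁻³, but their product has
cancellations: across an unperturbed cell the vector (u, u') is multiplied by a matrix of
determinant 1 that differs by O(h²) = O(aₙ) from the explicit `modelCell`, also of determinant 1 and
with half trace tending to 1 - 5E/6 = cos φ (`exists_cell_bounds`). The model is elliptic for small
h, and `modelCoord` turns it into multiplication by a unimodular zₙ → e^{iφ} on ℂ. These coordinates
vary summably in n because h is monotone, the cell errors are summable because ∑ aₙ is finite, and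
the random delta acts as a shear. In the coordinates the state therefore obeys p_{n+1} = zₙpₙ + κₙ
Im(zₙpₙ) with a summable relative error, where κₙ = kₙgₙ and kₙ → 1/sin φ
(`norm_modelCoord_step_le`).

Growth. With y = zₙpₙ/|pₙ|, the increment of log|p| is κ Im(y²)/2 + κ²(1/8 - Re(y²)/4 + Re(y⁴)/8) +
O(|κ|³ + error). Since y depends on the past only, the linear terms form a martingale, which is
o(log n) by L¹-bounded martingale convergence and Kronecker's lemma; a second martingale replaces
gₙ² by its mean. The terms in y² and y⁴ rotate asymptotically by e^{2iφ} and e^{4iφ}, both different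
from 1, so their logarithmic averages vanish. What remains is kₙ²λ²/(8n), and log|pₙ| ~ β log n with
β = λ²/(8 sin²φ) for the solution starting from (1, 0) (`IsDecayingNoise.ae_tendsto_log_norm`).

Decay. Let q be a second solution. The Wronskian of p and q is deterministic and bounded above and
below, so Im(q/p) = W/|p|² is of order n^{-2β}, up to arbitrarily small powers. The increments of
Re(q/p) are again a martingale part plus a summable part, of size |p|⁻², and converge even after
multiplication by n^s for any s < 2β. Hence Re(q/p) tends to a random c at rate n^{-s}; then |q -
cp| is at most of order n^{-β}, and the Wronskian gives the matching lower bound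
(`IsRandomShear.ae_exists_decaying`).

Subordinacy. The integral of |v|² over a cell is bounded by a multiple of the squared state at its
left node, and two consecutive cells together bound that square from above
(`exists_integral_bounds`). For the decaying solution u the cell integrals tend to 0, so those up to
cell n add up to o(n); every independent solution has a component along the growing one, and its
integrals grow at least linearly in n (`tendsto_integral_div_integral`). -/

theorem abs_sum_mul_le_of_antitone {d y : ℕ → ℝ} (hd : Antitone d) (hd0 : ∀ n, 0 ≤ d n) {C : ℝ}
    (h : ∀ N, |∑ m ∈ range N, y m| ≤ C) (N : ℕ) :
    |∑ m ∈ range N, d m * y m| ≤ C * d 0 := by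
  -- Abel summation: the partial sums of y get the nonnegative weights d m - d (m + 1), which
  -- together with d N add up to d 0.
  have key : ∀ N, ∑ m ∈ range N, d m * y m = d N * ∑ m ∈ range N, y m +
      ∑ m ∈ range N, (d m - d (m + 1)) * ∑ j ∈ range (m + 1), y j := by
    intro N
    induction N with
    | zero => simp
    | succ N ih => rw [sum_range_succ, ih, sum_range_succ (fun m => (d m - d (m + 1)) * _) N,
      sum_range_succ y N]; ring
  rw [key N]
  have h1 : |d N * ∑ m ∈ range N, y m| ≤ d N * C := by
    rw [abs_mul, abs_of_nonneg (hd0 N)]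
    exact mul_le_mul_of_nonneg_left (h N) (hd0 N)
  have h2 : |∑ m ∈ range N, (d m - d (m + 1)) * ∑ j ∈ range (m + 1), y j| ≤ (d 0 - d N) * C := by
    refine (abs_sum_le_sum_abs _ _).trans ?_
    rw [← sum_range_sub' d N, sum_mul]
    refine sum_le_sum fun m _ => ?_
    have := sub_nonneg.2 (hd (Nat.le_succ m))
    rw [abs_mul, abs_of_nonneg this]
    exact mul_le_mul_of_nonneg_left (h _) this
  calc _ ≤ d N * C + (d 0 - d N) * C := (abs_add_le _ _).trans (add_le_add h1 h2)
    _ = C * d 0 := by ring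

/-- If the increments of `c`, weighted by `(m + 1) ^ s`, are summable in the conditional sense, then
`c` converges at rate `n ^ (-s)`. -/
theorem exists_limit_of_weighted_increments {c : ℕ → ℝ} {s : ℝ} (hs : 0 < s) {l : ℝ}
    (h : Tendsto (fun n => ∑ m ∈ range n, (c (m + 1) - c m) * ((m : ℝ) + 1) ^ s) atTop (𝓝 l)) :
    ∃ c₀ C : ℝ, Tendsto c atTop (𝓝 c₀) ∧ ∀ n : ℕ, |c n - c₀| ≤ C * ((n : ℝ) + 1) ^ (-s) := by
  obtain ⟨B, hB⟩ : ∃ B, ∀ n, |∑ m ∈ range n, (c (m + 1) - c m) * ((m : ℝ) + 1) ^ s| ≤ B := by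
    obtain ⟨B, hB⟩ := h.norm.bddAbove_range
    exact ⟨B, fun n => hB ⟨n, rfl⟩⟩
  have hpos : ∀ m : ℕ, (0 : ℝ) < (m : ℝ) + 1 := fun m => by positivity
  -- Abel's bound on the window starting at n, with decreasing weights (m + 1)^(-s). A block of the
  -- weighted series is a difference of two partial sums, hence 2 * B.
  have win : ∀ n N : ℕ, |c (n + N) - c n| ≤ 2 * B * ((n : ℝ) + 1) ^ (-s) := by
    intro n N
    have h1 := abs_sum_mul_le_of_antitone (d := fun m : ℕ => (((n + m : ℕ) : ℝ) + 1) ^ (-s))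
      (y := fun m => (c (n + m + 1) - c (n + m)) * (((n + m : ℕ) : ℝ) + 1) ^ s) (C := 2 * B)
      (fun i j hij => Real.rpow_le_rpow_of_nonpos (hpos _) (by gcongr) (by linarith))
      (fun m => by positivity)
      (fun M => by
        have : ∑ m ∈ range M, (c (n + m + 1) - c (n + m)) * (((n + m : ℕ) : ℝ) + 1) ^ s =
            ∑ m ∈ range (n + M), (c (m + 1) - c m) * ((m : ℝ) + 1) ^ s -
            ∑ m ∈ range n, (c (m + 1) - c m) * ((m : ℝ) + 1) ^ s := by
          rw [sum_range_add, add_sub_cancel_left]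
        rw [this]
        exact (abs_sub _ _).trans (by linarith [hB (n + M), hB n])) N
    have h2 : ∑ m ∈ range N, (((n + m : ℕ) : ℝ) + 1) ^ (-s) *
        ((c (n + m + 1) - c (n + m)) * (((n + m : ℕ) : ℝ) + 1) ^ s) = c (n + N) - c n := by
      rw [show c (n + N) - c n = c (n + N) - c (n + 0) from rfl,
        ← sum_range_sub (fun m => c (n + m)) N]
      refine sum_congr rfl fun m _ => ?_
      have : (((n + m : ℕ) : ℝ) + 1) ^ (-s) * (((n + m : ℕ) : ℝ) + 1) ^ s = 1 := by
        rw [← Real.rpow_add (hpos _)]; simp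
      rw [mul_left_comm, this, mul_one, add_assoc]
    rw [h2] at h1
    simpa using h1
  have hlim : Tendsto (fun n : ℕ => 2 * B * ((n : ℝ) + 1) ^ (-s)) atTop (𝓝 0) := by
    have : Tendsto (fun n : ℕ => (n : ℝ) + 1) atTop atTop :=
      tendsto_atTop_add_const_right _ _ tendsto_natCast_atTop_atTop
    simpa using ((tendsto_rpow_neg_atTop hs).comp this).const_mul (2 * B)
  have hc : CauchySeq c := by
    refine Metric.cauchySeq_iff'.2 fun ε hε => ?_
    obtain ⟨N, hN⟩ := (hlim.eventually (gt_mem_nhds hε)).exists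
    refine ⟨N, fun n hn => ?_⟩
    obtain ⟨k, rfl⟩ := Nat.exists_eq_add_of_le hn
    exact (win N k).trans_lt hN
  obtain ⟨c₀, hc₀⟩ := cauchySeq_tendsto_of_complete hc
  refine ⟨c₀, 2 * B, hc₀, fun n => ?_⟩
  have h3 : Tendsto (fun N => |c n - c (n + N)|) atTop (𝓝 |c n - c₀|) :=
    ((tendsto_const_nhds.sub (hc₀.comp (tendsto_add_atTop_nat n |>.congr fun k => by
      rw [add_comm]))).abs)
  refine le_of_tendsto h3 (Eventually.of_forall fun N => ?_)
  rw [abs_sub_comm]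
  exact win n N

theorem tendsto_log_add_two : Tendsto (fun n : ℕ => Real.log ((n : ℝ) + 2)) atTop atTop :=
  Real.tendsto_log_atTop.comp (tendsto_atTop_add_const_right _ _ tendsto_natCast_atTop_atTop)

theorem isLittleO_log_of_tendsto {E : Type*} [NormedAddCommGroup E] {f : ℕ → E} {l : E}
    (h : Tendsto f atTop (𝓝 l)) : f =o[atTop] fun n : ℕ => Real.log ((n : ℝ) + 2) :=
  (h.isBigO_one ℝ).trans_isLittleO ((isLittleO_const_left (c := (1 : ℝ))).2
    (Or.inr (tendsto_norm_atTop_atTop.comp tendsto_log_add_two)))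

/-- Kronecker's lemma with the weights `log (n + 2)`. -/
theorem isLittleO_log_sum_of_tendsto {x : ℕ → ℝ} {l : ℝ}
    (h : Tendsto (fun n => ∑ m ∈ range n, x m / Real.log ((m : ℝ) + 2)) atTop (𝓝 l)) :
    (fun n => ∑ m ∈ range n, x m) =o[atTop] fun n : ℕ => Real.log ((n : ℝ) + 2) := by
  set b : ℕ → ℝ := fun m => Real.log ((m : ℝ) + 2) with hb
  set S : ℕ → ℝ := fun n => ∑ m ∈ range n, x m / b m with hS
  have hbpos : ∀ m, 0 < b m := fun m => Real.log_pos (by have : (0:ℝ) ≤ m := by positivity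
                                                         linarith)
  have hbmono : ∀ m, 0 ≤ b (m + 1) - b m := fun m => sub_nonneg.2 (Real.log_le_log (by positivity)
    (by push_cast; linarith))
  -- Summation by parts around the limit l, so that the remaining sum is an average of null terms
  -- with the nonnegative weights b (m + 1) - b m.
  have key : ∀ n, ∑ m ∈ range n, x m =
      b n * (S n - l) - ∑ m ∈ range n, (b (m + 1) - b m) * (S (m + 1) - l) + b 0 * l := by
    intro n
    induction n with
    | zero => simp [hS]
    | succ n ih =>
      have h1 : S (n + 1) = S n + x n / b n := sum_range_succ _ _
      have h2 : x n = b n * (x n / b n) := by rw [mul_div_cancel₀ _ (hbpos n).ne']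
      rw [sum_range_succ, ih, sum_range_succ _ n]
      rw [h1]
      nth_rewrite 1 [h2]
      ring
  have hb1 : (fun n => b n * (S n - l)) =o[atTop] b := by
    have : (fun n => S n - l) =o[atTop] fun _ => (1 : ℝ) := by
      rw [isLittleO_one_iff]; simpa using h.sub_const l
    simpa using (isBigO_refl b atTop).mul_isLittleO this
  have hb2 : (fun n => ∑ m ∈ range n, (b (m + 1) - b m) * (S (m + 1) - l)) =o[atTop] b := by
    have h1 : (fun n => (b (n + 1) - b n) * (S (n + 1) - l)) =o[atTop]
        fun n => b (n + 1) - b n := by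
      have : (fun n => S (n + 1) - l) =o[atTop] fun _ => (1 : ℝ) := by
        rw [isLittleO_one_iff]
        simpa using (h.comp (tendsto_add_atTop_nat 1)).sub_const l
      simpa using (isBigO_refl (fun n => b (n + 1) - b n) atTop).mul_isLittleO this
    have h2 := h1.sum_range hbmono (by
      simp_rw [sum_range_sub]
      exact tendsto_atTop_add_const_right _ _ tendsto_log_add_two)
    simp_rw [sum_range_sub] at h2
    refine h2.trans_isBigO ((isBigO_refl b atTop).sub ?_)
    exact (isLittleO_log_of_tendsto tendsto_const_nhds).isBigO
  refine ((hb1.sub hb2).add (isLittleO_log_of_tendsto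
    (tendsto_const_nhds (x := b 0 * l)))).congr_left fun n => (key n).symm

theorem tendsto_sum_inv_div_log :
    Tendsto (fun n : ℕ => (∑ m ∈ range n, ((m : ℝ) + 1)⁻¹) / Real.log ((n : ℝ) + 2)) atTop
      (𝓝 1) := by
  have h1 := Real.tendsto_harmonic_sub_log_add_one
  have h2 : Tendsto (fun n : ℕ => Real.log ((n : ℝ) + 2) - Real.log ((n : ℝ) + 1)) atTop (𝓝 0) := by
    have h3 : Tendsto (fun n : ℕ => 1 + 1 / ((n : ℝ) + 1)) atTop (𝓝 1) := by
      simpa using tendsto_one_div_add_atTop_nhds_zero_nat (𝕜 := ℝ) |>.const_add 1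
    have h4 := (Real.continuousAt_log one_ne_zero).tendsto.comp h3
    rw [Real.log_one] at h4
    refine h4.congr fun n => ?_
    have : (0 : ℝ) < n + 1 := by positivity
    simp only [Function.comp]
    rw [← Real.log_div (by positivity) this.ne']
    congr 1
    field_simp
    ring
  have h5 : (fun n : ℕ => (∑ m ∈ range n, ((m : ℝ) + 1)⁻¹) - Real.log ((n : ℝ) + 2)) =o[atTop]
      fun n : ℕ => Real.log ((n : ℝ) + 2) := by
    refine isLittleO_log_of_tendsto (l := Real.eulerMascheroniConstant - 0) ((h1.sub h2).congr fun n => ?_)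
    simp only [harmonic]
    push_cast
    ring
  have h6 := h5.tendsto_div_nhds_zero.add_const 1
  rw [zero_add] at h6
  refine h6.congr fun n => ?_
  have : 0 < Real.log ((n : ℝ) + 2) := Real.log_pos (by have : (0:ℝ) ≤ n := by positivity
                                                        linarith)
  field_simp
  ring

/-- The weights 1/(m + 1) have sums asymptotic to log n, so this is a Cesàro statement for
logarithmic averages. -/
theorem isLittleO_log_sum_div {E : Type*} [NormedAddCommGroup E] [NormedSpace ℝ E] {δ : ℕ → E}
    (h : Tendsto δ atTop (𝓝 0)) :
    (fun n => ∑ m ∈ range n, ((m : ℝ) + 1)⁻¹ • δ m) =o[atTop]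
      fun n : ℕ => Real.log ((n : ℝ) + 2) := by
  have h0 : (fun n : ℕ => ∑ m ∈ range n, ((m : ℝ) + 1)⁻¹) =O[atTop]
      fun n : ℕ => Real.log ((n : ℝ) + 2) := by
    refine isBigO_of_div_tendsto_nhds (Eventually.of_forall fun n hn => ?_) 1
      tendsto_sum_inv_div_log
    exact absurd hn (Real.log_pos (by have : (0:ℝ) ≤ n := by positivity
                                      linarith)).ne'
  have h1 : (fun n : ℕ => ((n : ℝ) + 1)⁻¹ • δ n) =o[atTop] fun n : ℕ => ((n : ℝ) + 1)⁻¹ := by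
    have : δ =o[atTop] fun _ => (1 : ℝ) := (isLittleO_one_iff ℝ).2 h
    simpa using (isBigO_refl (fun n : ℕ => ((n : ℝ) + 1)⁻¹) atTop).smul_isLittleO this
  refine (h1.sum_range (fun n => by positivity) ?_).trans_isBigO h0
  have := (tendsto_sum_inv_div_log.pos_mul_atTop one_pos tendsto_log_add_two)
  refine this.congr fun n => ?_
  exact div_mul_cancel₀ _ (Real.log_pos (by have : (0:ℝ) ≤ n := by positivity
                                            linarith)).ne'

/-- Logarithmic averages of an asymptotically rotating bounded sequence vanish. -/
theorem isLittleO_log_sum_rotating {Y : ℕ → ℂ} (hY : ∀ n, ‖Y n‖ ≤ 1) {ζ : ℂ} (hζ : ζ ≠ 1)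
    (h : Tendsto (fun n => Y (n + 1) - ζ * Y n) atTop (𝓝 0)) :
    (fun n => ∑ m ∈ range n, ((m : ℝ) + 1)⁻¹ • Y m) =o[atTop]
      fun n : ℕ => Real.log ((n : ℝ) + 2) := by
  have h1 := isLittleO_log_sum_div h
  have key : ∀ n : ℕ, ∑ m ∈ range n, ((m : ℝ) + 1)⁻¹ • (Y (m + 1) - Y m) =
      ((n : ℝ) + 1)⁻¹ • Y n - Y 0 +
        ∑ m ∈ range n, (((m : ℝ) + 1)⁻¹ - ((m : ℝ) + 1 + 1)⁻¹) • Y (m + 1) := by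
    intro n
    induction n with
    | zero => simp
    | succ n ih => rw [sum_range_succ, ih, sum_range_succ _ n]; push_cast; module
  -- Telescoping against a decreasing weight costs only a bounded amount: boundary terms plus the
  -- total variation of the weight.
  have h2 : ∀ n : ℕ, ‖∑ m ∈ range n, ((m : ℝ) + 1)⁻¹ • (Y (m + 1) - Y m)‖ ≤ 3 := by
    intro n
    rw [key n]
    have e1 : ‖((n : ℝ) + 1)⁻¹ • Y n‖ ≤ 1 := by
      rw [norm_smul, Real.norm_of_nonneg (by positivity)]
      exact mul_le_one₀ (inv_le_one_of_one_le₀ (by have : (0:ℝ) ≤ n := by positivity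
                                                   linarith)) (norm_nonneg _) (hY n)
    have e2 : ‖∑ m ∈ range n, (((m : ℝ) + 1)⁻¹ - ((m : ℝ) + 1 + 1)⁻¹) • Y (m + 1)‖ ≤ 1 := by
      calc _ ≤ ∑ m ∈ range n, (((m : ℝ) + 1)⁻¹ - (((m + 1 : ℕ) : ℝ) + 1)⁻¹) := by
            refine (norm_sum_le _ _).trans (sum_le_sum fun m _ => ?_)
            have : 0 ≤ ((m : ℝ) + 1)⁻¹ - ((m : ℝ) + 1 + 1)⁻¹ :=
              sub_nonneg.2 (inv_anti₀ (by positivity) (by linarith))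
            rw [norm_smul, Real.norm_of_nonneg this]
            push_cast
            exact mul_le_of_le_one_right this (hY _)
        _ = 1 - ((n : ℝ) + 1)⁻¹ := by
            rw [sum_range_sub' (fun m : ℕ => ((m : ℝ) + 1)⁻¹)]; simp
        _ ≤ 1 := by linarith [show (0:ℝ) ≤ ((n : ℝ) + 1)⁻¹ by positivity]
    calc _ ≤ ‖((n : ℝ) + 1)⁻¹ • Y n‖ + ‖Y 0‖ + _ :=
          (norm_add_le _ _).trans (add_le_add_left (norm_sub_le _ _) _)
      _ ≤ 1 + 1 + 1 := add_le_add (add_le_add e1 (hY 0)) e2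
      _ = 3 := by norm_num
  have h3 : (fun n => ∑ m ∈ range n, ((m : ℝ) + 1)⁻¹ • (Y (m + 1) - Y m)) =o[atTop]
      fun n : ℕ => Real.log ((n : ℝ) + 2) :=
    (IsBigO.of_bound 3 (Eventually.of_forall fun n => by simpa using h2 n) :
      _ =O[atTop] fun _ => (1 : ℝ)).trans_isLittleO
      (isLittleO_log_of_tendsto (tendsto_const_nhds (x := (1 : ℝ))))
  -- Pointwise, (ζ - 1) Y m is the telescoping difference minus the null sequence Y (m + 1) - ζ Y m;
  -- this is where ζ ≠ 1 enters.
  have h4 : ∀ n, ∑ m ∈ range n, ((m : ℝ) + 1)⁻¹ • Y m =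
      (ζ - 1)⁻¹ * (∑ m ∈ range n, ((m : ℝ) + 1)⁻¹ • (Y (m + 1) - Y m) -
        ∑ m ∈ range n, ((m : ℝ) + 1)⁻¹ • (Y (m + 1) - ζ * Y m)) := by
    intro n
    rw [← sum_sub_distrib, mul_sum]
    refine sum_congr rfl fun m _ => ?_
    have : ζ - 1 ≠ 0 := sub_ne_zero.2 hζ
    rw [← smul_sub, mul_smul_comm]
    congr 1
    field_simp
    ring
  exact ((h3.sub h1).const_mul_left _).congr_left fun n => (h4 n).symm

end DeltaComb

namespace DeltaComb

open Filter Topology Finset MeasureTheory ProbabilityTheory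

/-! ### Almost sure convergence of predictable transforms of independent centred sequences -/

section Martingale

variable {Ω : Type*}

/-- The σ-algebra generated by `g 0, …, g (n - 1)`. -/
abbrev past (g : ℕ → Ω → ℝ) (n : ℕ) : MeasurableSpace Ω :=
  ⨆ i ∈ {i | i < n}, MeasurableSpace.comap (g i) inferInstance

theorem past_mono (g : ℕ → Ω → ℝ) : Monotone (past g) := fun _ _ h =>
  biSup_mono fun _ hi => lt_of_lt_of_le hi h

theorem measurable_past (g : ℕ → Ω → ℝ) {i n : ℕ} (h : i < n) : Measurable[past g n] (g i) :=
  (comap_measurable (g i)).mono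
    (le_iSup₂ (f := fun i (_ : i ∈ {i | i < n}) => MeasurableSpace.comap (g i) inferInstance) i h)
    le_rfl

variable [mΩ : MeasurableSpace Ω] {ν : Measure Ω}

theorem past_le {g : ℕ → Ω → ℝ} (hg : ∀ n, Measurable (g n)) (n : ℕ) : past g n ≤ mΩ :=
  iSup₂_le fun i _ => (hg i).comap_le

/-- The filtration of the σ-algebras `past g n`. -/
def pastFiltration {g : ℕ → Ω → ℝ} (hg : ∀ n, Measurable (g n)) : Filtration ℕ mΩ where
  seq := past g
  mono' := past_mono g
  le' := past_le hg

/-- Grouping the independent variables into {n} and {i | i < n} gives what makes the n-th term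
conditionally centred. -/
theorem indep_comap_past {g : ℕ → Ω → ℝ} (hg : ∀ n, Measurable (g n)) (hi : iIndepFun g ν)
    (n : ℕ) : Indep (MeasurableSpace.comap (g n) inferInstance) (past g n) ν := by
  have h := indep_iSup_of_disjoint (fun i => (hg i).comap_le) hi (S := {n}) (T := {i | i < n})
    (by simp)
  simpa [past] using h

variable [IsProbabilityMeasure ν]

theorem integrable_of_bounded {f : Ω → ℝ} (hf : Measurable f) {C : ℝ} (h : ∀ ω, |f ω| ≤ C) :
    Integrable f ν :=
  Integrable.of_bound hf.aestronglyMeasurable C (Eventually.of_forall h)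

/-- A random series of predictable multiples of independent, centred, bounded variables converges
almost surely if the sum of the second moments is finite. -/
theorem ae_exists_tendsto_sum_predictable {g : ℕ → Ω → ℝ} (hg : ∀ n, Measurable (g n))
    (hi : iIndepFun g ν) {f : ℕ → ℝ → ℝ} (hf : ∀ n, Measurable (f n))
    (hfb : ∀ n, ∃ C, ∀ ω, |f n (g n ω)| ≤ C) (hf0 : ∀ n, ∫ ω, f n (g n ω) ∂ν = 0)
    {H : ℕ → Ω → ℝ} (hH : ∀ n, Measurable[past g n] (H n)) {w : ℕ → ℝ}
    (hHw : ∀ n ω, |H n ω| ≤ w n)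
    (hs : Summable fun n => w n ^ 2 * ∫ ω, f n (g n ω) ^ 2 ∂ν) :
    ∀ᵐ ω ∂ν, ∃ l, Tendsto (fun n => ∑ m ∈ range n, H m ω * f m (g m ω)) atTop (𝓝 l) := by
  choose C hC using hfb
  have hHm : ∀ n, Measurable (H n) := fun n => (hH n).mono (past_le hg n) le_rfl
  have hξm : ∀ n, Measurable fun ω => f n (g n ω) := fun n => (hf n).comp (hg n)
  set X : ℕ → Ω → ℝ := fun n ω => H n ω * f n (g n ω) with hX
  set S : ℕ → Ω → ℝ := fun n ω => ∑ m ∈ range n, X m ω with hS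
  have hXm : ∀ n, Measurable (X n) := fun n => (hHm n).mul (hξm n)
  have hXb : ∀ n ω, |X n ω| ≤ w n * C n := fun n ω => by
    rw [hX, abs_mul]
    exact mul_le_mul (hHw n ω) (hC n ω) (abs_nonneg _) ((abs_nonneg _).trans (hHw n ω))
  have hSm : ∀ n, Measurable (S n) := fun n => Finset.measurable_sum _ fun m _ => hXm m
  have hSb : ∀ n ω, |S n ω| ≤ ∑ m ∈ range n, w m * C m := fun n ω =>
    (abs_sum_le_sum_abs _ _).trans (sum_le_sum fun m _ => hXb m ω)
  have hSpast : ∀ n, Measurable[past g n] (S n) := fun n =>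
    Finset.measurable_sum _ fun m hm => by
      have hmn := Finset.mem_range.1 hm
      exact ((hH m).mono (past_mono g hmn.le) le_rfl).mul ((hf m).comp (measurable_past g hmn))
  have hXint : ∀ n, Integrable (X n) ν := fun n => integrable_of_bounded (hXm n) (hXb n)
  have hSint : ∀ n, Integrable (S n) ν := fun n => integrable_of_bounded (hSm n) (hSb n)
  have hmart : Martingale S (pastFiltration hg) ν := by
    refine martingale_of_condExp_sub_eq_zero_nat (fun n => (hSpast n).stronglyMeasurable) hSint
      fun n => ?_
    have h1 : S (n + 1) - S n = H n * fun ω => f n (g n ω) := by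
      ext ω
      simp [hS, hX, sum_range_succ]
    rw [h1]
    have h2 := condExp_mul_of_stronglyMeasurable_left (m := past g n) (μ := ν)
      (f := H n) (g := fun ω => f n (g n ω)) (hH n).stronglyMeasurable (hXint n)
      (integrable_of_bounded (hξm n) (hC n))
    have h3 := condExp_indep_eq (hg n).comap_le (past_le hg n) (f := fun ω => f n (g n ω))
      ((hf n).comp (comap_measurable (g n))).stronglyMeasurable (indep_comap_past hg hi n)
    refine h2.trans ?_
    filter_upwards [h3] with ω hω
    simp [hω, hf0 n]
  -- Martingale increments are orthogonal, so second moments add; the cross term vanishes because S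
  -- n * H n is measurable with respect to the past.
  have hsq : ∀ n, ∫ ω, S n ω ^ 2 ∂ν ≤ ∑ m ∈ range n, w m ^ 2 * ∫ ω, f m (g m ω) ^ 2 ∂ν := by
    intro n
    induction n with
    | zero => simp [hS]
    | succ n ih =>
      have hSH : Measurable[past g n] fun ω => S n ω * H n ω := (hSpast n).mul (hH n)
      have hind : IndepFun (fun ω => S n ω * H n ω) (fun ω => f n (g n ω)) ν := by
        have h1 := (indep_comap_past hg hi n).symm
        exact indep_of_indep_of_le_left (indep_of_indep_of_le_right h1
          ((hf n).comp (comap_measurable (g n))).comap_le) hSH.comap_le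
      have h0 : ∫ ω, S n ω * X n ω ∂ν = 0 := by
        have h1 := hind.integral_fun_mul_eq_mul_integral
          ((hSm n).mul (hHm n)).aestronglyMeasurable (hξm n).aestronglyMeasurable
        rw [hf0 n, mul_zero] at h1
        rw [← h1]
        exact integral_congr_ae (Eventually.of_forall fun ω => by simp only [hX]; ring)
      have i1 : Integrable (fun ω => S n ω ^ 2) ν :=
        integrable_of_bounded ((hSm n).pow_const 2) (C := (∑ m ∈ range n, w m * C m) ^ 2)
          fun ω => by rw [abs_pow]; exact pow_le_pow_left₀ (abs_nonneg _) (hSb n ω) 2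
      have i2 : Integrable (fun ω => X n ω ^ 2) ν :=
        integrable_of_bounded ((hXm n).pow_const 2) (C := (w n * C n) ^ 2)
          fun ω => by rw [abs_pow]; exact pow_le_pow_left₀ (abs_nonneg _) (hXb n ω) 2
      have i3 : Integrable (fun ω => S n ω * X n ω) ν :=
        integrable_of_bounded ((hSm n).mul (hXm n))
          (C := (∑ m ∈ range n, w m * C m) * (w n * C n)) fun ω => by
            rw [abs_mul]
            exact mul_le_mul (hSb n ω) (hXb n ω) (abs_nonneg _) ((abs_nonneg _).trans (hSb n ω))
      have i4 : Integrable (fun ω => f n (g n ω) ^ 2) ν :=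
        integrable_of_bounded ((hξm n).pow_const 2) (C := (C n) ^ 2)
          fun ω => by rw [abs_pow]; exact pow_le_pow_left₀ (abs_nonneg _) (hC n ω) 2
      have h1 : ∫ ω, S (n + 1) ω ^ 2 ∂ν = ∫ ω, S n ω ^ 2 ∂ν + ∫ ω, X n ω ^ 2 ∂ν := by
        have : ∀ ω, S (n + 1) ω ^ 2 = S n ω ^ 2 + X n ω ^ 2 + 2 * (S n ω * X n ω) := fun ω => by
          simp only [hS, sum_range_succ]; ring
        simp_rw [this]
        have i5 : Integrable (fun ω => S n ω ^ 2 + X n ω ^ 2) ν := i1.add i2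
        rw [integral_add i5 (i3.const_mul 2), integral_add i1 i2, integral_const_mul, h0]
        simp
      have h2 : ∫ ω, X n ω ^ 2 ∂ν ≤ w n ^ 2 * ∫ ω, f n (g n ω) ^ 2 ∂ν := by
        rw [← integral_const_mul]
        refine integral_mono i2 (i4.const_mul _) fun ω => ?_
        simp only [hX, mul_pow]
        refine mul_le_mul_of_nonneg_right ?_ (sq_nonneg _)
        rw [← sq_abs]
        exact pow_le_pow_left₀ (abs_nonneg _) (hHw n ω) 2
      rw [h1, sum_range_succ]
      exact add_le_add ih h2
  set T : ℝ := ∑' n, w n ^ 2 * ∫ ω, f n (g n ω) ^ 2 ∂ν with hT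
  have hnn : ∀ n, 0 ≤ w n ^ 2 * ∫ ω, f n (g n ω) ^ 2 ∂ν := fun n =>
    mul_nonneg (sq_nonneg _) (integral_nonneg fun ω => sq_nonneg _)
  -- The convergence theorem asks for a uniform L¹ bound, which follows from the L² bound through
  -- |S| ≤ 1 + S².
  have hbd : ∀ n, eLpNorm (S n) 1 ν ≤ ((1 + T).toNNReal : ENNReal) := by
    intro n
    rw [eLpNorm_one_eq_lintegral_enorm, ← ofReal_integral_norm_eq_lintegral_enorm (hSint n)]
    refine ENNReal.ofReal_le_ofReal ?_
    have i1 : Integrable (fun ω => S n ω ^ 2) ν :=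
      integrable_of_bounded ((hSm n).pow_const 2) (C := (∑ m ∈ range n, w m * C m) ^ 2)
        fun ω => by rw [abs_pow]; exact pow_le_pow_left₀ (abs_nonneg _) (hSb n ω) 2
    calc ∫ ω, ‖S n ω‖ ∂ν ≤ ∫ ω, (1 + S n ω ^ 2) ∂ν :=
          integral_mono (hSint n).norm ((integrable_const 1).add i1) fun ω => by
            simp only [Real.norm_eq_abs]
            nlinarith [sq_abs (S n ω), sq_nonneg (|S n ω| - 1), sq_nonneg (S n ω)]
      _ = 1 + ∫ ω, S n ω ^ 2 ∂ν := by rw [integral_add (integrable_const 1) i1]; simp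
      _ ≤ 1 + T := by
          gcongr
          exact (hsq n).trans (hs.sum_le_tsum _ fun m _ => hnn m)
  filter_upwards [hmart.submartingale.ae_tendsto_limitProcess hbd] with ω hω
  exact ⟨_, hω⟩

end Martingale

end DeltaComb

namespace DeltaComb

open Filter Topology Asymptotics Finset

/-! ### Growth of a perturbed rotation -/

theorem abs_log_le_two_mul {x : ℝ} (hx : 1 / 2 ≤ x) : |Real.log x| ≤ 2 * |x - 1| := by
  have h0 : 0 < x := by linarith
  have h1 := Real.log_le_sub_one_of_pos h0
  have h2 := Real.one_sub_inv_le_log_of_pos h0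
  have h3 : 1 - x⁻¹ = (x - 1) * x⁻¹ := by field_simp
  have h4 : x⁻¹ ≤ 2 := by
    rw [inv_le_comm₀ h0 (by norm_num)]; linarith
  have h5 : |(x - 1) * x⁻¹| ≤ |x - 1| * 2 := by
    rw [abs_mul, abs_of_pos (inv_pos.2 h0)]
    exact mul_le_mul_of_nonneg_left h4 (abs_nonneg _)
  rw [abs_le]
  constructor
  · have := (abs_le.1 h5).1
    linarith
  · have := le_abs_self (x - 1)
    linarith [abs_nonneg (x - 1)]

/-- Here 1 + κI + κ²J is the squared length of a sheared unit vector, with I = 2 Re y Im y and J =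
(Im y)². The Taylor remainder of the logarithm accounts for 4|κ|³, and replacing t² by κ²I² for
2|κ|³. -/
theorem abs_log_quadratic_sub_le {κ I J : ℝ} (hκ : |κ| ≤ 1 / 4) (hI : |I| ≤ 1) (hJ0 : 0 ≤ J)
    (hJ1 : J ≤ 1) :
    |Real.log (1 + (κ * I + κ ^ 2 * J)) - (κ * I + κ ^ 2 * (J - I ^ 2 / 2))| ≤ 6 * |κ| ^ 3 := by
  obtain ⟨t, ht⟩ : ∃ t, t = κ * I + κ ^ 2 * J := ⟨_, rfl⟩
  have hκ0 := abs_nonneg κ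
  have hκsq : κ ^ 2 = |κ| ^ 2 := (sq_abs κ).symm
  have htk : |t| ≤ 5 / 4 * |κ| := by
    calc |t| ≤ |κ * I| + |κ ^ 2 * J| := ht ▸ abs_add_le _ _
      _ ≤ |κ| * 1 + |κ| ^ 2 * 1 := by
        rw [abs_mul, abs_mul, abs_of_nonneg hJ0, abs_of_nonneg (sq_nonneg κ), hκsq]
        gcongr
      _ ≤ _ := by nlinarith
  have e2 : |Real.log (1 + t) - t + t ^ 2 / 2| ≤ 4 * |κ| ^ 3 := by
    have h1 := Real.abs_log_sub_add_sum_range_le (x := -t) (by rw [abs_neg]; linarith) 2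
    rw [sum_range_succ, sum_range_one] at h1
    norm_num at h1
    have h2 : |t| ^ 3 / (1 - |t|) ≤ 4 * |κ| ^ 3 := by
      rw [div_le_iff₀ (by linarith)]
      have h3 : |t| ^ 3 ≤ (5 / 4 * |κ|) ^ 3 := pow_le_pow_left₀ (abs_nonneg _) htk 3
      have h4 : 0 ≤ |κ| ^ 3 := by positivity
      rw [mul_pow] at h3
      have h5 : 11 / 16 ≤ 1 - |t| := by linarith
      calc |t| ^ 3 ≤ 4 * |κ| ^ 3 * (11 / 16) := by linarith
        _ ≤ _ := by gcongr
    calc _ = |-t + t ^ 2 / 2 + Real.log (1 + t)| := by congr 1; ring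
      _ ≤ _ := h1.trans h2
  have e3 : |t ^ 2 / 2 - κ ^ 2 * I ^ 2 / 2| ≤ 2 * |κ| ^ 3 := by
    have h1 : t ^ 2 / 2 - κ ^ 2 * I ^ 2 / 2 = κ ^ 3 * (I * J) + κ ^ 3 * (κ * J ^ 2 / 2) := by
      rw [ht]; ring
    have h3 : |I * J| ≤ 1 := by
      rw [abs_mul, abs_of_nonneg hJ0]
      exact mul_le_one₀ hI hJ0 hJ1
    have h4 : |κ * J ^ 2 / 2| ≤ 1 := by
      have h5 : J ^ 2 ≤ 1 := pow_le_one₀ hJ0 hJ1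
      rw [abs_div, abs_mul, abs_of_nonneg (sq_nonneg J), abs_two]
      have : |κ| * J ^ 2 ≤ 1 := mul_le_one₀ (by linarith) (sq_nonneg J) h5
      linarith
    rw [h1]
    calc _ ≤ |κ ^ 3 * (I * J)| + |κ ^ 3 * (κ * J ^ 2 / 2)| := abs_add_le _ _
      _ ≤ |κ| ^ 3 * 1 + |κ| ^ 3 * 1 := by
        rw [abs_mul, abs_mul (κ ^ 3), abs_pow]
        gcongr
      _ = _ := by ring
  rw [← ht]
  have e5 : Real.log (1 + t) - (κ * I + κ ^ 2 * (J - I ^ 2 / 2)) =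
      (Real.log (1 + t) - t + t ^ 2 / 2) - (t ^ 2 / 2 - κ ^ 2 * I ^ 2 / 2) := by
    rw [ht]; ring
  rw [e5]
  exact (abs_sub _ _).trans (by linarith)

theorem abs_log_norm_add_sub_le {A δ : ℂ} (hA : 1 / 2 ≤ ‖A‖) (hδ : ‖δ‖ ≤ 1 / 4) :
    |Real.log ‖A + δ‖ - Real.log ‖A‖| ≤ 4 * ‖δ‖ := by
  have hApos : 0 < ‖A‖ := by linarith
  have h1 : |‖A + δ‖ - ‖A‖| ≤ ‖δ‖ := by
    have := abs_norm_sub_norm_le (A + δ) A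
    simpa using this
  have h2 : |‖A + δ‖ / ‖A‖ - 1| ≤ 2 * ‖δ‖ := by
    have : ‖A + δ‖ / ‖A‖ - 1 = (‖A + δ‖ - ‖A‖) / ‖A‖ := by field_simp
    rw [this, abs_div, abs_of_pos hApos, div_le_iff₀ hApos]
    nlinarith [norm_nonneg δ]
  have h3 : 1 / 2 ≤ ‖A + δ‖ / ‖A‖ := by linarith [(abs_le.1 h2).1]
  have h4 : ‖A + δ‖ ≠ 0 := by
    intro h
    rw [h] at h3; norm_num at h3
  rw [← Real.log_div h4 hApos.ne']
  linarith [abs_log_le_two_mul h3]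

/-- Second order expansion of the growth of a sheared unit vector. -/
theorem abs_log_norm_shear_sub_le {y δ : ℂ} (hy : ‖y‖ = 1) {κ : ℝ} (hκ : |κ| ≤ 1 / 4)
    (hδ : ‖δ‖ ≤ 1 / 4) :
    |Real.log ‖y + (κ * y.im : ℝ) + δ‖ -
      (κ * (y ^ 2).im / 2 + κ ^ 2 * (1 / 8 - (y ^ 2).re / 4 + ((y ^ 2) ^ 2).re / 8))| ≤
      10 * |κ| ^ 3 + 4 * ‖δ‖ := by
  have hy2 : y.re ^ 2 + y.im ^ 2 = 1 := by
    have := Complex.sq_norm y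
    rw [hy, Complex.normSq_apply] at this
    linarith
  have hIe : (y ^ 2).im = 2 * y.re * y.im := by simp [sq, Complex.mul_im]; ring
  have hRe : (y ^ 2).re = y.re ^ 2 - y.im ^ 2 := by simp [sq, Complex.mul_re]
  have h4e : ((y ^ 2) ^ 2).re = 1 - 2 * (2 * y.re * y.im) ^ 2 := by
    rw [sq (y ^ 2), Complex.mul_re, hRe, hIe]
    linear_combination (y.re ^ 2 + y.im ^ 2 + 1) * hy2
  have hI1 : |2 * y.re * y.im| ≤ 1 := by
    rw [abs_le]
    constructor <;> nlinarith [sq_nonneg (y.re - y.im), sq_nonneg (y.re + y.im)]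
  have hJ1 : y.im ^ 2 ≤ 1 := by nlinarith [sq_nonneg y.re]
  have hL := abs_log_quadratic_sub_le hκ hI1 (sq_nonneg y.im) hJ1
  have hnA : ‖y + (κ * y.im : ℝ)‖ ^ 2 = 1 + (κ * (2 * y.re * y.im) + κ ^ 2 * y.im ^ 2) := by
    rw [Complex.sq_norm, Complex.normSq_apply]
    simp
    linear_combination hy2
  have hA1 : 1 / 2 ≤ ‖y + (κ * y.im : ℝ)‖ := by
    have h1 := norm_sub_norm_le y (-((κ * y.im : ℝ) : ℂ))
    have h2 : |κ * y.im| ≤ 1 / 4 := by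
      rw [abs_mul]
      have := (Complex.abs_im_le_norm y).trans hy.le
      nlinarith [abs_nonneg κ, abs_nonneg y.im]
    rw [norm_neg, Complex.norm_real, Real.norm_eq_abs, sub_neg_eq_add, hy] at h1
    linarith
  have e1 := abs_log_norm_add_sub_le hA1 hδ
  have e4 : Real.log ‖y + (κ * y.im : ℝ)‖ =
      Real.log (1 + (κ * (2 * y.re * y.im) + κ ^ 2 * y.im ^ 2)) / 2 := by
    rw [← hnA, Real.log_pow]; push_cast; ring
  rw [e4] at e1
  have hr : y.im ^ 2 = (1 - (y.re ^ 2 - y.im ^ 2)) / 2 := by linarith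
  rw [h4e, hRe, hIe]
  have : 0 ≤ |κ| ^ 3 := by positivity
  -- On the unit circle J = (1 - Re y²)/2 and I² = (1 - Re y⁴)/2, so (J - I²/2)/2 has constant term
  -- 1/8; this is the 8 in the decay rate.
  have e6 : κ ^ 2 * (y.im ^ 2 - (2 * y.re * y.im) ^ 2 / 2) = 2 * (κ ^ 2 *
      (1 / 8 - (y.re ^ 2 - y.im ^ 2) / 4 + (1 - 2 * (2 * y.re * y.im) ^ 2) / 8)) := by
    linear_combination κ ^ 2 * hr
  rw [e6] at hL
  rw [abs_le] at e1 hL ⊢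
  constructor <;> linarith [e1.1, e1.2, hL.1, hL.2]

/-- The unit vector `z p / |p|`. -/
noncomputable def direction (z p : ℂ) : ℂ := z * p / (‖p‖ : ℂ)

theorem norm_direction {z p : ℂ} (hz : ‖z‖ = 1) (hp : p ≠ 0) : ‖direction z p‖ = 1 := by
  have : ‖p‖ ≠ 0 := norm_ne_zero_iff.2 hp
  simp [direction, hz, this]

theorem norm_mul_direction {z p : ℂ} (hp : p ≠ 0) : (‖p‖ : ℂ) * direction z p = z * p := by
  have : (‖p‖ : ℂ) ≠ 0 := by exact_mod_cast norm_ne_zero_iff.2 hp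
  rw [direction, mul_div_cancel₀ _ this]

/-- A perturbed rotation `p (n + 1) ≈ z n * p n + κ n * Im (z n * p n)`. -/
structure IsShearedRotation (z : ℕ → ℂ) (κ e : ℕ → ℝ) (p : ℕ → ℂ) : Prop where
  ne_zero : ∀ n, p n ≠ 0
  norm_eq_one : ∀ n, ‖z n‖ = 1
  error : ∀ n, ‖p (n + 1) - (z n * p n + (κ n * (z n * p n).im : ℝ))‖ ≤ e n * ‖p n‖

namespace IsShearedRotation

variable {z : ℕ → ℂ} {κ e : ℕ → ℝ} {p : ℕ → ℂ}

theorem exists_error (h : IsShearedRotation z κ e p) (n : ℕ) : ∃ δ : ℂ, ‖δ‖ ≤ e n ∧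
    p (n + 1) = ‖p n‖ * (direction (z n) (p n) + (κ n * (direction (z n) (p n)).im : ℝ) + δ) := by
  have hp := h.ne_zero n
  have hp0 : (‖p n‖ : ℂ) ≠ 0 := by exact_mod_cast norm_ne_zero_iff.2 hp
  have hpp : 0 < ‖p n‖ := norm_pos_iff.2 hp
  refine ⟨(p (n + 1) - (z n * p n + (κ n * (z n * p n).im : ℝ))) / ‖p n‖, ?_, ?_⟩
  · rw [norm_div, Complex.norm_real, norm_norm, div_le_iff₀ hpp]
    exact h.error n
  · have h1 : (z n * p n).im = ‖p n‖ * (direction (z n) (p n)).im := by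
      rw [← norm_mul_direction hp, Complex.im_ofReal_mul]
    rw [mul_add, mul_add, norm_mul_direction hp, mul_div_cancel₀ _ hp0, h1]
    push_cast
    ring

/-- Shear and error move a unit vector by at most |κ| + e, and renormalising at most doubles this.
In the limit the direction just rotates by z₀. -/
theorem tendsto_direction (h : IsShearedRotation z κ e p) (hκ : Tendsto κ atTop (𝓝 0))
    (he : Tendsto e atTop (𝓝 0)) {z₀ : ℂ} (hz : Tendsto z atTop (𝓝 z₀)) :
    Tendsto (fun n => direction (z (n + 1)) (p (n + 1)) - z₀ * direction (z n) (p n)) atTop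
      (𝓝 0) := by
  choose δ hδ hδp using h.exists_error
  have hz0 : ‖z₀‖ = 1 := by
    refine tendsto_nhds_unique hz.norm ?_
    simp_rw [h.norm_eq_one]
    exact tendsto_const_nhds
  have hb : ∀ n, ‖direction (z (n + 1)) (p (n + 1)) - z₀ * direction (z n) (p n)‖ ≤
      2 * (|κ n| + e n) + ‖z (n + 1) - z₀‖ := by
    intro n
    set y := direction (z n) (p n) with hy
    have hy1 : ‖y‖ = 1 := norm_direction (h.norm_eq_one n) (h.ne_zero n)
    set B : ℂ := y + (κ n * y.im : ℝ) + δ n with hB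
    have hBy : ‖B - y‖ ≤ |κ n| + e n := by
      have : B - y = (κ n * y.im : ℝ) + δ n := by rw [hB]; ring
      rw [this]
      refine (norm_add_le _ _).trans (add_le_add ?_ (hδ n))
      rw [Complex.norm_real, Real.norm_eq_abs, abs_mul]
      exact mul_le_of_le_one_right (abs_nonneg _) ((Complex.abs_im_le_norm y).trans hy1.le)
    have hB0 : B ≠ 0 := by
      intro h0
      exact h.ne_zero (n + 1) (by rw [hδp n, ← hy, ← hB, h0, mul_zero])
    have hpn : (‖p n‖ : ℂ) ≠ 0 := by exact_mod_cast norm_ne_zero_iff.2 (h.ne_zero n)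
    have hBn : (‖B‖ : ℂ) ≠ 0 := by exact_mod_cast norm_ne_zero_iff.2 hB0
    have hd : direction (z (n + 1)) (p (n + 1)) = z (n + 1) * (B / ‖B‖) := by
      rw [direction, hδp n, ← hy, ← hB, norm_mul, Complex.norm_real, norm_norm]
      push_cast
      field_simp
    have h1 : ‖B / ‖B‖ - y‖ ≤ 2 * ‖B - y‖ := by
      have h2 : B / (‖B‖ : ℂ) - B = ((1 - ‖B‖ : ℝ) : ℂ) * (B / ‖B‖) := by
        push_cast
        field_simp
      have h3 : ‖B / (‖B‖ : ℂ) - B‖ ≤ ‖B - y‖ := by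
        rw [h2, norm_mul, norm_div, Complex.norm_real, Complex.norm_real, norm_norm,
          div_self (norm_ne_zero_iff.2 hB0), mul_one, ← hy1, Real.norm_eq_abs, abs_sub_comm]
        exact abs_norm_sub_norm_le _ _
      calc _ ≤ ‖B / (‖B‖ : ℂ) - B‖ + ‖B - y‖ := norm_sub_le_norm_sub_add_norm_sub _ _ _
        _ ≤ _ := by linarith
    rw [hd]
    have h4 : z (n + 1) * (B / ‖B‖) - z₀ * y =
        z (n + 1) * (B / ‖B‖ - y) + (z (n + 1) - z₀) * y := by ring
    rw [h4]
    refine (norm_add_le _ _).trans (add_le_add ?_ ?_)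
    · rw [norm_mul, h.norm_eq_one, one_mul]; linarith
    · rw [norm_mul, hy1, mul_one]
  refine squeeze_zero_norm hb ?_
  have h1 := ((hκ.abs.add he).const_mul 2).add ((hz.comp (tendsto_add_atTop_nat 1)).sub_const z₀).norm
  simpa using h1

/-- The deterministic half of the growth theorem. `h1` and `h2` are the two facts that probability
has to supply: the linear terms are negligible, and κ² may be replaced by its mean V m / (m + 1). -/
theorem tendsto_log_norm_div_log (h : IsShearedRotation z κ e p) (hκ : Summable fun n => |κ n| ^ 3)
    (he : Summable e) {z₀ : ℂ} (hz : Tendsto z atTop (𝓝 z₀)) (hz2 : z₀ ^ 2 ≠ 1) (hz4 : z₀ ^ 4 ≠ 1)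
    {V : ℕ → ℝ} {V₀ : ℝ} (hV : Tendsto V atTop (𝓝 V₀))
    (h1 : (fun n => ∑ m ∈ range n, κ m * (direction (z m) (p m) ^ 2).im) =o[atTop]
      fun n : ℕ => Real.log ((n : ℝ) + 2))
    (h2 : (fun n => ∑ m ∈ range n, (κ m ^ 2 - V m * ((m : ℝ) + 1)⁻¹) *
        (1 / 8 - (direction (z m) (p m) ^ 2).re / 4 +
          ((direction (z m) (p m) ^ 2) ^ 2).re / 8)) =o[atTop]
      fun n : ℕ => Real.log ((n : ℝ) + 2)) :
    Tendsto (fun n : ℕ => Real.log ‖p n‖ / Real.log n) atTop (𝓝 (V₀ / 8)) := by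
  set y : ℕ → ℂ := fun m => direction (z m) (p m) with hy
  have hy1 : ∀ m, ‖y m‖ = 1 := fun m => norm_direction (h.norm_eq_one m) (h.ne_zero m)
  set w : ℕ → ℝ := fun m => 1 / 8 - (y m ^ 2).re / 4 + ((y m ^ 2) ^ 2).re / 8 with hw
  have he0 : Tendsto e atTop (𝓝 0) := he.tendsto_atTop_zero
  have hκ0 : Tendsto κ atTop (𝓝 0) := by
    have h3 := hκ.tendsto_atTop_zero
    have h4 := h3.rpow_const (p := 1 / 3) (Or.inr (by norm_num))
    rw [Real.zero_rpow (by norm_num)] at h4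
    refine tendsto_zero_iff_norm_tendsto_zero.2 (h4.congr fun n => ?_)
    rw [← Real.rpow_natCast, ← Real.rpow_mul (abs_nonneg _)]
    norm_num
  have hrot := h.tendsto_direction hκ0 he0 hz
  have hz0 : ‖z₀‖ = 1 := by
    refine tendsto_nhds_unique hz.norm ?_
    simp_rw [h.norm_eq_one]
    exact tendsto_const_nhds
  -- Squaring an asymptotic rotation squares its multiplier; used once for y² and again for y⁴.
  have sqrot : ∀ {u : ℕ → ℂ} {ζ : ℂ}, (∀ n, ‖u n‖ = 1) → ‖ζ‖ = 1 →
      Tendsto (fun n => u (n + 1) - ζ * u n) atTop (𝓝 0) →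
      Tendsto (fun n => u (n + 1) ^ 2 - ζ ^ 2 * u n ^ 2) atTop (𝓝 0) := by
    intro u ζ hu hζ hr
    refine squeeze_zero_norm (a := fun n => 2 * ‖u (n + 1) - ζ * u n‖) (fun n => ?_)
      (by simpa using hr.norm.const_mul 2)
    have : u (n + 1) ^ 2 - ζ ^ 2 * u n ^ 2 = (u (n + 1) + ζ * u n) * (u (n + 1) - ζ * u n) := by
      ring
    rw [this, norm_mul]
    refine mul_le_mul_of_nonneg_right ((norm_add_le _ _).trans ?_) (norm_nonneg _)
    rw [norm_mul, hu, hu, hζ]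
    norm_num
  have hrot2 := sqrot hy1 hz0 hrot
  have hy2 : ∀ m, ‖y m ^ 2‖ = 1 := fun m => by rw [norm_pow, hy1, one_pow]
  have hrot4 := sqrot hy2 (by rw [norm_pow, hz0, one_pow]) hrot2
  have p2 := isLittleO_log_sum_rotating (fun m => (hy2 m).le) hz2 hrot2
  have p4 := isLittleO_log_sum_rotating (Y := fun m => (y m ^ 2) ^ 2)
    (fun m => by rw [norm_pow, hy2, one_pow]) (by rwa [← pow_mul]) hrot4
  have re : ∀ {u : ℕ → ℂ}, (fun n => ∑ m ∈ range n, ((m : ℝ) + 1)⁻¹ • u m) =o[atTop]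
      (fun n : ℕ => Real.log ((n : ℝ) + 2)) →
      (fun n => ∑ m ∈ range n, ((m : ℝ) + 1)⁻¹ * (u m).re) =o[atTop]
      (fun n : ℕ => Real.log ((n : ℝ) + 2)) := by
    intro u hu
    refine (IsBigO.of_bound 1 (g := fun n => ∑ m ∈ range n, ((m : ℝ) + 1)⁻¹ • u m)
      (Eventually.of_forall fun n => ?_)).trans_isLittleO hu
    have : ∑ m ∈ range n, ((m : ℝ) + 1)⁻¹ * (u m).re =
        (∑ m ∈ range n, ((m : ℝ) + 1)⁻¹ • u m).re := by
      rw [Complex.re_sum]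
      exact sum_congr rfl fun m _ => by rw [Complex.smul_re, smul_eq_mul]
    rw [this, one_mul]
    exact Complex.abs_re_le_norm _
  have hwb : ∀ m, |w m| ≤ 1 := by
    intro m
    have a1 := (Complex.abs_re_le_norm (y m ^ 2)).trans (hy2 m).le
    have a2 := (Complex.abs_re_le_norm ((y m ^ 2) ^ 2)).trans
      (by rw [norm_pow, hy2, one_pow] : ‖(y m ^ 2) ^ 2‖ = 1).le
    rw [abs_le] at a1 a2 ⊢
    simp only [hw]
    constructor <;> linarith [a1.1, a1.2, a2.1, a2.2]
  have p5 : (fun n => ∑ m ∈ range n, ((m : ℝ) + 1)⁻¹ • ((V m - V₀) * w m)) =o[atTop]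
      fun n : ℕ => Real.log ((n : ℝ) + 2) := by
    refine isLittleO_log_sum_div ?_
    have h3 : Tendsto (fun m => V m - V₀) atTop (𝓝 0) := by simpa using hV.sub_const V₀
    refine squeeze_zero_norm (fun m => ?_) (by simpa using h3.norm)
    rw [norm_mul]
    exact mul_le_of_le_one_right (norm_nonneg _) (hwb m)
  -- the increments
  set D : ℕ → ℝ := fun m => Real.log ‖p (m + 1)‖ - Real.log ‖p m‖ -
    (κ m * (y m ^ 2).im / 2 + κ m ^ 2 * w m) with hD
  have hDs : Summable D := by
    refine Summable.of_norm_bounded_eventually_nat (g := fun m => 10 * |κ m| ^ 3 + 4 * e m)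
      ((hκ.mul_left 10).add (he.mul_left 4)) ?_
    filter_upwards [hκ0.abs.eventually (ge_mem_nhds (show |(0:ℝ)| < 1 / 4 by norm_num)),
      he0.eventually (ge_mem_nhds (show (0:ℝ) < 1 / 4 by norm_num))] with m hm1 hm2
    obtain ⟨δ, hδ, hδp⟩ := h.exists_error m
    have h3 := abs_log_norm_shear_sub_le (hy1 m) hm1 (hδ.trans hm2)
    have hpm : ‖p m‖ ≠ 0 := norm_ne_zero_iff.2 (h.ne_zero m)
    have hB0 : ‖y m + (κ m * (y m).im : ℝ) + δ‖ ≠ 0 := by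
      intro h0
      exact h.ne_zero (m + 1) (by rw [hδp, norm_eq_zero.1 h0, mul_zero])
    have h4 : Real.log ‖p (m + 1)‖ - Real.log ‖p m‖ =
        Real.log ‖y m + (κ m * (y m).im : ℝ) + δ‖ := by
      rw [hδp, norm_mul, Complex.norm_real, norm_norm, Real.log_mul hpm hB0]
      ring
    rw [Real.norm_eq_abs, hD]
    simp only
    rw [h4]
    exact h3.trans (by linarith)
  have p6 := isLittleO_log_of_tendsto hDs.hasSum.tendsto_sum_nat
  have p7 := isLittleO_log_of_tendsto (tendsto_const_nhds (x := Real.log ‖p 0‖) (f := atTop))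
  have key : (fun n => Real.log ‖p n‖ - V₀ / 8 * ∑ m ∈ range n, ((m : ℝ) + 1)⁻¹) =o[atTop]
      fun n : ℕ => Real.log ((n : ℝ) + 2) := by
    refine ((((((h1.const_mul_left (1 / 2)).add h2).add p5).add
      ((re p2).const_mul_left (-V₀ / 4))).add ((re p4).const_mul_left (V₀ / 8))).add
        (p6.add p7)).congr_left fun n => ?_
    have hlog : Real.log ‖p n‖ = Real.log ‖p 0‖ +
        ∑ m ∈ range n, (Real.log ‖p (m + 1)‖ - Real.log ‖p m‖) := by
      rw [sum_range_sub (fun m => Real.log ‖p m‖)]; ring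
    rw [hlog]
    simp only [mul_sum, ← sum_add_distrib, smul_eq_mul]
    rw [add_comm (Real.log _), add_sub_right_comm, ← sum_sub_distrib, ← add_assoc,
      ← sum_add_distrib]
    congr 1
    refine sum_congr rfl fun m _ => ?_
    simp only [hD, hw]
    ring
  have hL : ∀ n : ℕ, 0 < Real.log ((n : ℝ) + 2) := fun n =>
    Real.log_pos (by have : (0:ℝ) ≤ n := by positivity
                     linarith)
  have k1 := key.tendsto_div_nhds_zero.add (tendsto_sum_inv_div_log.const_mul (V₀ / 8))
  rw [zero_add, mul_one] at k1
  -- The averages use log (n + 2), positive for every n; the result is stated with log n.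
  have k2 : Tendsto (fun n : ℕ => Real.log ((n : ℝ) + 2) / Real.log n) atTop (𝓝 1) := by
    have a1 : Tendsto (fun n : ℕ => Real.log ((n : ℝ) + 2) - Real.log n) atTop (𝓝 0) := by
      have a2 : Tendsto (fun n : ℕ => 1 + 2 / (n : ℝ)) atTop (𝓝 1) := by
        simpa using (tendsto_const_div_atTop_nhds_zero_nat (2 : ℝ)).const_add 1
      have a3 := (Real.continuousAt_log one_ne_zero).tendsto.comp a2
      rw [Real.log_one] at a3
      refine a3.congr' ?_
      filter_upwards [eventually_gt_atTop 0] with n hn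
      have : (0 : ℝ) < n := by exact_mod_cast hn
      simp only [Function.comp]
      rw [← Real.log_div (by positivity) this.ne']
      congr 1
      field_simp
    have a4 := (a1.div_atTop (Real.tendsto_log_atTop.comp tendsto_natCast_atTop_atTop)).const_add 1
    rw [add_zero] at a4
    refine a4.congr' ?_
    filter_upwards [eventually_gt_atTop 1] with n hn
    have : 0 < Real.log (n : ℝ) := Real.log_pos (by exact_mod_cast hn)
    simp only [Function.comp]
    field_simp
    ring
  have k3 := k1.mul k2
  rw [mul_one] at k3
  refine k3.congr fun n => ?_
  have := (hL n).ne'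
  field_simp
  ring

end IsShearedRotation

end DeltaComb

namespace DeltaComb

open Filter Topology Asymptotics Finset

/-! ### Polynomial growth rates -/

theorem tendsto_natCast_rpow_atTop {γ : ℝ} (hγ : 0 < γ) :
    Tendsto (fun n : ℕ => (n : ℝ) ^ γ) atTop atTop :=
  (tendsto_rpow_atTop hγ).comp tendsto_natCast_atTop_atTop

/-- In the form of two-sided power bounds with arbitrarily small loss, rates survive multiplicative
constants, products and sums. -/
theorem tendsto_log_div_log_iff {x : ℕ → ℝ} (hx : ∀ n, 0 < x n) {b : ℝ} :
    Tendsto (fun n : ℕ => Real.log (x n) / Real.log n) atTop (𝓝 b) ↔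
      (∀ γ < b, ∀ᶠ n : ℕ in atTop, (n : ℝ) ^ γ ≤ x n) ∧
      (∀ γ > b, ∀ᶠ n : ℕ in atTop, x n ≤ (n : ℝ) ^ γ) := by
  have hlog : ∀ n : ℕ, 1 < n → 0 < Real.log n := fun n hn => Real.log_pos (by exact_mod_cast hn)
  have hpos : ∀ n : ℕ, 1 < n → (0 : ℝ) < n := fun n hn => by positivity
  have le1 : ∀ n : ℕ, 1 < n → ∀ γ : ℝ, γ ≤ Real.log (x n) / Real.log n ↔ (n : ℝ) ^ γ ≤ x n := by
    intro n hn γ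
    rw [le_div_iff₀ (hlog n hn), ← Real.log_rpow (hpos n hn),
      Real.log_le_log_iff (Real.rpow_pos_of_pos (hpos n hn) _) (hx n)]
  have le2 : ∀ n : ℕ, 1 < n → ∀ γ : ℝ, Real.log (x n) / Real.log n ≤ γ ↔ x n ≤ (n : ℝ) ^ γ := by
    intro n hn γ
    rw [div_le_iff₀ (hlog n hn), ← Real.log_rpow (hpos n hn),
      Real.log_le_log_iff (hx n) (Real.rpow_pos_of_pos (hpos n hn) _)]
  constructor
  · intro h
    constructor
    · intro γ hγ
      filter_upwards [h.eventually (le_mem_nhds hγ), eventually_gt_atTop 1] with n h1 h2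
      exact (le1 n h2 γ).1 h1
    · intro γ hγ
      filter_upwards [h.eventually (ge_mem_nhds hγ), eventually_gt_atTop 1] with n h1 h2
      exact (le2 n h2 γ).1 h1
  · rintro ⟨h1, h2⟩
    rw [tendsto_order]
    constructor
    · intro γ hγ
      obtain ⟨γ', hγ1, hγ2⟩ := exists_between hγ
      filter_upwards [h1 γ' hγ2, eventually_gt_atTop 1] with n h3 h4
      exact hγ1.trans_le ((le1 n h4 γ').2 h3)
    · intro γ hγ
      obtain ⟨γ', hγ1, hγ2⟩ := exists_between hγ
      filter_upwards [h2 γ' hγ1, eventually_gt_atTop 1] with n h3 h4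
      exact ((le2 n h4 γ').2 h3).trans_lt hγ2

theorem eventually_const_mul_rpow_le (C : ℝ) {γ γ' : ℝ} (h : γ < γ') :
    ∀ᶠ n : ℕ in atTop, C * (n : ℝ) ^ γ ≤ (n : ℝ) ^ γ' := by
  filter_upwards [(tendsto_natCast_rpow_atTop (sub_pos.2 h)).eventually_ge_atTop C,
    eventually_gt_atTop 0] with n hn hn0
  have h0 : (0 : ℝ) < n := by exact_mod_cast hn0
  calc C * (n : ℝ) ^ γ ≤ (n : ℝ) ^ (γ' - γ) * (n : ℝ) ^ γ := by gcongr
    _ = _ := by rw [← Real.rpow_add h0]; congr 1; ring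

theorem eventually_add_one_rpow_le {γ γ' : ℝ} (hγ : 0 ≤ γ) (h : γ < γ') :
    ∀ᶠ n : ℕ in atTop, ((n : ℝ) + 1) ^ γ ≤ (n : ℝ) ^ γ' := by
  filter_upwards [eventually_const_mul_rpow_le ((2 : ℝ) ^ γ) h, eventually_gt_atTop 0] with n h1 h2
  have h0 : (1 : ℝ) ≤ n := by exact_mod_cast h2
  refine le_trans ?_ h1
  rw [← Real.mul_rpow (by norm_num) (by linarith)]
  exact Real.rpow_le_rpow (by linarith) (by linarith) hγ

theorem tendsto_log_div_log_of_le_mul {x y : ℕ → ℝ} (hx : ∀ n, 0 < x n) (hy : ∀ n, 0 < y n)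
    {b c C : ℝ} (hc : 0 < c) (h1 : ∀ n, c * x n ≤ y n) (h2 : ∀ n, y n ≤ C * x n)
    (h : Tendsto (fun n : ℕ => Real.log (x n) / Real.log n) atTop (𝓝 b)) :
    Tendsto (fun n : ℕ => Real.log (y n) / Real.log n) atTop (𝓝 b) := by
  rw [tendsto_log_div_log_iff hx] at h
  rw [tendsto_log_div_log_iff hy]
  have hC : 0 < C := by
    have := (h1 0).trans (h2 0)
    have := le_of_mul_le_mul_right this (hx 0)
    linarith
  constructor
  · intro γ hγ
    obtain ⟨γ', hγ1, hγ2⟩ := exists_between hγ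
    filter_upwards [h.1 γ' hγ2, eventually_const_mul_rpow_le c⁻¹ hγ1] with n h3 h4
    refine le_trans ?_ (h1 n)
    rw [inv_mul_le_iff₀ hc] at h4
    exact h4.trans (by gcongr)
  · intro γ hγ
    obtain ⟨γ', hγ1, hγ2⟩ := exists_between hγ
    filter_upwards [h.2 γ' hγ1, eventually_const_mul_rpow_le C hγ2] with n h3 h4
    exact ((h2 n).trans (by gcongr)).trans h4

/-! ### The recessive solution of a sheared rotation -/

/-- The real part of `q / p`. -/
noncomputable def quotRe (p q : ℂ) : ℝ := (p.re * q.re + p.im * q.im) / ‖p‖ ^ 2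

/-- The real Wronskian of `p` and `q`. -/
def wronskian (p q : ℂ) : ℝ := p.re * q.im - p.im * q.re

theorem sq_norm_ne_zero {p : ℂ} (hp : p ≠ 0) : p.re ^ 2 + p.im ^ 2 ≠ 0 := by
  have h : ‖p‖ ^ 2 = p.re ^ 2 + p.im ^ 2 := by
    rw [Complex.sq_norm, Complex.normSq_apply]; ring
  rw [← h]; exact pow_ne_zero 2 (norm_ne_zero_iff.2 hp)

/-- This is q/p = Re(q/p) + i Im(q/p), with Im(q/p) equal to the Wronskian divided by |p|². -/
theorem sub_quotRe_smul {p q : ℂ} (hp : p ≠ 0) :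
    q - quotRe p q * p = (wronskian p q / ‖p‖ ^ 2 : ℝ) * (Complex.I * p) := by
  have h : ‖p‖ ^ 2 = p.re ^ 2 + p.im ^ 2 := by
    rw [Complex.sq_norm, Complex.normSq_apply]; ring
  have h0 := sq_norm_ne_zero hp
  apply Complex.ext
  · simp only [Complex.sub_re, Complex.mul_re, Complex.ofReal_re, Complex.ofReal_im, Complex.I_re,
      Complex.I_im, quotRe, wronskian, h, Complex.mul_im]
    field_simp
    ring
  · simp only [Complex.sub_im, Complex.mul_re, Complex.ofReal_re, Complex.ofReal_im, Complex.I_re,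
      Complex.I_im, quotRe, wronskian, h, Complex.mul_im]
    field_simp
    ring

theorem quotRe_real_smul_add {p r : ℂ} (c : ℝ) (hp : p ≠ 0) :
    quotRe p (c * p + r) = c + quotRe p r := by
  have h : ‖p‖ ^ 2 = p.re ^ 2 + p.im ^ 2 := by
    rw [Complex.sq_norm, Complex.normSq_apply]; ring
  have h0 := sq_norm_ne_zero hp
  rw [quotRe, quotRe, h]
  simp only [Complex.add_re, Complex.add_im, Complex.mul_re, Complex.mul_im, Complex.ofReal_re,
    Complex.ofReal_im]
  field_simp
  ring

/-- The first order change of `quotRe` under a perturbed shear. -/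
theorem abs_quotRe_shear_sub_le {y δ₁ δ₂ : ℂ} (hy : ‖y‖ = 1) {κ e : ℝ} (hκ : |κ| ≤ 1 / 4)
    (he : e ≤ 1 / 16) (h₁ : ‖δ₁‖ ≤ e) (h₂ : ‖δ₂‖ ≤ e) :
    |quotRe (y + (κ * y.im : ℝ) + δ₁) (Complex.I * y + (κ * y.re : ℝ) + δ₂) -
      κ * (y ^ 2).re| ≤ 60 * (κ ^ 2 + e) := by
  have hy2 : y.re ^ 2 + y.im ^ 2 = 1 := by
    have := Complex.sq_norm y
    rw [hy, Complex.normSq_apply] at this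
    linarith
  have hRe : (y ^ 2).re = y.re ^ 2 - y.im ^ 2 := by simp [sq, Complex.mul_re]
  have hRe1 : |y.re ^ 2 - y.im ^ 2| ≤ 1 := by
    rw [abs_le]; constructor <;> nlinarith [sq_nonneg y.re, sq_nonneg y.im]
  have a1 := (Complex.abs_re_le_norm δ₁).trans h₁
  have a2 := (Complex.abs_im_le_norm δ₁).trans h₁
  have a3 := (Complex.abs_re_le_norm δ₂).trans h₂
  have a4 := (Complex.abs_im_le_norm δ₂).trans h₂
  have a5 := (Complex.abs_re_le_norm y).trans hy.le
  have a6 := (Complex.abs_im_le_norm y).trans hy.le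
  have he0 : 0 ≤ e := (norm_nonneg _).trans h₁
  have hκ0 := abs_nonneg κ
  rw [hRe, quotRe, Complex.sq_norm, Complex.normSq_apply]
  simp only [Complex.add_re, Complex.add_im, Complex.mul_re, Complex.mul_im, Complex.I_re,
    Complex.I_im, Complex.ofReal_re, Complex.ofReal_im, zero_mul, one_mul, add_zero, zero_sub,
    zero_add]
  generalize y.re = a at *
  generalize y.im = b at *
  generalize δ₁.re = d₁ at *
  generalize δ₁.im = d₂ at *
  generalize δ₂.re = d₃ at *
  generalize δ₂.im = d₄ at *
  -- u and v are the real parts of the sheared vectors y + κ Im y and iy + κ Re y. Since Re(iy/y) =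
  -- 0, the numerator of the quotient starts at order κ.
  obtain ⟨u, hu⟩ : ∃ u, u = a + κ * b := ⟨_, rfl⟩
  obtain ⟨v, hv⟩ : ∃ v, v = -b + κ * a := ⟨_, rfl⟩
  have hub : |u| ≤ 5 / 4 := by
    rw [hu]
    refine (abs_add_le _ _).trans ?_
    rw [abs_mul]
    nlinarith [abs_nonneg b]
  have hvb : |v| ≤ 5 / 4 := by
    rw [hv]
    refine (abs_add_le _ _).trans ?_
    rw [abs_mul, abs_neg]
    nlinarith [abs_nonneg a]
  have mulb : ∀ {s t S T : ℝ}, |s| ≤ S → |t| ≤ T → |s * t| ≤ S * T := fun {s t S T} hs ht => by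
    rw [abs_mul]
    exact mul_le_mul hs ht (abs_nonneg _) ((abs_nonneg _).trans hs)
  have hab : |a * b| ≤ 1 := by simpa using mulb a5 a6
  -- numerator and denominator
  obtain ⟨r, hr⟩ : ∃ r, r = u * d₃ + d₁ * v + d₁ * d₃ + (b * d₄ + d₂ * a + d₂ * d₄) := ⟨_, rfl⟩
  obtain ⟨τ, hτ⟩ : ∃ τ, τ = 2 * (κ * (a * b)) + κ * (κ * (b * b)) + 2 * (u * d₁) + d₁ * d₁ +
    2 * (b * d₂) + d₂ * d₂ := ⟨_, rfl⟩
  have hrb : |r| ≤ 5 * e := by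
    have b1 := mulb hub a3
    have b2 := mulb a1 hvb
    have b3 := mulb a1 a3
    have b4 := mulb a6 a4
    have b5 := mulb a2 a5
    have b6 := mulb a2 a4
    rw [abs_le] at b1 b2 b3 b4 b5 b6
    have : e * e ≤ 1 / 16 * e := by gcongr
    rw [hr, abs_le]
    constructor <;> linarith [b1.1, b2.1, b3.1, b4.1, b5.1, b6.1, b1.2, b2.2, b3.2, b4.2, b5.2,
      b6.2]
  have hτb : |τ| ≤ 9 / 4 * |κ| + 5 * e := by
    have b1 := mulb (le_refl |κ|) hab
    have b2 := mulb (le_refl |κ|) (mulb hκ (mulb a6 a6))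
    have b3 := mulb hub a1
    have b4 := mulb a1 a1
    have b5 := mulb a6 a2
    have b6 := mulb a2 a2
    rw [abs_le] at b1 b2 b3 b4 b5 b6
    have : e * e ≤ 1 / 16 * e := by gcongr
    rw [hτ, abs_le]
    constructor <;> linarith [b1.1, b2.1, b3.1, b4.1, b5.1, b6.1, b1.2, b2.2, b3.2, b4.2, b5.2,
      b6.2]
  -- The assumptions 1/4 and 1/16 on κ and e give 9/16 + 5/16, which keeps the denominator 1 + τ at
  -- least 1/8.
  have hτ1 : |τ| ≤ 7 / 8 := by linarith
  have hτ2 : 1 / 8 ≤ 1 + τ := by linarith [(abs_le.1 hτ1).1]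
  have hnum : (a + κ * b + d₁) * (-b + κ * a + d₃) + (b + d₂) * (a + d₄) =
      κ * (a ^ 2 - b ^ 2) + κ ^ 2 * (a * b) + r := by rw [hr, hu, hv]; ring
  have hden : (a + κ * b + d₁) * (a + κ * b + d₁) + (b + d₂) * (b + d₂) = 1 + τ := by
    rw [hτ, hu]; linear_combination hy2
  rw [hnum, hden]
  obtain ⟨A, hA⟩ : ∃ A, A = a ^ 2 - b ^ 2 := ⟨_, rfl⟩
  rw [← hA] at hRe1 ⊢
  have hsub : (κ * A + κ ^ 2 * (a * b) + r) / (1 + τ) - κ * A =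
      (κ ^ 2 * (a * b) + r - τ * (κ * A)) / (1 + τ) := by
    field_simp
    ring
  rw [hsub, abs_div, abs_of_pos (by linarith : 0 < 1 + τ), div_le_iff₀ (by linarith)]
  have c1 := mulb (le_of_eq (abs_of_nonneg (sq_nonneg κ))) hab
  have c2 := mulb hτb (mulb (le_refl |κ|) hRe1)
  have hκsq : |κ| * |κ| = κ ^ 2 := by rw [← sq, sq_abs]
  have c3 : |κ ^ 2 * (a * b) + r - τ * (κ * A)| ≤
      κ ^ 2 * 1 + 5 * e + (9 / 4 * |κ| + 5 * e) * (|κ| * 1) :=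
    (abs_sub _ _).trans (add_le_add ((abs_add_le _ _).trans (add_le_add c1 hrb)) c2)
  have c4 : e * |κ| ≤ e * (1 / 4) := by gcongr
  have c5 : 60 * (κ ^ 2 + e) * (1 / 8) ≤ 60 * (κ ^ 2 + e) * (1 + τ) := by
    have := sq_nonneg κ
    gcongr
  have := sq_nonneg κ
  linarith

end DeltaComb

namespace DeltaComb

open Filter Topology Asymptotics Finset MeasureTheory ProbabilityTheory

/-! ### Random sheared rotations -/

theorem log_add_two_pos (n : ℕ) : 0 < Real.log ((n : ℝ) + 2) :=
  Real.log_pos (by have : (0:ℝ) ≤ n := by positivity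
                   linarith)

/-- Comparison with the telescoping differences of 1/log (n + 2). This is the margin that makes
division by log n enough to sum the variances of the linear term. -/
theorem summable_inv_mul_log_sq :
    Summable fun n : ℕ => ((n : ℝ) + 1)⁻¹ * (Real.log ((n : ℝ) + 2) ^ 2)⁻¹ := by
  set u : ℕ → ℝ := fun n => (Real.log ((n : ℝ) + 2))⁻¹ with hu
  have hL := log_add_two_pos
  have step : ∀ n : ℕ, ((n : ℝ) + 1)⁻¹ * (Real.log ((n : ℝ) + 2) ^ 2)⁻¹ ≤ 6 * (u n - u (n + 1)) := by
    intro n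
    have hn : (0 : ℝ) ≤ n := by positivity
    have h1 : (1 : ℝ) / (n + 3) ≤ Real.log (((n + 1 : ℕ) : ℝ) + 2) - Real.log ((n : ℝ) + 2) := by
      rw [← Real.log_div (by positivity) (by positivity)]
      refine le_trans (le_of_eq ?_) (Real.one_sub_inv_le_log_of_pos (by positivity))
      push_cast
      field_simp
      ring
    have h2 : Real.log (((n + 1 : ℕ) : ℝ) + 2) ≤ 2 * Real.log ((n : ℝ) + 2) := by
      rw [← Real.log_rpow (by positivity)]
      refine Real.log_le_log (by positivity) ?_
      push_cast
      norm_num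
      nlinarith
    have h3 := hL n
    have h4 := hL (n + 1)
    have h5 : u n - u (n + 1) = (Real.log (((n + 1 : ℕ) : ℝ) + 2) - Real.log ((n : ℝ) + 2)) *
        (Real.log ((n : ℝ) + 2) * Real.log (((n + 1 : ℕ) : ℝ) + 2))⁻¹ := by
      simp only [hu]
      field_simp
    have h6 : (2 * Real.log ((n : ℝ) + 2) ^ 2)⁻¹ ≤
        (Real.log ((n : ℝ) + 2) * Real.log (((n + 1 : ℕ) : ℝ) + 2))⁻¹ :=
      inv_anti₀ (by positivity) (by nlinarith)
    have h7 : ((n : ℝ) + 1)⁻¹ ≤ 3 * (1 / (n + 3)) := by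
      field_simp
      linarith
    rw [h5]
    calc ((n : ℝ) + 1)⁻¹ * (Real.log ((n : ℝ) + 2) ^ 2)⁻¹
        ≤ 3 * (1 / (n + 3)) * (Real.log ((n : ℝ) + 2) ^ 2)⁻¹ := by gcongr
      _ = 6 * (1 / (n + 3) * (2 * Real.log ((n : ℝ) + 2) ^ 2)⁻¹) := by
        rw [mul_inv]; ring
      _ ≤ _ := by
        have : (0 : ℝ) ≤ 1 / (n + 3) := by positivity
        have h8 := this.trans h1
        gcongr
  refine summable_of_sum_range_le (c := 6 * u 0) (fun n => by positivity) fun n => ?_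
  calc _ ≤ ∑ m ∈ range n, 6 * (u m - u (m + 1)) := sum_le_sum fun m _ => step m
    _ = 6 * (u 0 - u n) := by rw [← mul_sum, sum_range_sub']
    _ ≤ 6 * u 0 := by
      have : 0 ≤ u n := inv_nonneg.2 (hL n).le
      linarith

theorem summable_add_one_rpow {s : ℝ} (hs : 1 < s) : Summable fun n : ℕ => ((n : ℝ) + 1) ^ (-s) := by
  have h := (summable_nat_add_iff 1).2 (Real.summable_nat_rpow.2 (by linarith : -s < -1))
  simpa using h

/-- The assumptions on the random coupling constants. -/
structure IsDecayingNoise {Ω : Type*} [MeasurableSpace Ω] (ν : Measure Ω) (g : ℕ → Ω → ℝ)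
    (lam : ℝ) : Prop where
  measurable : ∀ n, Measurable (g n)
  indep : iIndepFun g ν
  second : ∀ n : ℕ, ∫ ω, g n ω ^ 2 ∂ν = lam ^ 2 / ((n : ℝ) + 1)
  fourth : ∃ C₄ : ℝ, 0 < C₄ ∧ ∀ n : ℕ, ∫ ω, g n ω ^ 4 ∂ν ≤ C₄ * lam ^ 4 / ((n : ℝ) + 1) ^ 2
  mean : ∀ n : ℕ, ∫ ω, g n ω ∂ν = 0
  bound : ∃ ε : ℝ, 0 < ε ∧ ∃ C₁ : ℝ, 0 < C₁ ∧
    ∀ (n : ℕ) (ω : Ω), |g n ω| ≤ C₁ * ((n : ℝ) + 1) ^ (-(1 / 3) - ε)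

namespace IsDecayingNoise

variable {Ω : Type*} [MeasurableSpace Ω] {ν : Measure Ω} {g : ℕ → Ω → ℝ} {lam : ℝ}

/-- The exponent 1/3 in the sup bound is needed here: cubes are of order n^(-1-3ε), so the third
order remainders are summable for every ω. -/
theorem summable_cube (hg : IsDecayingNoise ν g lam) (ω : Ω) : Summable fun n => |g n ω| ^ 3 := by
  obtain ⟨ε, hε, C, hC, hb⟩ := hg.bound
  have h := (summable_add_one_rpow (s := 1 + 3 * ε) (by linarith)).mul_left (C ^ 3)
  refine Summable.of_nonneg_of_le (fun n => by positivity) (fun n => ?_) h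
  calc |g n ω| ^ 3 ≤ (C * ((n : ℝ) + 1) ^ (-(1 / 3) - ε)) ^ 3 :=
        pow_le_pow_left₀ (abs_nonneg _) (hb n ω) 3
    _ = _ := by
      rw [mul_pow, ← Real.rpow_natCast (((n : ℝ) + 1) ^ _), ← Real.rpow_mul (by positivity)]
      congr 2
      push_cast
      ring

theorem tendsto_zero (hg : IsDecayingNoise ν g lam) (ω : Ω) :
    Tendsto (fun n => g n ω) atTop (𝓝 0) := by
  have h4 := (hg.summable_cube ω).tendsto_atTop_zero.rpow_const (p := 1 / 3) (Or.inr (by norm_num))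
  rw [Real.zero_rpow (by norm_num)] at h4
  refine tendsto_zero_iff_norm_tendsto_zero.2 (h4.congr fun n => ?_)
  rw [← Real.rpow_natCast, ← Real.rpow_mul (abs_nonneg _)]
  norm_num

theorem exists_abs_le (hg : IsDecayingNoise ν g lam) : ∃ C, ∀ n ω, |g n ω| ≤ C := by
  obtain ⟨ε, hε, C, hC, hb⟩ := hg.bound
  refine ⟨C, fun n ω => (hb n ω).trans (mul_le_of_le_one_right hC.le ?_)⟩
  exact Real.rpow_le_one_of_one_le_of_nonpos (by have : (0:ℝ) ≤ n := by positivity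
                                                 linarith) (by linarith)

variable [IsProbabilityMeasure ν]

theorem ae_tendsto_linear (hg : IsDecayingNoise ν g lam) {H : ℕ → Ω → ℝ}
    (hH : ∀ n, Measurable[past g n] (H n)) {w : ℕ → ℝ} (hHw : ∀ n ω, |H n ω| ≤ w n)
    (hs : Summable fun n : ℕ => w n ^ 2 * ((n : ℝ) + 1)⁻¹) :
    ∀ᵐ ω ∂ν, ∃ l, Tendsto (fun n => ∑ m ∈ range n, H m ω * g m ω) atTop (𝓝 l) := by
  obtain ⟨C, hC⟩ := hg.exists_abs_le
  refine ae_exists_tendsto_sum_predictable hg.measurable hg.indep (f := fun _ x => x)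
    (fun _ => measurable_id) (fun n => ⟨C, hC n⟩) hg.mean hH hHw ?_
  simp_rw [hg.second]
  refine (hs.mul_left (lam ^ 2)).congr fun n => ?_
  rw [div_eq_mul_inv]; ring

/-- The variance of g² is at most its second moment E g⁴ = O(n⁻²), which is summable, so bounded
predictable weights suffice. -/
theorem ae_tendsto_quadratic (hg : IsDecayingNoise ν g lam) {H : ℕ → Ω → ℝ}
    (hH : ∀ n, Measurable[past g n] (H n)) {C : ℝ} (hHw : ∀ n ω, |H n ω| ≤ C) :
    ∀ᵐ ω ∂ν, ∃ l, Tendsto (fun n => ∑ m ∈ range n,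
      H m ω * (g m ω ^ 2 - lam ^ 2 / ((m : ℝ) + 1))) atTop (𝓝 l) := by
  obtain ⟨B, hB⟩ := hg.exists_abs_le
  have hB2 : ∀ n ω, |g n ω ^ 2| ≤ B ^ 2 := fun n ω => by
    rw [abs_pow]; exact pow_le_pow_left₀ (abs_nonneg _) (hB n ω) 2
  have hB4 : ∀ n ω, |g n ω ^ 4| ≤ B ^ 4 := fun n ω => by
    rw [abs_pow]; exact pow_le_pow_left₀ (abs_nonneg _) (hB n ω) 4
  have i2 : ∀ n, Integrable (fun ω => g n ω ^ 2) ν := fun n =>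
    integrable_of_bounded ((hg.measurable n).pow_const 2) (hB2 n)
  have i4 : ∀ n, Integrable (fun ω => g n ω ^ 4) ν := fun n =>
    integrable_of_bounded ((hg.measurable n).pow_const 4) (hB4 n)
  refine ae_exists_tendsto_sum_predictable hg.measurable hg.indep
    (f := fun n x => x ^ 2 - lam ^ 2 / ((n : ℝ) + 1))
    (fun _ => (measurable_id.pow_const 2).sub_const _)
    (fun n => ⟨B ^ 2 + |lam ^ 2 / ((n : ℝ) + 1)|, fun ω => (abs_sub _ _).trans
      (by gcongr; exact hB2 n ω)⟩) (fun n => ?_) hH hHw ?_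
  · rw [integral_sub (i2 n) (integrable_const _), hg.second]
    simp
  · obtain ⟨C₄, hC₄, h4⟩ := hg.fourth
    have hsum : Summable fun n : ℕ => C ^ 2 * (C₄ * lam ^ 4 / ((n : ℝ) + 1) ^ 2) := by
      have := (summable_add_one_rpow (s := 2) (by norm_num)).mul_left (C ^ 2 * (C₄ * lam ^ 4))
      refine this.congr fun n => ?_
      rw [Real.rpow_neg (by positivity), Real.rpow_two]
      ring
    refine Summable.of_nonneg_of_le (fun n => mul_nonneg (sq_nonneg _)
      (integral_nonneg fun ω => sq_nonneg _)) (fun n => ?_) hsum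
    refine mul_le_mul_of_nonneg_left (le_trans ?_ (h4 n)) (sq_nonneg C)
    have e1 : ∀ ω, (g n ω ^ 2 - lam ^ 2 / ((n : ℝ) + 1)) ^ 2 =
        g n ω ^ 4 - (2 * (lam ^ 2 / ((n : ℝ) + 1)) * g n ω ^ 2 - (lam ^ 2 / ((n : ℝ) + 1)) ^ 2) :=
      fun ω => by ring
    simp_rw [e1]
    have i5 : Integrable (fun ω => 2 * (lam ^ 2 / ((n : ℝ) + 1)) * g n ω ^ 2) ν :=
      (i2 n).const_mul _
    have i6 : Integrable (fun ω => 2 * (lam ^ 2 / ((n : ℝ) + 1)) * g n ω ^ 2 -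
        (lam ^ 2 / ((n : ℝ) + 1)) ^ 2) ν := i5.sub (integrable_const _)
    rw [integral_sub (i4 n) i6, integral_sub i5 (integrable_const _), integral_const_mul, hg.second]
    simp only [integral_const, probReal_univ, one_smul]
    nlinarith [sq_nonneg (lam ^ 2 / ((n : ℝ) + 1))]

/-- The centred sums converge by `ae_tendsto_quadratic`, and the means λ² n^(-1-δ) are summable. As
the terms are nonnegative, boundedness of their partial sums is enough. -/
theorem ae_summable_sq (hg : IsDecayingNoise ν g lam) {δ : ℝ} (hδ : 0 < δ) :
    ∀ᵐ ω ∂ν, Summable fun n : ℕ => ((n : ℝ) + 1) ^ (-δ) * g n ω ^ 2 := by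
  have h := hg.ae_tendsto_quadratic (ν := ν) (H := fun n _ => ((n : ℝ) + 1) ^ (-δ)) (C := 1)
    (fun n => measurable_const) (fun n ω => by
      rw [abs_of_nonneg (by positivity)]
      exact Real.rpow_le_one_of_one_le_of_nonpos (by have : (0:ℝ) ≤ n := by positivity
                                                     linarith) (by linarith))
  filter_upwards [h] with ω hω
  obtain ⟨l, hl⟩ := hω
  have h1 := ((summable_add_one_rpow (s := 1 + δ) (by linarith)).mul_left
    (lam ^ 2)).hasSum.tendsto_sum_nat
  have h2 := hl.add h1
  obtain ⟨B, hB⟩ := h2.bddAbove_range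
  refine summable_of_sum_range_le (c := B) (fun n => by positivity) fun n => ?_
  refine le_trans (le_of_eq ?_) (hB ⟨n, rfl⟩)
  simp only [← sum_add_distrib]
  refine sum_congr rfl fun m _ => ?_
  have hm : (0 : ℝ) < (m : ℝ) + 1 := by positivity
  rw [neg_add_rev, Real.rpow_add hm, Real.rpow_neg_one]
  field_simp
  ring

end IsDecayingNoise

theorem measurable_direction {Ω : Type*} {m : MeasurableSpace Ω} {p : Ω → ℂ}
    (hp : Measurable p) (z : ℂ) : Measurable fun ω => direction z (p ω) :=
  (hp.const_mul z).div (Complex.measurable_ofReal.comp hp.norm)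

theorem exists_abs_le_of_tendsto {k : ℕ → ℝ} {k₀ : ℝ} (hk : Tendsto k atTop (𝓝 k₀)) :
    ∃ K, ∀ n, |k n| ≤ K := by
  obtain ⟨K, hK⟩ := hk.abs.bddAbove_range
  exact ⟨K, fun n => hK ⟨n, rfl⟩⟩

/-- Almost sure growth rate of a random sheared rotation. -/
theorem IsDecayingNoise.ae_tendsto_log_norm {Ω : Type*} [MeasurableSpace Ω] {ν : Measure Ω}
    [IsProbabilityMeasure ν] {g : ℕ → Ω → ℝ} {lam : ℝ} (hg : IsDecayingNoise ν g lam)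
    {z : ℕ → ℂ} {z₀ : ℂ} (hz : Tendsto z atTop (𝓝 z₀)) (hz2 : z₀ ^ 2 ≠ 1) (hz4 : z₀ ^ 4 ≠ 1)
    {k : ℕ → ℝ} {k₀ : ℝ} (hk : Tendsto k atTop (𝓝 k₀)) {e : ℕ → ℝ} (he : Summable e)
    {p : ℕ → Ω → ℂ} (hpm : ∀ n, Measurable[past g n] (p n))
    (hp : ∀ ω, IsShearedRotation z (fun n => k n * g n ω) e (fun n => p n ω)) :
    ∀ᵐ ω ∂ν, Tendsto (fun n : ℕ => Real.log ‖p n ω‖ / Real.log n) atTop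
      (𝓝 (k₀ ^ 2 * lam ^ 2 / 8)) := by
  obtain ⟨K, hK⟩ := exists_abs_le_of_tendsto hk
  set Y : ℕ → Ω → ℂ := fun n ω => direction (z n) (p n ω) ^ 2 with hY
  have hY1 : ∀ n ω, ‖Y n ω‖ = 1 := fun n ω => by
    rw [hY, norm_pow, norm_direction ((hp ω).norm_eq_one n) ((hp ω).ne_zero n), one_pow]
  have hYm : ∀ n, Measurable[past g n] (Y n) := fun n =>
    Measurable.pow_const (measurable_direction (hpm n) (z n)) 2
  have hK0 : 0 ≤ K := (abs_nonneg _).trans (hK 0)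
  -- the linear term
  have A1 := hg.ae_tendsto_linear (ν := ν)
    (H := fun n ω => k n * (Y n ω).im * (Real.log ((n : ℝ) + 2))⁻¹)
    (w := fun n => K * (Real.log ((n : ℝ) + 2))⁻¹)
    (fun n => ((Complex.measurable_im.comp (hYm n)).const_mul _).mul_const _)
    (fun n ω => by
      have := log_add_two_pos n
      rw [abs_mul, abs_of_pos (inv_pos.2 this)]
      refine mul_le_mul_of_nonneg_right ?_ (inv_nonneg.2 this.le)
      rw [abs_mul]
      exact (mul_le_of_le_one_right (abs_nonneg _)
        ((Complex.abs_im_le_norm _).trans (hY1 n ω).le)).trans (hK n))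
    -- The weight 1/log, to be removed by Kronecker's lemma, turns the divergent variance sum ∑ 1/n
    -- into ∑ 1/(n log² n).
    ((summable_inv_mul_log_sq.mul_left (K ^ 2)).congr fun n => by
      rw [mul_pow, inv_pow]; ring)
  -- the quadratic term
  have A2 := hg.ae_tendsto_quadratic (ν := ν)
    (H := fun n ω => k n ^ 2 * (1 / 8 - (Y n ω).re / 4 + (Y n ω ^ 2).re / 8)) (C := K ^ 2)
    (fun n => (((((Complex.measurable_re.comp (hYm n)).div_const 4).const_sub (1 / 8)).add
      ((Complex.measurable_re.comp (Measurable.pow_const (hYm n) 2)).div_const 8))).const_mul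
        (k n ^ 2))
    (fun n ω => by
      have a1 := (Complex.abs_re_le_norm (Y n ω)).trans (hY1 n ω).le
      have a2 := (Complex.abs_re_le_norm (Y n ω ^ 2)).trans
        (by rw [norm_pow, hY1, one_pow] : ‖Y n ω ^ 2‖ = 1).le
      have a3 : |1 / 8 - (Y n ω).re / 4 + (Y n ω ^ 2).re / 8| ≤ 1 := by
        rw [abs_le] at a1 a2 ⊢
        constructor <;> linarith [a1.1, a1.2, a2.1, a2.2]
      rw [abs_mul, abs_pow]
      exact (mul_le_of_le_one_right (by positivity) a3).trans
        (pow_le_pow_left₀ (abs_nonneg _) (hK n) 2))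
  filter_upwards [A1, A2] with ω h1 h2
  obtain ⟨l1, h1⟩ := h1
  obtain ⟨l2, h2⟩ := h2
  have hV : Tendsto (fun n => k n ^ 2 * lam ^ 2) atTop (𝓝 (k₀ ^ 2 * lam ^ 2)) :=
    (hk.pow 2).mul_const _
  refine (hp ω).tendsto_log_norm_div_log ?_ he hz hz2 hz4 hV ?_ ?_
  · refine Summable.of_nonneg_of_le (fun n => by positivity) (fun n => ?_)
      ((hg.summable_cube ω).mul_left (K ^ 3))
    rw [abs_mul, mul_pow]
    have := hK n
    gcongr
  · refine isLittleO_log_sum_of_tendsto (l := l1) (h1.congr fun n => ?_)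
    refine sum_congr rfl fun m _ => ?_
    rw [div_eq_mul_inv]
    ring
  · refine isLittleO_log_of_tendsto (l := l2) (h2.congr fun n => ?_)
    refine sum_congr rfl fun m _ => ?_
    simp only [hY, div_eq_mul_inv]
    ring

end DeltaComb

/-! ### Convergence of the slopes Re(q/p) and the decaying trajectory. -/

namespace DeltaComb

open Filter Topology Asymptotics Finset MeasureTheory ProbabilityTheory

theorem quotRe_real_mul (p q : ℂ) (w : ℝ) : quotRe p (w * q) = w * quotRe p q := by
  simp only [quotRe, Complex.mul_re, Complex.mul_im, Complex.ofReal_re, Complex.ofReal_im]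
  ring

theorem quotRe_real_mul_mul (p q : ℂ) {r : ℝ} (hr : r ≠ 0) :
    quotRe (r * p) (r * q) = quotRe p q := by
  simp only [quotRe, Complex.mul_re, Complex.mul_im, Complex.ofReal_re, Complex.ofReal_im,
    norm_mul, Complex.norm_real, Real.norm_eq_abs, mul_pow, sq_abs]
  have : r ^ 2 ≠ 0 := pow_ne_zero 2 hr
  rw [show (r * p.re - 0 * p.im) * (r * q.re - 0 * q.im) +
    (r * p.im + 0 * p.re) * (r * q.im + 0 * q.re) = r ^ 2 * (p.re * q.re + p.im * q.im) by ring,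
    mul_div_mul_left _ _ this]

/-- Decompose q = Re(q/p) p + w (ip). By real linearity the first part contributes the old slope
exactly, so the increment is w times the slope of B(ip) relative to B p, for which
`abs_quotRe_shear_sub_le` applies. -/
theorem abs_quotRe_increment_le {B : ℂ →ₗ[ℝ] ℂ} {z : ℂ} (hz : ‖z‖ = 1) {κ e : ℝ}
    (hB : ∀ x, ‖B x - (z * x + (κ * (z * x).im : ℝ))‖ ≤ e * ‖x‖) (hκ : |κ| ≤ 1 / 4)
    (he : e ≤ 1 / 16) {p : ℂ} (hp : p ≠ 0) (hBp : B p ≠ 0) (q : ℂ) :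
    |quotRe (B p) (B q) - quotRe p q -
        wronskian p q / ‖p‖ ^ 2 * (κ * (direction z p ^ 2).re)| ≤
      |wronskian p q| / ‖p‖ ^ 2 * (60 * (κ ^ 2 + e)) := by
  set w : ℝ := wronskian p q / ‖p‖ ^ 2 with hw
  set y := direction z p with hy
  have hn : 0 < ‖p‖ := norm_pos_iff.2 hp
  have hnc : (‖p‖ : ℂ) ≠ 0 := by exact_mod_cast hn.ne'
  have hy1 : ‖y‖ = 1 := norm_direction hz hp
  have hzy : z * p = ‖p‖ * y := (norm_mul_direction hp).symm
  have hq : q = quotRe p q • p + w • (Complex.I * p) := by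
    rw [Complex.real_smul, Complex.real_smul, hw, ← sub_quotRe_smul hp]
    ring
  have hBq : B q = quotRe p q * B p + (w : ℂ) * B (Complex.I * p) := by
    conv_lhs => rw [hq]
    rw [map_add, map_smul, map_smul, Complex.real_smul, Complex.real_smul]
  obtain ⟨δ₁, hδ₁⟩ : ∃ δ : ℂ, δ = (B p - (z * p + (κ * (z * p).im : ℝ))) / ‖p‖ := ⟨_, rfl⟩
  obtain ⟨δ₂, hδ₂⟩ : ∃ δ : ℂ, δ = (B (Complex.I * p) - (z * (Complex.I * p) +
    (κ * (z * (Complex.I * p)).im : ℝ))) / ‖p‖ := ⟨_, rfl⟩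
  have n1 : ‖δ₁‖ ≤ e := by
    rw [hδ₁, norm_div, Complex.norm_real, norm_norm, div_le_iff₀ hn]
    exact hB p
  have n2 : ‖δ₂‖ ≤ e := by
    rw [hδ₂, norm_div, Complex.norm_real, norm_norm, div_le_iff₀ hn]
    simpa using hB (Complex.I * p)
  have b1 : B p = (‖p‖ : ℝ) * (y + (κ * y.im : ℝ) + δ₁) := by
    rw [mul_add, hδ₁, mul_div_cancel₀ _ hnc, hzy, Complex.im_ofReal_mul]
    push_cast
    ring
  have b2 : B (Complex.I * p) = (‖p‖ : ℝ) * (Complex.I * y + (κ * y.re : ℝ) + δ₂) := by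
    have : z * (Complex.I * p) = ‖p‖ * (Complex.I * y) := by
      rw [mul_left_comm, hzy]; ring
    rw [mul_add, hδ₂, mul_div_cancel₀ _ hnc, this, Complex.im_ofReal_mul]
    simp only [Complex.mul_im, Complex.I_re, Complex.I_im, zero_mul, one_mul, zero_add]
    push_cast
    ring
  have h1 := abs_quotRe_shear_sub_le hy1 hκ he n1 n2
  rw [hBq, quotRe_real_smul_add _ hBp, quotRe_real_mul, b1, b2, quotRe_real_mul_mul _ _ hn.ne']
  have e1 : quotRe p q + w * quotRe (y + (κ * y.im : ℝ) + δ₁)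
      (Complex.I * y + (κ * y.re : ℝ) + δ₂) - quotRe p q - w * (κ * (y ^ 2).re) =
      w * (quotRe (y + (κ * y.im : ℝ) + δ₁) (Complex.I * y + (κ * y.re : ℝ) + δ₂) -
        κ * (y ^ 2).re) := by ring
  rw [e1, abs_mul, hw, abs_div, abs_of_pos (by positivity : 0 < ‖p‖ ^ 2)]
  gcongr

theorem exists_tendsto_sum_of_summable_sub {x y : ℕ → ℝ}
    (h : ∃ l, Tendsto (fun n => ∑ m ∈ range n, x m) atTop (𝓝 l))
    (hs : Summable fun n => y n - x n) :
    ∃ l, Tendsto (fun n => ∑ m ∈ range n, y m) atTop (𝓝 l) := by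
  obtain ⟨l, hl⟩ := h
  refine ⟨_, (hl.add hs.hasSum.tendsto_sum_nat).congr fun n => ?_⟩
  rw [← sum_add_distrib]
  exact sum_congr rfl fun m _ => by ring

/-- A solution cannot decay faster than another one of known Wronskian grows; this is the source of
the lower bound in the decay rate. -/
theorem wronskian_le (p q : ℂ) : |wronskian p q| ≤ ‖p‖ * ‖q‖ := by
  have h : wronskian p q = (starRingEnd ℂ p * q).im := by
    simp [wronskian, Complex.mul_im]
    ring
  rw [h]
  refine (Complex.abs_im_le_norm _).trans ?_
  simp

theorem measurable_truncated_weight {Ω : Type*} {m : MeasurableSpace Ω} {p : Ω → ℂ}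
    (hp : Measurable p) (z : ℂ) (a w k b : ℝ) : Measurable fun ω => if a ≤ ‖p ω‖ ^ 2 then
      w / ‖p ω‖ ^ 2 * (k * (direction z (p ω) ^ 2).re) * b else 0 := by
  have h1 : Measurable fun ω => ‖p ω‖ ^ 2 := hp.norm.pow_const 2
  have h2 : Measurable fun ω => (direction z (p ω) ^ 2).re :=
    Complex.measurable_re.comp ((measurable_direction hp z).pow_const 2)
  exact Measurable.ite (measurableSet_le measurable_const h1)
    (((h1.const_div w).mul (h2.const_mul k)).mul_const b) measurable_const

/-- A pair of random sheared rotations with a common deterministic Wronskian. -/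
structure IsRandomShear {Ω : Type*} (g : ℕ → Ω → ℝ) (z : ℕ → ℂ) (k e W : ℕ → ℝ)
    (B : ℕ → Ω → ℂ →ₗ[ℝ] ℂ) (p q : ℕ → Ω → ℂ) : Prop where
  norm_eq_one : ∀ n, ‖z n‖ = 1
  error : ∀ n ω x, ‖B n ω x - (z n * x + ((k n * g n ω) * (z n * x).im : ℝ))‖ ≤ e n * ‖x‖
  left : ∀ n ω, p (n + 1) ω = B n ω (p n ω)
  right : ∀ n ω, q (n + 1) ω = B n ω (q n ω)
  wronskian_eq : ∀ n ω, wronskian (p n ω) (q n ω) = W n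
  measurable : ∀ n, Measurable[past g n] (p n)

namespace IsRandomShear

variable {Ω : Type*} {g : ℕ → Ω → ℝ} {z : ℕ → ℂ} {k e W : ℕ → ℝ}
    {B : ℕ → Ω → ℂ →ₗ[ℝ] ℂ} {p q : ℕ → Ω → ℂ}

theorem left_ne_zero (h : IsRandomShear g z k e W B p q) (hW : ∀ n, W n ≠ 0) (n : ℕ) (ω : Ω) :
    p n ω ≠ 0 := by
  intro h0
  refine hW n ?_
  rw [← h.wronskian_eq n ω, h0]
  simp [wronskian]

theorem isShearedRotation (h : IsRandomShear g z k e W B p q) (hW : ∀ n, W n ≠ 0) (ω : Ω) :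
    IsShearedRotation z (fun n => k n * g n ω) e (fun n => p n ω) where
  ne_zero n := h.left_ne_zero hW n ω
  norm_eq_one := h.norm_eq_one
  error n := by rw [h.left]; exact h.error n ω _

variable [MeasurableSpace Ω] {ν : Measure Ω} [IsProbabilityMeasure ν] {lam : ℝ}

/-- Weighted convergence of the slopes `quotRe (p n) (q n)`, given a growth rate of `p`. -/
theorem ae_exists_tendsto_weighted (h : IsRandomShear g z k e W B p q)
    (hg : IsDecayingNoise ν g lam) {K : ℝ} (hK : ∀ n, |k n| ≤ K) (he : Summable e) {w₁ w₂ : ℝ}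
    (hw₁ : 0 < w₁) (hW₁ : ∀ n, w₁ ≤ |W n|) (hW₂ : ∀ n, |W n| ≤ w₂) {s r : ℝ} (hsr : s < r)
    (hp : ∀ᵐ ω ∂ν, ∀ᶠ n : ℕ in atTop, ((n : ℝ) + 1) ^ r ≤ ‖p n ω‖ ^ 2) :
    ∀ᵐ ω ∂ν, ∃ l, Tendsto (fun n => ∑ m ∈ range n,
      (quotRe (p (m + 1) ω) (q (m + 1) ω) - quotRe (p m ω) (q m ω)) * ((m : ℝ) + 1) ^ s)
      atTop (𝓝 l) := by
  have hW0 : ∀ n, W n ≠ 0 := fun n => abs_pos.1 (hw₁.trans_le (hW₁ n))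
  have hw₂ : 0 ≤ w₂ := (abs_nonneg _).trans (hW₂ 0)
  have hK0 : 0 ≤ K := (abs_nonneg _).trans (hK 0)
  set X : ℕ → Ω → ℝ := fun n ω =>
    W n / ‖p n ω‖ ^ 2 * (k n * (direction (z n) (p n ω) ^ 2).re) * ((n : ℝ) + 1) ^ s with hX
  -- The martingale argument needs a deterministic bound on the weights, but the growth of p is only
  -- almost sure and starts at a random time. The truncation is predictable and, by `hp`, almost
  -- surely inactive from some index on.
  set H : ℕ → Ω → ℝ := fun n ω =>
    if ((n : ℝ) + 1) ^ r ≤ ‖p n ω‖ ^ 2 then X n ω else 0 with hH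
  have hHm : ∀ n, Measurable[past g n] (H n) := fun n =>
    measurable_truncated_weight (h.measurable n) (z n) _ (W n) (k n) _
  have hpos : ∀ n : ℕ, (0 : ℝ) < (n : ℝ) + 1 := fun n => by positivity
  have hinv : ∀ (n : ℕ) ω, ((n : ℝ) + 1) ^ r ≤ ‖p n ω‖ ^ 2 →
      |W n| / ‖p n ω‖ ^ 2 * ((n : ℝ) + 1) ^ s ≤ w₂ * ((n : ℝ) + 1) ^ (-(r - s)) := by
    intro n ω hn
    have h1 : 0 < ((n : ℝ) + 1) ^ r := Real.rpow_pos_of_pos (hpos n) _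
    calc |W n| / ‖p n ω‖ ^ 2 * ((n : ℝ) + 1) ^ s
        ≤ w₂ / ((n : ℝ) + 1) ^ r * ((n : ℝ) + 1) ^ s := by
          have := hW₂ n
          gcongr
      _ = _ := by
        rw [show -(r - s) = s - r by ring, Real.rpow_sub (hpos n)]
        ring
  have hre : ∀ (n : ℕ) ω, |(direction (z n) (p n ω) ^ 2).re| ≤ 1 := fun n ω => by
    refine (Complex.abs_re_le_norm _).trans ?_
    rw [norm_pow, norm_direction (h.norm_eq_one n) (h.left_ne_zero hW0 n ω), one_pow]
  have hXb : ∀ (n : ℕ) ω, ((n : ℝ) + 1) ^ r ≤ ‖p n ω‖ ^ 2 →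
      |X n ω| ≤ w₂ * K * ((n : ℝ) + 1) ^ (-(r - s)) := by
    intro n ω hn
    have h1 := hinv n ω hn
    have h2 : |k n * (direction (z n) (p n ω) ^ 2).re| ≤ K * 1 := by
      rw [abs_mul]
      exact mul_le_mul (hK n) (hre n ω) (abs_nonneg _) hK0
    calc |X n ω| = |W n| / ‖p n ω‖ ^ 2 * ((n : ℝ) + 1) ^ s *
          |k n * (direction (z n) (p n ω) ^ 2).re| := by
          rw [hX, abs_mul, abs_mul, abs_div, abs_of_nonneg (sq_nonneg ‖p n ω‖),
            abs_of_nonneg (Real.rpow_nonneg (hpos n).le s)]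
          ring
      _ ≤ w₂ * ((n : ℝ) + 1) ^ (-(r - s)) * (K * 1) := by
        have : 0 ≤ w₂ * ((n : ℝ) + 1) ^ (-(r - s)) := by positivity
        gcongr
      _ = _ := by ring
  have hHb : ∀ (n : ℕ) ω, |H n ω| ≤ w₂ * K * ((n : ℝ) + 1) ^ (-(r - s)) := by
    intro n ω
    by_cases hn : ((n : ℝ) + 1) ^ r ≤ ‖p n ω‖ ^ 2
    · simp only [hH, if_pos hn]
      exact hXb n ω hn
    · simp only [hH, if_neg hn, abs_zero]
      positivity
  -- The truncated weights are of size n^(-(r - s)), so the variances sum like n^(-1 - 2(r - s)).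
  have A1 := hg.ae_tendsto_linear (ν := ν) hHm hHb (by
    refine ((summable_add_one_rpow (s := 1 + 2 * (r - s)) (by linarith)).mul_left
      ((w₂ * K) ^ 2)).congr fun n => ?_
    rw [mul_pow (w₂ * K) (((n : ℝ) + 1) ^ (-(r - s))),
      ← Real.rpow_natCast (((n : ℝ) + 1) ^ (-(r - s))), ← Real.rpow_mul (hpos n).le,
      ← Real.rpow_neg_one ((n : ℝ) + 1), mul_assoc, ← Real.rpow_add (hpos n)]
    congr 2
    push_cast
    ring)
  have A2 := hg.ae_summable_sq (sub_pos.2 hsr)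
  filter_upwards [A1, A2, hp] with ω h1 h2 h3
  -- Away from the martingale part, the weighted increments are bounded by n^(-(r - s)) g² plus the
  -- deterministic error, both summable.
  refine exists_tendsto_sum_of_summable_sub h1 ?_
  have hs1 : Summable fun n : ℕ =>
      w₂ * 60 * (K ^ 2 * (((n : ℝ) + 1) ^ (-(r - s)) * g n ω ^ 2) + e n) :=
    ((h2.mul_left (K ^ 2)).add he).mul_left (w₂ * 60)
  refine Summable.of_norm_bounded_eventually_nat hs1 ?_
  have hk0 : Tendsto (fun n => k n * g n ω) atTop (𝓝 0) := by
    refine squeeze_zero_norm (fun n => ?_)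
      (by simpa using (hg.tendsto_zero ω).norm.const_mul K)
    rw [norm_mul]
    exact mul_le_mul_of_nonneg_right (hK n) (norm_nonneg _)
  filter_upwards [hk0.abs.eventually (ge_mem_nhds (show |(0:ℝ)| < 1 / 4 by norm_num)),
    he.tendsto_atTop_zero.eventually (ge_mem_nhds (show (0:ℝ) < 1 / 16 by norm_num)), h3]
    with n hn1 hn2 hn3
  have hBp : B n ω (p n ω) ≠ 0 := by
    rw [← h.left]; exact h.left_ne_zero hW0 _ _
  have e1 := abs_quotRe_increment_le (h.norm_eq_one n) (h.error n ω) hn1 hn2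
    (h.left_ne_zero hW0 n ω) hBp (q n ω)
  rw [h.wronskian_eq, ← h.left, ← h.right] at e1
  have e2 : (quotRe (p (n + 1) ω) (q (n + 1) ω) - quotRe (p n ω) (q n ω)) * ((n : ℝ) + 1) ^ s -
      H n ω * g n ω = (quotRe (p (n + 1) ω) (q (n + 1) ω) - quotRe (p n ω) (q n ω) -
        W n / ‖p n ω‖ ^ 2 * (k n * g n ω * (direction (z n) (p n ω) ^ 2).re)) *
        ((n : ℝ) + 1) ^ s := by
    simp only [hH, if_pos hn3, hX]
    ring
  have e3 : 0 ≤ e n := by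
    have := (norm_nonneg _).trans (h.error n ω 1)
    simpa using this
  rw [Real.norm_eq_abs, e2, abs_mul, abs_of_nonneg (Real.rpow_nonneg (hpos n).le s)]
  have e4 : 0 ≤ (k n * g n ω) ^ 2 + e n := by positivity
  have e5 : ((n : ℝ) + 1) ^ (-(r - s)) ≤ 1 :=
    Real.rpow_le_one_of_one_le_of_nonpos (by have : (0:ℝ) ≤ n := by positivity
                                             linarith) (by linarith)
  calc _ ≤ |W n| / ‖p n ω‖ ^ 2 * (60 * ((k n * g n ω) ^ 2 + e n)) * ((n : ℝ) + 1) ^ s := by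
        gcongr
    _ = |W n| / ‖p n ω‖ ^ 2 * ((n : ℝ) + 1) ^ s * (60 * ((k n * g n ω) ^ 2 + e n)) := by ring
    _ ≤ w₂ * ((n : ℝ) + 1) ^ (-(r - s)) * (60 * ((k n * g n ω) ^ 2 + e n)) := by
        have := hinv n ω hn3
        gcongr
    _ = w₂ * 60 * (k n ^ 2 * (((n : ℝ) + 1) ^ (-(r - s)) * g n ω ^ 2) +
          ((n : ℝ) + 1) ^ (-(r - s)) * e n) := by ring
    _ ≤ w₂ * 60 * (K ^ 2 * (((n : ℝ) + 1) ^ (-(r - s)) * g n ω ^ 2) + 1 * e n) := by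
        have : k n ^ 2 ≤ K ^ 2 := by
          rw [← sq_abs (k n)]; exact pow_le_pow_left₀ (abs_nonneg _) (hK n) 2
        gcongr
    _ = _ := by rw [one_mul]

/-- Almost surely `p` grows like `n ^ β` and some combination `q - c p` decays like `n ^ (-β)`. -/
theorem ae_exists_decaying (h : IsRandomShear g z k e W B p q) (hg : IsDecayingNoise ν g lam)
    {z₀ : ℂ} (hz : Tendsto z atTop (𝓝 z₀)) (hz2 : z₀ ^ 2 ≠ 1) (hz4 : z₀ ^ 4 ≠ 1)
    {k₀ : ℝ} (hk : Tendsto k atTop (𝓝 k₀)) (he : Summable e) {w₁ w₂ : ℝ}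
    (hw₁ : 0 < w₁) (hW₁ : ∀ n, w₁ ≤ |W n|) (hW₂ : ∀ n, |W n| ≤ w₂)
    {β : ℝ} (hβ : 0 < β) (hβk : β = k₀ ^ 2 * lam ^ 2 / 8) :
    ∀ᵐ ω ∂ν, Tendsto (fun n : ℕ => Real.log ‖p n ω‖ / Real.log n) atTop (𝓝 β) ∧
      ∃ c : ℝ, Tendsto (fun n : ℕ => Real.log ‖q n ω - c * p n ω‖ / Real.log n) atTop
        (𝓝 (-β)) := by
  obtain ⟨K, hK⟩ := exists_abs_le_of_tendsto hk
  have hW0 : ∀ n, W n ≠ 0 := fun n => abs_pos.1 (hw₁.trans_le (hW₁ n))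
  have hp0 : ∀ n ω, p n ω ≠ 0 := h.left_ne_zero hW0
  have hpn : ∀ n ω, 0 < ‖p n ω‖ := fun n ω => norm_pos_iff.2 (hp0 n ω)
  have hgrow := hg.ae_tendsto_log_norm hz hz2 hz4 hk he h.measurable (h.isShearedRotation hW0)
  rw [← hβk] at hgrow
  -- A sequence of exponents with limit 2β: countably many, so that one null set serves them all.
  set s : ℕ → ℝ := fun j => 2 * β * (1 - 1 / ((j : ℝ) + 2)) with hs
  have hs0 : ∀ j, 0 < s j := fun j => by
    have h1 : (1 : ℝ) / ((j : ℝ) + 2) < 1 := by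
      rw [div_lt_one (by positivity)]
      have : (0:ℝ) ≤ j := by positivity
      linarith
    have := sub_pos.2 h1
    positivity
  have hs1 : ∀ j, s j < 2 * β := fun j => by
    have h1 : (0 : ℝ) < 1 / ((j : ℝ) + 2) := by positivity
    simp only [hs]
    nlinarith
  have hslim : Tendsto s atTop (𝓝 (2 * β)) := by
    have h1 : Tendsto (fun j : ℕ => 1 / ((j : ℝ) + 2)) atTop (𝓝 0) := by
      simp_rw [one_div]
      exact tendsto_inv_atTop_zero.comp
        (tendsto_atTop_add_const_right _ _ tendsto_natCast_atTop_atTop)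
    have h2 := (h1.const_sub 1).const_mul (2 * β)
    rwa [sub_zero, mul_one] at h2
  have hw : ∀ᵐ ω ∂ν, ∀ j, ∃ l, Tendsto (fun n => ∑ m ∈ range n,
      (quotRe (p (m + 1) ω) (q (m + 1) ω) - quotRe (p m ω) (q m ω)) * ((m : ℝ) + 1) ^ s j)
      atTop (𝓝 l) := by
    rw [ae_all_iff]
    intro j
    -- The order is s j < r < r' < 2β: the growth rate yields |p|² ≥ n^r', and the gap to r absorbs
    -- the passage from n to n + 1.
    obtain ⟨r, hr1, hr2⟩ := exists_between (hs1 j)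
    obtain ⟨r', hr3, hr4⟩ := exists_between hr2
    refine h.ae_exists_tendsto_weighted hg hK he hw₁ hW₁ hW₂ hr1 ?_
    filter_upwards [hgrow] with ω hω
    have h1 := ((tendsto_log_div_log_iff fun n => hpn n ω).1 hω).1 (r' / 2) (by linarith)
    filter_upwards [h1, eventually_add_one_rpow_le ((hs0 j).trans hr1).le hr3] with n h2 h3
    refine h3.trans ?_
    calc (n : ℝ) ^ r' = ((n : ℝ) ^ (r' / 2)) ^ 2 := by
          rw [← Real.rpow_natCast, ← Real.rpow_mul (by positivity)]
          congr 1
          push_cast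
          ring
      _ ≤ _ := by gcongr
  filter_upwards [hgrow, hw] with ω h1 h2
  refine ⟨h1, ?_⟩
  have h3 := (tendsto_log_div_log_iff fun n => hpn n ω).1 h1
  choose l hl using h2
  have h4 := fun j => exists_limit_of_weighted_increments (c := fun n => quotRe (p n ω) (q n ω))
    (hs0 j) (hl j)
  choose c₀ C hc hC using h4
  have hcc : ∀ j, c₀ j = c₀ 0 := fun j => tendsto_nhds_unique (hc j) (hc 0)
  refine ⟨c₀ 0, ?_⟩
  -- Subtracting a multiple of p does not change the Wronskian; hence q - c p never vanishes, and |q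
  -- - c p| ≥ |W|/|p|.
  have hwr : ∀ n, wronskian (p n ω) (q n ω - c₀ 0 * p n ω) = W n := fun n => by
    rw [← h.wronskian_eq n ω]
    simp [wronskian]
    ring
  have hd0 : ∀ n, 0 < ‖q n ω - c₀ 0 * p n ω‖ := fun n => by
    rw [norm_pos_iff]
    intro h0
    refine hW0 n ?_
    rw [← hwr n, h0]
    simp [wronskian]
  rw [tendsto_log_div_log_iff hd0]
  constructor
  · intro γ hγ
    obtain ⟨γ', hγ1, hγ2⟩ := exists_between hγ
    filter_upwards [h3.2 (-γ') (by linarith), eventually_const_mul_rpow_le w₁⁻¹ hγ1,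
      eventually_gt_atTop 0] with n a1 a2 a3
    have hn : (0 : ℝ) < n := by exact_mod_cast a3
    have a4 := (hW₁ n).trans ((hwr n ▸ wronskian_le (p n ω) (q n ω - c₀ 0 * p n ω)))
    have a5 : w₁ ≤ (n : ℝ) ^ (-γ') * ‖q n ω - c₀ 0 * p n ω‖ := a4.trans (by gcongr)
    rw [inv_mul_le_iff₀ hw₁] at a2
    refine a2.trans ?_
    calc w₁ * (n : ℝ) ^ γ' ≤ (n : ℝ) ^ (-γ') * ‖q n ω - c₀ 0 * p n ω‖ * (n : ℝ) ^ γ' := by gcongr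
      _ = ((n : ℝ) ^ (-γ') * (n : ℝ) ^ γ') * ‖q n ω - c₀ 0 * p n ω‖ := by ring
      _ = _ := by rw [← Real.rpow_add hn]; simp
  · intro γ hγ
    -- γ = -β + 3η. The slope error n^(-2β + η) times |p| ≤ n^(β + η) gives n^(-β + 2η), and the
    -- last η absorbs the constants.
    have hη : 0 < (γ + β) / 3 := by linarith
    set η := (γ + β) / 3 with hηd
    obtain ⟨j, hj⟩ := (hslim.eventually (lt_mem_nhds (show 2 * β - η < 2 * β by linarith))).exists
    filter_upwards [h3.2 (β + η) (by linarith), h3.1 (β - η) (by linarith),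
      eventually_const_mul_rpow_le (|C j| + w₂) (show -β + 2 * η < γ by linarith),
      eventually_gt_atTop 0] with n a1 a2 a3 a4
    have hn : (0 : ℝ) < n := by exact_mod_cast a4
    have hn1 : (1 : ℝ) ≤ n := by exact_mod_cast a4
    refine le_trans ?_ a3
    have b1 : q n ω - c₀ 0 * p n ω = ((quotRe (p n ω) (q n ω) - c₀ 0 : ℝ) : ℂ) * p n ω +
        (W n / ‖p n ω‖ ^ 2 : ℝ) * (Complex.I * p n ω) := by
      rw [← h.wronskian_eq n ω, ← sub_quotRe_smul (hp0 n ω)]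
      push_cast
      ring
    have b2 : |quotRe (p n ω) (q n ω) - c₀ 0| ≤ |C j| * (n : ℝ) ^ (-(2 * β - η)) := by
      rw [← hcc j]
      refine (hC j n).trans ?_
      calc C j * ((n : ℝ) + 1) ^ (-s j) ≤ |C j| * (n : ℝ) ^ (-s j) := by
            refine mul_le_mul (le_abs_self _) ?_ (by positivity) (abs_nonneg _)
            exact Real.rpow_le_rpow_of_nonpos hn (by linarith) (by linarith [hs0 j])
        _ ≤ _ := by
            gcongr
    have b3 : |W n| / ‖p n ω‖ ≤ w₂ * (n : ℝ) ^ (-(β - η)) := by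
      rw [Real.rpow_neg hn.le, ← div_eq_mul_inv]
      have := hW₂ n
      have h0 : 0 < (n : ℝ) ^ (β - η) := Real.rpow_pos_of_pos hn _
      have : 0 ≤ w₂ := (abs_nonneg _).trans this
      gcongr
    calc ‖q n ω - c₀ 0 * p n ω‖
        ≤ |quotRe (p n ω) (q n ω) - c₀ 0| * ‖p n ω‖ + |W n| / ‖p n ω‖ := by
          rw [b1]
          refine (norm_add_le _ _).trans (add_le_add ?_ ?_)
          · rw [norm_mul, Complex.norm_real, Real.norm_eq_abs]
          · have := hpn n ω
            rw [norm_mul, norm_mul, Complex.norm_I, Complex.norm_real, Real.norm_eq_abs, abs_div,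
              abs_of_pos (by positivity : 0 < ‖p n ω‖ ^ 2), one_mul]
            apply le_of_eq
            field_simp
      _ ≤ |C j| * (n : ℝ) ^ (-(2 * β - η)) * (n : ℝ) ^ (β + η) + w₂ * (n : ℝ) ^ (-(β - η)) := by
          gcongr
      _ = |C j| * (n : ℝ) ^ (-β + 2 * η) + w₂ * (n : ℝ) ^ (-β + η) := by
          rw [mul_assoc, ← Real.rpow_add hn]
          congr 3 <;> ring
      _ ≤ |C j| * (n : ℝ) ^ (-β + 2 * η) + w₂ * (n : ℝ) ^ (-β + 2 * η) := by
          have : 0 ≤ w₂ := (abs_nonneg _).trans (hW₂ 0)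
          gcongr
          linarith
      _ = _ := by ring

end IsRandomShear

end DeltaComb

namespace DeltaComb

open Set Filter Topology

/-! ### Solutions for a comb with increasing nodes -/

/-- The solution of `-u'' = k² u` with `u t = α`, `u' t = β`. -/
noncomputable def freeSol (k t α β x : ℝ) : ℝ :=
  α * Real.cos (k * (x - t)) + β * (Real.sin (k * (x - t)) / k)

/-- The derivative of `freeSol`. -/
noncomputable def freeSolDeriv (k t α β x : ℝ) : ℝ :=
  -(α * (k * Real.sin (k * (x - t)))) + β * Real.cos (k * (x - t))

/-- The transfer matrix across an interval of length `s` followed by a delta of strength `y`. -/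
noncomputable def transfer (k s y : ℝ) : (ℝ × ℝ) →ₗ[ℝ] (ℝ × ℝ) where
  toFun x := (Real.cos (k * s) * x.1 + Real.sin (k * s) / k * x.2,
    y * (Real.cos (k * s) * x.1 + Real.sin (k * s) / k * x.2) +
      (-(k * Real.sin (k * s)) * x.1 + Real.cos (k * s) * x.2))
  map_add' x y := by ext <;> simp <;> ring
  map_smul' r x := by ext <;> simp <;> ring

theorem transfer_apply (k s y : ℝ) (x : ℝ × ℝ) : transfer k s y x =
    (Real.cos (k * s) * x.1 + Real.sin (k * s) / k * x.2,
    y * (Real.cos (k * s) * x.1 + Real.sin (k * s) / k * x.2) +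
      (-(k * Real.sin (k * s)) * x.1 + Real.cos (k * s) * x.2)) := rfl

/-- The symplectic form on `ℝ²`. -/
def sympl (x y : ℝ × ℝ) : ℝ := x.1 * y.2 - x.2 * y.1

/-- Free propagation and a delta each have determinant 1. -/
theorem sympl_transfer {k : ℝ} (hk : k ≠ 0) (s c : ℝ) (x y : ℝ × ℝ) :
    sympl (transfer k s c x) (transfer k s c y) = sympl x y := by
  simp only [sympl, transfer_apply]
  field_simp
  linear_combination k ^ 2 * (x.1 * y.2 - x.2 * y.1) * Real.sin_sq_add_cos_sq (k * s)

theorem hasDerivAt_freeSol {k : ℝ} (hk : k ≠ 0) (t α β x : ℝ) :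
    HasDerivAt (freeSol k t α β) (freeSolDeriv k t α β x) x := by
  have h0 : HasDerivAt (fun x => k * (x - t)) k x := by
    simpa using ((hasDerivAt_id x).sub_const t).const_mul k
  have h1 := (h0.cos.const_mul α).add ((h0.sin.div_const k).const_mul β)
  refine h1.congr_deriv ?_
  simp only [freeSolDeriv]
  field_simp

theorem hasDerivAt_freeSolDeriv (k t α β x : ℝ) :
    HasDerivAt (freeSolDeriv k t α β) (-k ^ 2 * freeSol k t α β x) x := by
  by_cases hk : k = 0
  · subst hk
    have : freeSolDeriv 0 t α β = fun _ => β := by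
      ext x; simp [freeSolDeriv]
    rw [this]
    simpa using hasDerivAt_const x β
  have h0 : HasDerivAt (fun x => k * (x - t)) k x := by
    simpa using ((hasDerivAt_id x).sub_const t).const_mul k
  have h1 := ((h0.sin.const_mul k).const_mul α).neg.add (h0.cos.const_mul β)
  refine h1.congr_deriv ?_
  simp only [freeSol]
  field_simp
  ring

@[simp] theorem freeSol_self (k t α β : ℝ) : freeSol k t α β t = α := by simp [freeSol]

@[simp] theorem freeSolDeriv_self (k t α β : ℝ) : freeSolDeriv k t α β t = β := by
  simp [freeSolDeriv]

section Comb

variable {b : ℝ} {t : ℕ → ℝ} {c : ℕ → ℝ} {k : ℝ}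

theorem exists_mem_Ico_of_tendsto (htb : Tendsto t atTop (𝓝 b)) {x : ℝ}
    (hx : x ∈ Ico (t 0) b) : ∃ j, x ∈ Ico (t j) (t (j + 1)) := by
  have h : ∃ j, x < t j := (htb.eventually (lt_mem_nhds hx.2)).exists
  classical
  have h0 : Nat.find h ≠ 0 := fun h0 => by
    have := Nat.find_spec h
    rw [h0] at this
    exact absurd hx.1 (not_le.2 this)
  obtain ⟨j, hj⟩ := Nat.exists_eq_succ_of_ne_zero h0
  refine ⟨j, ?_, ?_⟩
  · exact not_lt.1 (Nat.find_min h (by omega))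
  · have := Nat.find_spec h
    rwa [hj] at this

theorem notMem_range_of_mem_Ioo (ht : StrictMono t) {x : ℝ} {j : ℕ}
    (hx : x ∈ Ioo (t j) (t (j + 1))) : x ∉ range fun i => t (i + 1) := by
  rintro ⟨i, rfl⟩
  have h1 := ht.lt_iff_lt.1 hx.1
  have h2 := ht.lt_iff_lt.1 hx.2
  omega

theorem exists_mem_Ioo_of_notMem_range (htb : Tendsto t atTop (𝓝 b)) {x : ℝ}
    (hx : x ∈ Ioo (t 0) b) (hxr : x ∉ range fun i => t (i + 1)) :
    ∃ j, x ∈ Ioo (t j) (t (j + 1)) := by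
  obtain ⟨j, hj⟩ := exists_mem_Ico_of_tendsto htb ⟨hx.1.le, hx.2⟩
  refine ⟨j, lt_of_le_of_ne hj.1 ?_, hj.2⟩
  rintro rfl
  cases j with
  | zero => exact lt_irrefl _ hx.1
  | succ j => exact hxr ⟨j, rfl⟩

theorem lt_of_strictMono_of_tendsto (ht : StrictMono t) (htb : Tendsto t atTop (𝓝 b)) (j : ℕ) :
    t j < b :=
  (ht (Nat.lt_succ_self j)).trans_le (ht.monotone.ge_of_tendsto htb _)

variable {u u' : ℝ → ℝ}

/-- Between consecutive points of the comb a solution is free. -/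
theorem IsSolution.eq_freeSol (h : IsSolution b (fun j => t (j + 1)) c (k ^ 2) u u')
    (hk : k ≠ 0) (ht : StrictMono t) (ht0 : t 0 = 0) (htb : Tendsto t atTop (𝓝 b)) {j : ℕ}
    {x : ℝ} (hx : x ∈ Ico (t j) (t (j + 1))) :
    u x = freeSol k (t j) (u (t j)) (u' (t j)) x ∧
      u' x = freeSolDeriv k (t j) (u (t j)) (u' (t j)) x := by
  have htj : 0 ≤ t j := ht0 ▸ ht.monotone (Nat.zero_le j)
  have hb := lt_of_strictMono_of_tendsto ht htb (j + 1)
  rcases hx.1.eq_or_lt with rfl | hlt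
  · simp
  set C : ℝ → ℝ := fun y => Real.cos (k * (y - t j)) with hC
  set S : ℝ → ℝ := fun y => Real.sin (k * (y - t j)) with hS
  have hC' : ∀ y, HasDerivAt C (-(k * S y)) y := fun y => by
    have h0 : HasDerivAt (fun x => k * (x - t j)) k y := by
      simpa using ((hasDerivAt_id y).sub_const (t j)).const_mul k
    refine h0.cos.congr_deriv ?_
    simp only [hS]; ring
  have hS' : ∀ y, HasDerivAt S (k * C y) y := fun y => by
    have h0 : HasDerivAt (fun x => k * (x - t j)) k y := by
      simpa using ((hasDerivAt_id y).sub_const (t j)).const_mul k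
    refine h0.sin.congr_deriv ?_
    simp only [hC]; ring
  have hmem : ∀ y ∈ Ioo (t j) x, y ∈ Ioo 0 b ∧ y ∉ range fun j => t (j + 1) := fun y hy =>
    ⟨⟨htj.trans_lt hy.1, (hy.2.trans hx.2).trans hb⟩,
      notMem_range_of_mem_Ioo ht ⟨hy.1, hy.2.trans hx.2⟩⟩
  have hxm : x ∈ Ioo 0 b ∧ x ∉ range fun j => t (j + 1) :=
    ⟨⟨htj.trans_lt hlt, hx.2.trans hb⟩, notMem_range_of_mem_Ioo ht ⟨hlt, hx.2⟩⟩
  have cu : ContinuousOn u (Icc (t j) x) := h.continuousOn.mono fun y hy =>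
    ⟨htj.trans hy.1, (hy.2.trans_lt hx.2).trans hb⟩
  have cu' : ContinuousOn u' (Icc (t j) x) := by
    intro y hy
    rcases hy.1.eq_or_lt with rfl | hlt'
    · exact (h.right_continuous _ ⟨htj, (hy.2.trans_lt hx.2).trans hb⟩).mono fun z hz => hz.1
    · rcases hy.2.eq_or_lt with rfl | hlt''
      · exact (h.hasDerivAt_deriv _ hxm.1 hxm.2).continuousAt.continuousWithinAt
      · have := hmem y ⟨hlt', hlt''⟩
        exact (h.hasDerivAt_deriv _ this.1 this.2).continuousAt.continuousWithinAt
  have cC : Continuous C := continuous_iff_continuousAt.2 fun y => (hC' y).continuousAt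
  have cS : Continuous S := continuous_iff_continuousAt.2 fun y => (hS' y).continuousAt
  have const : ∀ F : ℝ → ℝ, ContinuousOn F (Icc (t j) x) →
      (∀ y ∈ Ioo (t j) x, HasDerivAt F 0 y) → F x = F (t j) := by
    intro F hF hF'
    obtain ⟨y, hy, hy'⟩ := exists_hasDerivAt_eq_slope F (fun _ => 0) hlt hF hF'
    have : x - t j ≠ 0 := (sub_pos.2 hlt).ne'
    rw [eq_div_iff this, zero_mul] at hy'
    linarith
  -- Uniqueness without Picard-Lindelöf: this combination and the next have zero derivative, and
  -- together they determine u and u'.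
  have h1 := const (fun y => k * u y * C y - u' y * S y)
    (((continuousOn_const.mul cu).mul cC.continuousOn).sub (cu'.mul cS.continuousOn))
    fun y hy => by
      have hy := hmem y hy
      have := (((h.hasDerivAt y hy.1 hy.2).const_mul k).mul (hC' y)).sub
        ((h.hasDerivAt_deriv y hy.1 hy.2).mul (hS' y))
      refine this.congr_deriv ?_
      ring
  have h2 := const (fun y => k * u y * S y + u' y * C y)
    (((continuousOn_const.mul cu).mul cS.continuousOn).add (cu'.mul cC.continuousOn))
    fun y hy => by
      have hy := hmem y hy
      have := (((h.hasDerivAt y hy.1 hy.2).const_mul k).mul (hS' y)).add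
        ((h.hasDerivAt_deriv y hy.1 hy.2).mul (hC' y))
      refine this.congr_deriv ?_
      ring
  have hsc : S x ^ 2 + C x ^ 2 = 1 := Real.sin_sq_add_cos_sq _
  have e1 : C (t j) = 1 := by simp [hC]
  have e2 : S (t j) = 0 := by simp [hS]
  simp only [e1, e2] at h1 h2
  constructor
  · simp only [freeSol]
    change u x = u (t j) * C x + u' (t j) * (S x / k)
    field_simp
    linear_combination C x * h1 + S x * h2 - k * u x * hsc
  · simp only [freeSolDeriv]
    change u' x = -(u (t j) * (k * S x)) + u' (t j) * C x
    linear_combination C x * h2 - S x * h1 - u' x * hsc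

theorem IsSolution.apply_succ (h : IsSolution b (fun j => t (j + 1)) c (k ^ 2) u u')
    (hk : k ≠ 0) (ht : StrictMono t) (ht0 : t 0 = 0) (htb : Tendsto t atTop (𝓝 b)) (j : ℕ) :
    (u (t (j + 1)), u' (t (j + 1))) =
      transfer k (t (j + 1) - t j) (c j) (u (t j), u' (t j)) := by
  have hlt : t j < t (j + 1) := ht (Nat.lt_succ_self j)
  have hpos : 0 < t (j + 1) := by
    rw [← ht0]; exact ht (Nat.succ_pos j)
  have hb := lt_of_strictMono_of_tendsto ht htb (j + 1)
  have hev : ∀ᶠ x in 𝓝[<] t (j + 1), x ∈ Ico (t j) (t (j + 1)) := by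
    filter_upwards [Ioo_mem_nhdsLT hlt] with x hx using ⟨hx.1.le, hx.2⟩
  have h1 : u (t (j + 1)) = freeSol k (t j) (u (t j)) (u' (t j)) (t (j + 1)) := by
    have l1 : Tendsto u (𝓝[<] t (j + 1)) (𝓝 (u (t (j + 1)))) :=
      ((h.continuousOn.continuousAt (Ico_mem_nhds hpos hb)).tendsto).mono_left nhdsWithin_le_nhds
    have l2 : Tendsto (freeSol k (t j) (u (t j)) (u' (t j))) (𝓝[<] t (j + 1))
        (𝓝 (freeSol k (t j) (u (t j)) (u' (t j)) (t (j + 1)))) :=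
      (hasDerivAt_freeSol hk _ _ _ _).continuousAt.tendsto.mono_left nhdsWithin_le_nhds
    exact tendsto_nhds_unique l1 (l2.congr' (hev.mono fun x hx =>
      (h.eq_freeSol hk ht ht0 htb hx).1.symm))
  have h2 : u' (t (j + 1)) - c j * u (t (j + 1)) =
      freeSolDeriv k (t j) (u (t j)) (u' (t j)) (t (j + 1)) := by
    have l2 : Tendsto (freeSolDeriv k (t j) (u (t j)) (u' (t j))) (𝓝[<] t (j + 1))
        (𝓝 (freeSolDeriv k (t j) (u (t j)) (u' (t j)) (t (j + 1)))) :=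
      (hasDerivAt_freeSolDeriv _ _ _ _ _).continuousAt.tendsto.mono_left nhdsWithin_le_nhds
    exact tendsto_nhds_unique (h.jump j) (l2.congr' (hev.mono fun x hx =>
      (h.eq_freeSol hk ht ht0 htb hx).2.symm))
  rw [transfer_apply]
  simp only [freeSol, freeSolDeriv] at h1 h2
  ext
  · simp only
    rw [h1]; ring
  · simp only
    linear_combination h2 + c j * h1

/-- The values of a solution at the points of the comb. -/
noncomputable def nodeState (k : ℝ) (t c : ℕ → ℝ) (x₀ : ℝ × ℝ) : ℕ → ℝ × ℝ
  | 0 => x₀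
  | j + 1 => transfer k (t (j + 1) - t j) (c j) (nodeState k t c x₀ j)

open Classical in
/-- The number of the interval of the comb containing `x`. -/
noncomputable def nodeIndex (t : ℕ → ℝ) (x : ℝ) : ℕ :=
  -- The default 0 only concerns x beyond all nodes, outside the interval [0, b).
  if h : ∃ j, x < t (j + 1) then Nat.find h else 0

theorem nodeIndex_eq (ht : StrictMono t) {x : ℝ} {j : ℕ} (hx : x < t (j + 1))
    (hj : j = 0 ∨ t j ≤ x) : nodeIndex t x = j := by
  classical
  have h : ∃ j, x < t (j + 1) := ⟨j, hx⟩
  rw [nodeIndex, dif_pos h]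
  rw [Nat.find_eq_iff h]
  refine ⟨hx, fun i hi => not_lt.2 ?_⟩
  rcases hj with rfl | hj
  · omega
  · exact (ht.monotone (by omega)).trans hj

/-- The solution with given initial values. -/
noncomputable def combSol (k : ℝ) (t c : ℕ → ℝ) (x₀ : ℝ × ℝ) (x : ℝ) : ℝ :=
  freeSol k (t (nodeIndex t x)) (nodeState k t c x₀ (nodeIndex t x)).1
    (nodeState k t c x₀ (nodeIndex t x)).2 x

/-- The derivative of `combSol`. -/
noncomputable def combSolDeriv (k : ℝ) (t c : ℕ → ℝ) (x₀ : ℝ × ℝ) (x : ℝ) : ℝ :=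
  freeSolDeriv k (t (nodeIndex t x)) (nodeState k t c x₀ (nodeIndex t x)).1
    (nodeState k t c x₀ (nodeIndex t x)).2 x

theorem combSol_node (ht : StrictMono t) (x₀ : ℝ × ℝ) (j : ℕ) :
    (combSol k t c x₀ (t j), combSolDeriv k t c x₀ (t j)) = nodeState k t c x₀ j := by
  have := nodeIndex_eq ht (ht (Nat.lt_succ_self j)) (Or.inr le_rfl)
  simp [combSol, combSolDeriv, this]

/-- Each half-open interval [t j, t (j + 1)) carries one free solution, so right limits are
immediate. Continuity and the jump at a node compare its left limit with the next state, as encoded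
in `transfer`. -/
theorem isSolution_combSol (hk : k ≠ 0) (ht : StrictMono t) (ht0 : t 0 = 0)
    (htb : Tendsto t atTop (𝓝 b)) (x₀ : ℝ × ℝ) :
    IsSolution b (fun j => t (j + 1)) c (k ^ 2) (combSol k t c x₀) (combSolDeriv k t c x₀) := by
  set X := nodeState k t c x₀ with hX
  have eqU : ∀ j, EqOn (combSol k t c x₀) (freeSol k (t j) (X j).1 (X j).2)
      (Ico (t j) (t (j + 1))) := fun j x hx => by
    simp only [combSol, nodeIndex_eq ht hx.2 (Or.inr hx.1), hX]
  have eqV : ∀ j, EqOn (combSolDeriv k t c x₀) (freeSolDeriv k (t j) (X j).1 (X j).2)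
      (Ico (t j) (t (j + 1))) := fun j x hx => by
    simp only [combSolDeriv, nodeIndex_eq ht hx.2 (Or.inr hx.1), hX]
  have cU : ∀ s α β x, ContinuousAt (freeSol k s α β) x := fun s α β x =>
    (hasDerivAt_freeSol hk _ _ _ _).continuousAt
  have cV : ∀ s α β x, ContinuousAt (freeSolDeriv k s α β) x := fun s α β x =>
    (hasDerivAt_freeSolDeriv _ _ _ _ _).continuousAt
  have stepU : ∀ j, (X (j + 1)).1 = freeSol k (t j) (X j).1 (X j).2 (t (j + 1)) := fun j => by
    simp only [hX, nodeState, transfer_apply, freeSol]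
    ring
  have stepV : ∀ j, (X (j + 1)).2 - c j * (X (j + 1)).1 =
      freeSolDeriv k (t j) (X j).1 (X j).2 (t (j + 1)) := fun j => by
    simp only [hX, nodeState, transfer_apply, freeSolDeriv]
    ring
  have node : ∀ j, combSol k t c x₀ (t j) = (X j).1 ∧ combSolDeriv k t c x₀ (t j) = (X j).2 :=
    fun j => Prod.mk.inj (combSol_node ht x₀ j)
  have evR : ∀ j, ∀ x ∈ Ico (t j) (t (j + 1)), Ico (t j) (t (j + 1)) ∈ 𝓝[≥] x := fun j x hx =>
    mem_of_superset (Ico_mem_nhdsGE hx.2) (Ico_subset_Ico_left hx.1)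
  have evL : ∀ j, Ico (t j) (t (j + 1)) ∈ 𝓝[<] t (j + 1) := fun j =>
    mem_of_superset (Ioo_mem_nhdsLT (ht (Nat.lt_succ_self j))) Ioo_subset_Ico_self
  have rU : ∀ x ∈ Ico 0 b, ContinuousWithinAt (combSol k t c x₀) (Ici x) x := fun x hx => by
    obtain ⟨j, hj⟩ := exists_mem_Ico_of_tendsto htb (ht0.symm ▸ hx)
    exact (cU _ _ _ _).continuousWithinAt.congr_of_eventuallyEq
      (eventually_of_mem (evR j x hj) (eqU j)) (eqU j hj)
  have rV : ∀ x ∈ Ico 0 b, ContinuousWithinAt (combSolDeriv k t c x₀) (Ici x) x := fun x hx => by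
    obtain ⟨j, hj⟩ := exists_mem_Ico_of_tendsto htb (ht0.symm ▸ hx)
    exact (cV _ _ _ _).continuousWithinAt.congr_of_eventuallyEq
      (eventually_of_mem (evR j x hj) (eqV j)) (eqV j hj)
  have dU : ∀ x ∈ Ioo 0 b, x ∉ range (fun j => t (j + 1)) →
      HasDerivAt (combSol k t c x₀) (combSolDeriv k t c x₀ x) x := fun x hx hxr => by
    obtain ⟨j, hj⟩ := exists_mem_Ioo_of_notMem_range htb (ht0.symm ▸ hx) hxr
    rw [eqV j (Ioo_subset_Ico_self hj)]
    exact (hasDerivAt_freeSol hk _ _ _ _).congr_of_eventuallyEq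
      (eventually_of_mem (Ioo_mem_nhds hj.1 hj.2) fun y hy => eqU j (Ioo_subset_Ico_self hy))
  refine ⟨fun x hx => ?_, dU, fun x hx hxr => ?_, rV, fun j => ?_⟩
  · rcases hx.1.eq_or_lt with rfl | hx0
    · exact (rU 0 hx).mono fun y hy => hy.1
    · by_cases hxr : x ∈ range fun j => t (j + 1)
      · obtain ⟨j, rfl⟩ := hxr
        refine ContinuousAt.continuousWithinAt ?_
        rw [continuousAt_iff_continuous_left'_right']
        refine ⟨?_, (rU _ hx).mono Ioi_subset_Ici_self⟩
        have h1 : Tendsto (combSol k t c x₀) (𝓝[<] t (j + 1))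
            (𝓝 (freeSol k (t j) (X j).1 (X j).2 (t (j + 1)))) :=
          ((cU _ _ _ _).tendsto.mono_left nhdsWithin_le_nhds).congr'
            (eventually_of_mem (evL j) fun y hy => (eqU j hy).symm)
        rw [ContinuousWithinAt, (node (j + 1)).1, stepU]
        exact h1
      · exact (dU x ⟨hx0, hx.2⟩ hxr).continuousAt.continuousWithinAt
  · obtain ⟨j, hj⟩ := exists_mem_Ioo_of_notMem_range htb (ht0.symm ▸ hx) hxr
    rw [eqU j (Ioo_subset_Ico_self hj)]
    exact (hasDerivAt_freeSolDeriv _ _ _ _ _).congr_of_eventuallyEq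
      (eventually_of_mem (Ioo_mem_nhds hj.1 hj.2) fun y hy => eqV j (Ioo_subset_Ico_self hy))
  · rw [(node (j + 1)).1, (node (j + 1)).2, stepV]
    exact ((cV _ _ _ _).tendsto.mono_left nhdsWithin_le_nhds).congr'
      (eventually_of_mem (evL j) fun y hy => (eqV j hy).symm)

end Comb

/-! ### The flattened comb -/

/-- The points of the comb in increasing order, starting with `0`. -/
noncomputable def flatNode (a : ℕ → ℝ) (j : ℕ) : ℝ :=
  combNode a (j / 8) + ((j % 8 : ℕ) : ℝ) * a (j / 8)

theorem combNode_succ (a : ℕ → ℝ) (n : ℕ) : combNode a (n + 1) = combNode a n + 8 * a n :=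
  Finset.sum_range_succ _ _

/-- Allowing i = 8 makes the right end of one cell agree with the left end of the next, so every
step of the comb can be read inside a single cell. -/
theorem flatNode_cell (a : ℕ → ℝ) (n : ℕ) {i : ℕ} (hi : i ≤ 8) :
    flatNode a (8 * n + i) = combNode a n + i * a n := by
  rcases hi.lt_or_eq with h | rfl
  · have h1 : (8 * n + i) / 8 = n := by omega
    have h2 : (8 * n + i) % 8 = i := by omega
    rw [flatNode, h1, h2]
  · have h1 : (8 * n + 8) / 8 = n + 1 := by omega
    have h2 : (8 * n + 8) % 8 = 0 := by omega
    rw [flatNode, h1, h2, combNode_succ]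
    push_cast
    ring

theorem flatNode_mul (a : ℕ → ℝ) (n : ℕ) : flatNode a (8 * n) = combNode a n := by
  simpa using flatNode_cell a n (i := 0) (by norm_num)

theorem flatNode_succ_sub (a : ℕ → ℝ) (j : ℕ) : flatNode a (j + 1) - flatNode a j = a (j / 8) := by
  have h1 := flatNode_cell a (j / 8) (i := j % 8) (by omega)
  have h2 := flatNode_cell a (j / 8) (i := j % 8 + 1) (by omega)
  rw [← add_assoc, Nat.div_add_mod] at h2
  rw [Nat.div_add_mod] at h1
  rw [h1, h2]
  push_cast
  ring

theorem flatNode_succ_eq (a : ℕ → ℝ) (j : ℕ) :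
    flatNode a (j + 1) = combPoint a (Nat.divModEquiv 8 j) := by
  have h2 := flatNode_cell a (j / 8) (i := j % 8 + 1) (by omega)
  rw [← add_assoc, Nat.div_add_mod] at h2
  rw [h2, combPoint]
  simp [Nat.divModEquiv]

section Flat

variable {a : ℕ → ℝ}

theorem flatNode_strictMono (ha : ∀ n, 0 < a n) : StrictMono (flatNode a) :=
  strictMono_nat_of_lt_succ fun j => by
    have := flatNode_succ_sub a j
    have := ha (j / 8)
    linarith

theorem flatNode_zero (a : ℕ → ℝ) : flatNode a 0 = 0 := by simp [flatNode, combNode]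

theorem tendsto_combNode (hs : Summable a) : Tendsto (combNode a) atTop (𝓝 (combEnd a)) :=
  (hs.mul_left 8).hasSum.tendsto_sum_nat

theorem tendsto_flatNode (ha : ∀ n, 0 < a n) (hs : Summable a) :
    Tendsto (flatNode a) atTop (𝓝 (combEnd a)) := by
  have h8 : Tendsto (fun n => 8 * n) atTop (atTop : Filter ℕ) :=
    tendsto_id.const_mul_atTop' (by norm_num)
  refine (tendsto_iff_tendsto_subseq_of_monotone (flatNode_strictMono ha).monotone h8).2 ?_
  exact (tendsto_combNode hs).congr fun n => (flatNode_mul a n).symm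

theorem isSolution_comp_equiv {ι κ : Type*} (f : κ ≃ ι) {b E : ℝ} {p c : ι → ℝ} {u u' : ℝ → ℝ} :
    IsSolution b p c E u u' ↔ IsSolution b (p ∘ f) (c ∘ f) E u u' := by
  have hr : range (p ∘ f) = range p := f.surjective.range_comp p
  constructor
  · rintro ⟨h1, h2, h3, h4, h5⟩
    exact ⟨h1, by rwa [hr], by rwa [hr], h4, fun i => h5 (f i)⟩
  · rintro ⟨h1, h2, h3, h4, h5⟩
    rw [hr] at h2 h3
    refine ⟨h1, h2, h3, h4, fun i => ?_⟩
    have := h5 (f.symm i)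
    simpa using this

theorem isCombSolution_iff {g : ℕ → ℝ} {E : ℝ} {u u' : ℝ → ℝ} :
    IsCombSolution a g E u u' ↔ IsSolution (combEnd a) (fun j => flatNode a (j + 1))
      (fun j => combStrength a g (Nat.divModEquiv 8 j)) E u u' := by
  rw [IsCombSolution, isSolution_comp_equiv (Nat.divModEquiv 8)]
  have : combPoint a ∘ Nat.divModEquiv 8 = fun j => flatNode a (j + 1) :=
    funext fun j => (flatNode_succ_eq a j).symm
  rw [this]
  rfl

end Flat

end DeltaComb

namespace DeltaComb

open Filter Topology

/-! ### Small-spacing asymptotics of the cell transfer matrix -/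

/-- Boundedness near `0+`. -/
@[fun_prop]
def EvBdd (f : ℝ → ℝ) : Prop := ∃ C, ∀ᶠ h in 𝓝[>] (0 : ℝ), |f h| ≤ C

namespace EvBdd

variable {f g : ℝ → ℝ}

@[fun_prop]
theorem const (c : ℝ) : EvBdd fun _ => c := ⟨|c|, Eventually.of_forall fun _ => le_rfl⟩

@[fun_prop]
theorem id : EvBdd fun h => h := by
  refine ⟨1, ?_⟩
  filter_upwards [Ioo_mem_nhdsGT (show (0 : ℝ) < 1 by norm_num)] with h hh
  rw [abs_of_pos hh.1]
  exact hh.2.le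

@[fun_prop]
theorem add (hf : EvBdd f) (hg : EvBdd g) : EvBdd fun h => f h + g h := by
  obtain ⟨C, hC⟩ := hf
  obtain ⟨D, hD⟩ := hg
  refine ⟨C + D, ?_⟩
  filter_upwards [hC, hD] with h h1 h2 using (abs_add_le _ _).trans (add_le_add h1 h2)

@[fun_prop]
theorem neg (hf : EvBdd f) : EvBdd fun h => -f h := by
  obtain ⟨C, hC⟩ := hf
  exact ⟨C, hC.mono fun h hh => by rwa [abs_neg]⟩

@[fun_prop]
theorem sub (hf : EvBdd f) (hg : EvBdd g) : EvBdd fun h => f h - g h := by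
  simpa only [sub_eq_add_neg] using hf.add hg.neg

@[fun_prop]
theorem mul (hf : EvBdd f) (hg : EvBdd g) : EvBdd fun h => f h * g h := by
  obtain ⟨C, hC⟩ := hf
  obtain ⟨D, hD⟩ := hg
  refine ⟨C * D, ?_⟩
  filter_upwards [hC, hD] with h h1 h2
  rw [abs_mul]
  exact mul_le_mul h1 h2 (abs_nonneg _) ((abs_nonneg _).trans h1)

@[fun_prop]
theorem pow (hf : EvBdd f) (n : ℕ) : EvBdd fun h => f h ^ n := by
  induction n with
  | zero => simpa using const 1
  | succ n ih => simpa only [pow_succ] using ih.mul hf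

theorem congr (hf : EvBdd f) (h : ∀ x, 0 < x → g x = f x) : EvBdd g := by
  obtain ⟨C, hC⟩ := hf
  refine ⟨C, ?_⟩
  filter_upwards [hC, self_mem_nhdsWithin] with x h1 h2
  rwa [h x h2]

end EvBdd

/-- The strengths of the deltas of a cell of spacing `h²`, multiplied by `h²`. -/
noncomputable def scaledStrength (h : ℝ) : ℕ → ℝ
  | 0 => h⁻¹ - 1
  | 1 => h - 1
  | 2 => h - 1
  | 3 => h⁻¹ - 1
  | 4 => h - 1
  | 5 => h⁻¹ - 1
  | 6 => h⁻¹ - 1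
  | _ => h - 1

/-- The values `a i` and the derivatives, multiplied by `h²`, `b i` of a solution of energy `E` at
the points of a cell of spacing `h²`. -/
structure IsScaledCell (E : ℝ) (r q : ℝ → ℝ) (a b : ℕ → ℝ → ℝ) : Prop where
  bdd_cos : EvBdd r
  bdd_sin : EvBdd q
  fst : ∀ i < 8, ∀ h, 0 < h → a (i + 1) h = (1 - 1 / 2 * h ^ 4 * E + h ^ 8 * r h) * a i h +
    (1 - 1 / 6 * h ^ 4 * E + h ^ 8 * q h) * b i h
  snd : ∀ i < 8, ∀ h, 0 < h → b (i + 1) h = scaledStrength h i * a (i + 1) h +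
    (1 - 1 / 2 * h ^ 4 * E + h ^ 8 * r h) * b i h -
    E * h ^ 4 * (1 - 1 / 6 * h ^ 4 * E + h ^ 8 * q h) * a i h

set_option maxHeartbeats 4000000 in
-- First column of the cell matrix, expanded delta by delta. The deltas of size h⁻¹ raise the values
-- to order h⁻¹ and then lower them again to order h before the last step. The remainders start at
-- order h⁶, enough to survive the multiplications by h⁻¹ and leave an error h² in the value and h⁴
-- in the scaled derivative. The bounds after two deltas and for all i < 8 serve the estimates of
-- the integrals.
theorem IsScaledCell.column_one {E : ℝ} {r q : ℝ → ℝ} {a b : ℕ → ℝ → ℝ}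
    (hc : IsScaledCell E r q a b) (ha0 : ∀ h, 0 < h → a 0 h = 1) (hb0 : ∀ h, 0 < h → b 0 h = 0) :
    (∀ i < 8, EvBdd (fun h => h * a i h) ∧ EvBdd fun h => h * b i h) ∧
    (EvBdd (fun h => a 2 h - h⁻¹) ∧ EvBdd (b 2)) ∧
    ∃ x y, EvBdd x ∧ EvBdd y ∧ ∀ h, 0 < h →
      a 8 h = 1 - 5 / 3 * E - 4 * h * E + h ^ 2 * x h ∧
      b 8 h = -(5 / 3 * h ^ 2 * E) - 2 / 3 * h ^ 3 * E + h ^ 4 * y h := by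
  have hr := hc.bdd_cos
  have hq := hc.bdd_sin
  obtain ⟨x1, hx1, ha1⟩ : ∃ x, EvBdd x ∧ ∀ h, 0 < h → a 1 h =
      1 - 1 / 2 * h ^ 4 * E + h ^ 6 * x h := by
    -- In each of these steps the witness is the remainder that the recursion produces exactly; its
    -- boundedness follows from its polynomial form in h, `r`, `q` and the previous remainders.
    refine ⟨fun h => h ^ 2 * r h, by fun_prop, fun h hh => ?_⟩
    rw [hc.fst 0 (by norm_num) h hh, ha0 h hh, hb0 h hh]
    field_simp
    ring
  obtain ⟨y1, hy1, hb1⟩ : ∃ y, EvBdd y ∧ ∀ h, 0 < h → b 1 h =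
      h⁻¹ - 1 - 1 / 2 * h ^ 3 * E - 1 / 2 * h ^ 4 * E + h ^ 6 * y h := by
    refine ⟨fun h => h * r h - h ^ 2 * r h + 1 / 6 * h ^ 2 * E ^ 2 - h ^ 6 * E * q h, by fun_prop, fun h hh => ?_⟩
    rw [hc.snd 0 (by norm_num) h hh, hc.fst 0 (by norm_num) h hh, ha0 h hh, hb0 h hh]
    simp only [scaledStrength]
    field_simp
    ring
  obtain ⟨x2, hx2, ha2⟩ : ∃ x, EvBdd x ∧ ∀ h, 0 < h → a 2 h =
      h⁻¹ - 2 / 3 * h ^ 3 * E - 4 / 3 * h ^ 4 * E + h ^ 6 * x h := by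
    refine ⟨fun h => y1 h + x1 h + h * q h + 1 / 12 * h * E ^ 2 - h ^ 2 * q h + h ^ 2 * r h + 1 / 3 * h ^ 2 * E ^
      2 - 1 / 6 * h ^ 4 * E * y1 h - 1 / 2 * h ^ 4 * E * x1 h - 1 / 2 * h ^ 5 * E * q h - 1 / 2 *
      h ^ 6 * E * q h - 1 / 2 * h ^ 6 * E * r h + h ^ 8 * q h * y1 h + h ^ 8 * r h * x1 h, by fun_prop, fun h hh => ?_⟩
    rw [hc.fst 1 (by norm_num) h hh, ha1 h hh, hb1 h hh]
    field_simp
    ring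
  obtain ⟨y2, hy2, hb2⟩ : ∃ y, EvBdd y ∧ ∀ h, 0 < h → b 2 h =
      -(1 / 3 * h ^ 3 * E) - 1 / 3 * h ^ 4 * E - 4 / 3 * h ^ 5 * E + h ^ 6 * y h := by
    refine ⟨fun h => -(x1 h) + h * y1 h + h * x1 h - h * q h + h * r h + 1 / 6 * h * E ^ 2 + 2 * h ^ 2 * q h - 2
      * h ^ 2 * r h + 2 / 3 * h ^ 2 * E ^ 2 - h ^ 3 * q h + h ^ 3 * r h + 1 / 3 * h ^ 3 * E ^ 2 -
      1 / 3 * h ^ 4 * E * y1 h - 1 / 2 * h ^ 4 * E * x1 h - 1 / 6 * h ^ 5 * E * y1 h - 1 / 2 * h ^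
      5 * E * x1 h + 1 / 2 * h ^ 5 * E * q h - 1 / 2 * h ^ 5 * E * r h - h ^ 6 * E * q h - 1 / 12
      * h ^ 6 * E ^ 3 - 1 / 2 * h ^ 7 * E * q h - 1 / 2 * h ^ 7 * E * r h - h ^ 8 * q h * y1 h + h
      ^ 8 * r h * y1 h - h ^ 8 * r h * x1 h + 1 / 6 * h ^ 8 * E ^ 2 * x1 h + h ^ 9 * q h * y1 h +
      h ^ 9 * r h * x1 h + 1 / 2 * h ^ 10 * E ^ 2 * q h - h ^ 12 * E * q h * x1 h, by fun_prop, fun h hh => ?_⟩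
    rw [hc.snd 1 (by norm_num) h hh, hc.fst 1 (by norm_num) h hh, ha1 h hh, hb1 h hh]
    simp only [scaledStrength]
    field_simp
    ring
  obtain ⟨x3, hx3, ha3⟩ : ∃ x, EvBdd x ∧ ∀ h, 0 < h → a 3 h =
      h⁻¹ - 3 / 2 * h ^ 3 * E - 5 / 3 * h ^ 4 * E - 4 / 3 * h ^ 5 * E + h ^ 6 * x h := by
    refine ⟨fun h => y2 h + x2 h + h * r h + 7 / 18 * h * E ^ 2 + 13 / 18 * h ^ 2 * E ^ 2 + 2 / 9 * h ^ 3 * E ^ 2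
      - 1 / 6 * h ^ 4 * E * y2 h - 1 / 2 * h ^ 4 * E * x2 h - 1 / 3 * h ^ 5 * E * q h - 2 / 3 * h
      ^ 5 * E * r h - 1 / 3 * h ^ 6 * E * q h - 4 / 3 * h ^ 6 * E * r h - 4 / 3 * h ^ 7 * E * q h
      + h ^ 8 * q h * y2 h + h ^ 8 * r h * x2 h, by fun_prop, fun h hh => ?_⟩
    rw [hc.fst 2 (by norm_num) h hh, ha2 h hh, hb2 h hh]
    field_simp
    ring
  obtain ⟨y3, hy3, hb3⟩ : ∃ y, EvBdd y ∧ ∀ h, 0 < h → b 3 h =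
      -(h⁻¹) + 1 + 1 / 6 * h ^ 3 * E - 1 / 6 * h ^ 4 * E - 5 / 3 * h ^ 5 * E + h ^ 6 * y h := by
    refine ⟨fun h => -(x2 h) - 4 / 3 * E + h * y2 h + h * x2 h - h * r h + 11 / 18 * h * E ^ 2 + h ^ 2 * r h + 7
      / 6 * h ^ 2 * E ^ 2 + 7 / 6 * h ^ 3 * E ^ 2 - 1 / 3 * h ^ 4 * E * y2 h - 1 / 2 * h ^ 4 * E *
      x2 h + 2 / 9 * h ^ 4 * E ^ 2 - 1 / 6 * h ^ 5 * E * y2 h - 1 / 2 * h ^ 5 * E * x2 h - 2 / 3 *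
      h ^ 5 * E * q h + 1 / 3 * h ^ 5 * E * r h - 1 / 9 * h ^ 5 * E ^ 3 + 1 / 3 * h ^ 6 * E * r h
      - 2 / 9 * h ^ 6 * E ^ 3 + h ^ 7 * E * q h - 8 / 3 * h ^ 7 * E * r h - h ^ 8 * q h * y2 h + h
      ^ 8 * r h * y2 h - h ^ 8 * r h * x2 h - 4 / 3 * h ^ 8 * E * q h + 1 / 6 * h ^ 8 * E ^ 2 * x2
      h + h ^ 9 * q h * y2 h + h ^ 9 * r h * x2 h + 2 / 3 * h ^ 9 * E ^ 2 * q h + 4 / 3 * h ^ 10 *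
      E ^ 2 * q h - h ^ 12 * E * q h * x2 h, by fun_prop, fun h hh => ?_⟩
    rw [hc.snd 2 (by norm_num) h hh, hc.fst 2 (by norm_num) h hh, ha2 h hh, hb2 h hh]
    simp only [scaledStrength]
    field_simp
    ring
  obtain ⟨x4, hx4, ha4⟩ : ∃ x, EvBdd x ∧ ∀ h, 0 < h → a 4 h =
      1 - 5 / 3 * h ^ 3 * E - 2 * h ^ 4 * E + h ^ 5 * x h := by
    refine ⟨fun h => -(3 * E) + h * y3 h + h * x3 h - h ^ 2 * q h + h ^ 2 * r h + 13 / 18 * h ^ 2 * E ^ 2 + h ^ 3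
      * q h + 31 / 36 * h ^ 3 * E ^ 2 + 17 / 18 * h ^ 4 * E ^ 2 - 1 / 6 * h ^ 5 * E * y3 h - 1 / 2
      * h ^ 5 * E * x3 h + 1 / 6 * h ^ 6 * E * q h - 3 / 2 * h ^ 6 * E * r h - 1 / 6 * h ^ 7 * E *
      q h - 5 / 3 * h ^ 7 * E * r h - 5 / 3 * h ^ 8 * E * q h - 4 / 3 * h ^ 8 * E * r h + h ^ 9 *
      q h * y3 h + h ^ 9 * r h * x3 h, by fun_prop, fun h hh => ?_⟩
    rw [hc.fst 3 (by norm_num) h hh, ha3 h hh, hb3 h hh]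
    field_simp
    ring
  obtain ⟨y4, hy4, hb4⟩ : ∃ y, EvBdd y ∧ ∀ h, 0 < h → b 4 h =
      -(5 / 3 * h ^ 2 * E) - 2 / 3 * h ^ 3 * E - 5 / 3 * h ^ 4 * E + h ^ 5 * y h := by
    refine ⟨fun h => y3 h + x3 h + 4 / 3 * E - h * x3 h - h * q h + h * r h + 13 / 18 * h * E ^ 2 + 2 * h ^ 2 * q
      h - 2 * h ^ 2 * r h + 31 / 18 * h ^ 2 * E ^ 2 - h ^ 3 * q h + h ^ 3 * r h + 11 / 6 * h ^ 3 *
      E ^ 2 - 1 / 6 * h ^ 4 * E * y3 h - 1 / 2 * h ^ 4 * E * x3 h + 11 / 9 * h ^ 4 * E ^ 2 - 1 / 3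
      * h ^ 5 * E * y3 h - 1 / 2 * h ^ 5 * E * x3 h + 1 / 6 * h ^ 5 * E * q h - 3 / 2 * h ^ 5 * E
      * r h - 4 / 3 * h ^ 6 * E * q h - 1 / 4 * h ^ 6 * E ^ 3 - 3 / 2 * h ^ 7 * E * q h + 1 / 6 *
      h ^ 7 * E * r h - 5 / 18 * h ^ 7 * E ^ 3 + h ^ 8 * q h * y3 h + h ^ 8 * r h * x3 h + 5 / 3 *
      h ^ 8 * E * q h - 1 / 3 * h ^ 8 * E * r h - 2 / 9 * h ^ 8 * E ^ 3 - h ^ 9 * q h * y3 h + h ^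
      9 * r h * y3 h - h ^ 9 * r h * x3 h + 1 / 6 * h ^ 9 * E ^ 2 * x3 h + 3 / 2 * h ^ 10 * E ^ 2
      * q h + 5 / 3 * h ^ 11 * E ^ 2 * q h + 4 / 3 * h ^ 12 * E ^ 2 * q h - h ^ 13 * E * q h * x3
      h, by fun_prop, fun h hh => ?_⟩
    rw [hc.snd 3 (by norm_num) h hh, hc.fst 3 (by norm_num) h hh, ha3 h hh, hb3 h hh]
    simp only [scaledStrength]
    field_simp
    ring
  obtain ⟨x5, hx5, ha5⟩ : ∃ x, EvBdd x ∧ ∀ h, 0 < h → a 5 h =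
      1 - 5 / 3 * h ^ 2 * E - 7 / 3 * h ^ 3 * E - 25 / 6 * h ^ 4 * E + h ^ 5 * x h := by
    refine ⟨fun h => y4 h + x4 h + 5 / 18 * h * E ^ 2 + 17 / 18 * h ^ 2 * E ^ 2 + h ^ 3 * r h + 23 / 18 * h ^ 3 *
      E ^ 2 - 1 / 6 * h ^ 4 * E * y4 h - 1 / 2 * h ^ 4 * E * x4 h - 5 / 3 * h ^ 5 * E * q h - 2 /
      3 * h ^ 6 * E * q h - 5 / 3 * h ^ 6 * E * r h - 5 / 3 * h ^ 7 * E * q h - 2 * h ^ 7 * E * r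
      h + h ^ 8 * q h * y4 h + h ^ 8 * r h * x4 h, by fun_prop, fun h hh => ?_⟩
    rw [hc.fst 4 (by norm_num) h hh, ha4 h hh, hb4 h hh]
    field_simp
    ring
  obtain ⟨y5, hy5, hb5⟩ : ∃ y, EvBdd y ∧ ∀ h, 0 < h → b 5 h =
      -(1) + h - 5 / 6 * h ^ 4 * E + h ^ 5 * y h := by
    refine ⟨fun h => -(x4 h) - 25 / 6 * E + h * y4 h + h * x4 h + 5 / 9 * h * E ^ 2 + 4 / 3 * h ^ 2 * E ^ 2 - h ^
      3 * r h + 8 / 3 * h ^ 3 * E ^ 2 + h ^ 4 * r h - 1 / 3 * h ^ 4 * E * y4 h - 1 / 2 * h ^ 4 * E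
      * x4 h + 23 / 18 * h ^ 4 * E ^ 2 - 1 / 6 * h ^ 5 * E * y4 h - 1 / 2 * h ^ 5 * E * x4 h + 5 /
      3 * h ^ 5 * E * q h - 5 / 3 * h ^ 5 * E * r h - h ^ 6 * E * q h + h ^ 6 * E * r h - 5 / 18 *
      h ^ 6 * E ^ 3 - 4 / 3 * h ^ 7 * E * r h - 1 / 3 * h ^ 7 * E ^ 3 - h ^ 8 * q h * y4 h + h ^ 8
      * r h * y4 h - h ^ 8 * r h * x4 h - 5 / 3 * h ^ 8 * E * q h - 2 * h ^ 8 * E * r h + 1 / 6 *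
      h ^ 8 * E ^ 2 * x4 h + h ^ 9 * q h * y4 h + h ^ 9 * r h * x4 h + 5 / 3 * h ^ 10 * E ^ 2 * q
      h + 2 * h ^ 11 * E ^ 2 * q h - h ^ 12 * E * q h * x4 h, by fun_prop, fun h hh => ?_⟩
    rw [hc.snd 4 (by norm_num) h hh, hc.fst 4 (by norm_num) h hh, ha4 h hh, hb4 h hh]
    simp only [scaledStrength]
    field_simp
    ring
  obtain ⟨x6, hx6, ha6⟩ : ∃ x, EvBdd x ∧ ∀ h, 0 < h → a 6 h =
      h - 5 / 3 * h ^ 2 * E - 7 / 3 * h ^ 3 * E + h ^ 4 * x h := by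
    refine ⟨fun h => -(16 / 3 * E) + h * y5 h + h * x5 h - 1 / 6 * h * E + 5 / 6 * h ^ 2 * E ^ 2 + 7 / 6 * h ^ 3
      * E ^ 2 - h ^ 4 * q h + h ^ 4 * r h + 20 / 9 * h ^ 4 * E ^ 2 + h ^ 5 * q h - 1 / 6 * h ^ 5 *
      E * y5 h - 1 / 2 * h ^ 5 * E * x5 h - 5 / 3 * h ^ 6 * E * r h - 7 / 3 * h ^ 7 * E * r h - 5
      / 6 * h ^ 8 * E * q h - 25 / 6 * h ^ 8 * E * r h + h ^ 9 * q h * y5 h + h ^ 9 * r h * x5 h, by fun_prop, fun h hh => ?_⟩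
    rw [hc.fst 5 (by norm_num) h hh, ha5 h hh, hb5 h hh]
    field_simp
    ring
  obtain ⟨y6, hy6, hb6⟩ : ∃ y, EvBdd y ∧ ∀ h, 0 < h → b 6 h =
      -(5 / 3 * h * E) - 2 / 3 * h ^ 2 * E - 3 * h ^ 3 * E + h ^ 4 * y h := by
    refine ⟨fun h => y5 h + x5 h + 23 / 6 * E - h * x5 h - 1 / 3 * h * E + 5 / 6 * h * E ^ 2 + 2 * h ^ 2 * E ^ 2
      - h ^ 3 * q h + h ^ 3 * r h + 61 / 18 * h ^ 3 * E ^ 2 + 2 * h ^ 4 * q h - 2 * h ^ 4 * r h -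
      1 / 6 * h ^ 4 * E * y5 h - 1 / 2 * h ^ 4 * E * x5 h + 91 / 36 * h ^ 4 * E ^ 2 - h ^ 5 * q h
      + h ^ 5 * r h - 1 / 3 * h ^ 5 * E * y5 h - 1 / 2 * h ^ 5 * E * x5 h - 5 / 3 * h ^ 5 * E * r
      h - 2 / 3 * h ^ 6 * E * r h - 5 / 18 * h ^ 6 * E ^ 3 - 5 / 6 * h ^ 7 * E * q h - 11 / 6 * h
      ^ 7 * E * r h - 7 / 18 * h ^ 7 * E ^ 3 + h ^ 8 * q h * y5 h + h ^ 8 * r h * x5 h - 1 / 6 * h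
      ^ 8 * E * q h + 10 / 3 * h ^ 8 * E * r h - 25 / 36 * h ^ 8 * E ^ 3 - h ^ 9 * q h * y5 h + h
      ^ 9 * r h * y5 h - h ^ 9 * r h * x5 h + 1 / 6 * h ^ 9 * E ^ 2 * x5 h + 5 / 3 * h ^ 10 * E ^
      2 * q h + 7 / 3 * h ^ 11 * E ^ 2 * q h + 25 / 6 * h ^ 12 * E ^ 2 * q h - h ^ 13 * E * q h *
      x5 h, by fun_prop, fun h hh => ?_⟩
    rw [hc.snd 5 (by norm_num) h hh, hc.fst 5 (by norm_num) h hh, ha5 h hh, hb5 h hh]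
    simp only [scaledStrength]
    field_simp
    ring
  obtain ⟨x7, hx7, ha7⟩ : ∃ x, EvBdd x ∧ ∀ h, 0 < h → a 7 h =
      h - 5 / 3 * h * E - 7 / 3 * h ^ 2 * E - 16 / 3 * h ^ 3 * E + h ^ 4 * x h := by
    refine ⟨fun h => y6 h + x6 h - 1 / 2 * h * E + 5 / 18 * h * E ^ 2 + 17 / 18 * h ^ 2 * E ^ 2 + 5 / 3 * h ^ 3 *
      E ^ 2 - 1 / 6 * h ^ 4 * E * y6 h - 1 / 2 * h ^ 4 * E * x6 h + h ^ 5 * r h - 5 / 3 * h ^ 5 *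
      E * q h - 2 / 3 * h ^ 6 * E * q h - 5 / 3 * h ^ 6 * E * r h - 3 * h ^ 7 * E * q h - 7 / 3 *
      h ^ 7 * E * r h + h ^ 8 * q h * y6 h + h ^ 8 * r h * x6 h, by fun_prop, fun h hh => ?_⟩
    rw [hc.fst 6 (by norm_num) h hh, ha6 h hh, hb6 h hh]
    field_simp
    ring
  obtain ⟨y7, hy7, hb7⟩ : ∃ y, EvBdd y ∧ ∀ h, 0 < h → b 7 h =
      1 - 5 / 3 * E - h - 7 / 3 * h * E - 11 / 3 * h ^ 2 * E + h ^ 3 * y h := by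
    refine ⟨fun h => y6 h + x6 h + 7 / 3 * E - h * x6 h - 1 / 2 * h * E + 5 / 18 * h * E ^ 2 - 1 / 2 * h ^ 2 * E
      + 3 / 2 * h ^ 2 * E ^ 2 + 49 / 18 * h ^ 3 * E ^ 2 - 1 / 6 * h ^ 4 * E * y6 h - 1 / 2 * h ^ 4
      * E * x6 h + 13 / 6 * h ^ 4 * E ^ 2 + h ^ 5 * r h - 1 / 3 * h ^ 5 * E * y6 h - 1 / 2 * h ^ 5
      * E * x6 h - 5 / 3 * h ^ 5 * E * q h - h ^ 6 * r h + h ^ 6 * E * q h - 10 / 3 * h ^ 6 * E *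
      r h + 1 / 6 * h ^ 6 * E ^ 2 - 7 / 3 * h ^ 7 * E * q h - 4 / 3 * h ^ 7 * E * r h - 5 / 18 * h
      ^ 7 * E ^ 3 + h ^ 8 * q h * y6 h + h ^ 8 * r h * x6 h + 3 * h ^ 8 * E * q h - 2 / 3 * h ^ 8
      * E * r h - 7 / 18 * h ^ 8 * E ^ 3 - h ^ 9 * q h * y6 h + h ^ 9 * r h * y6 h - h ^ 9 * r h *
      x6 h + 1 / 6 * h ^ 9 * E ^ 2 * x6 h - h ^ 10 * E * q h + 5 / 3 * h ^ 11 * E ^ 2 * q h + 7 /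
      3 * h ^ 12 * E ^ 2 * q h - h ^ 13 * E * q h * x6 h, by fun_prop, fun h hh => ?_⟩
    rw [hc.snd 6 (by norm_num) h hh, hc.fst 6 (by norm_num) h hh, ha6 h hh, hb6 h hh]
    simp only [scaledStrength]
    field_simp
    ring
  obtain ⟨x8, hx8, ha8⟩ : ∃ x, EvBdd x ∧ ∀ h, 0 < h → a 8 h =
      1 - 5 / 3 * E - 4 * h * E + h ^ 2 * x h := by
    refine ⟨fun h => -(6 * E) + h * y7 h - 16 / 3 * h * E + h ^ 2 * x7 h - 1 / 6 * h ^ 2 * E + 5 / 18 * h ^ 2 * E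
      ^ 2 - 1 / 3 * h ^ 3 * E + 11 / 9 * h ^ 3 * E ^ 2 + 16 / 9 * h ^ 4 * E ^ 2 - 1 / 6 * h ^ 5 *
      E * y7 h + 8 / 3 * h ^ 5 * E ^ 2 + h ^ 6 * q h - 1 / 2 * h ^ 6 * E * x7 h - 5 / 3 * h ^ 6 *
      E * q h - h ^ 7 * q h + h ^ 7 * r h - 7 / 3 * h ^ 7 * E * q h - 5 / 3 * h ^ 7 * E * r h - 11
      / 3 * h ^ 8 * E * q h - 7 / 3 * h ^ 8 * E * r h + h ^ 9 * q h * y7 h - 16 / 3 * h ^ 9 * E *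
      r h + h ^ 10 * r h * x7 h, by fun_prop, fun h hh => ?_⟩
    rw [hc.fst 7 (by norm_num) h hh, ha7 h hh, hb7 h hh]
    field_simp
    ring
  obtain ⟨y8, hy8, hb8⟩ : ∃ y, EvBdd y ∧ ∀ h, 0 < h → b 8 h =
      -(5 / 3 * h ^ 2 * E) - 2 / 3 * h ^ 3 * E + h ^ 4 * y h := by
    refine ⟨fun h => y7 h - x7 h - 17 / 3 * E + 5 / 9 * E ^ 2 + h * x7 h - 1 / 3 * h * E + 17 / 9 * h * E ^ 2 - 1
      / 3 * h ^ 2 * E + 65 / 18 * h ^ 2 * E ^ 2 - 1 / 3 * h ^ 3 * E * y7 h + 40 / 9 * h ^ 3 * E ^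
      2 - h ^ 4 * q h + h ^ 4 * r h - 1 / 6 * h ^ 4 * E * y7 h - 1 / 2 * h ^ 4 * E * x7 h + 5 / 3
      * h ^ 4 * E * q h - 5 / 3 * h ^ 4 * E * r h + 8 / 3 * h ^ 4 * E ^ 2 + 2 * h ^ 5 * q h - 2 *
      h ^ 5 * r h - 1 / 2 * h ^ 5 * E * x7 h + 2 / 3 * h ^ 5 * E * q h - 2 / 3 * h ^ 5 * E * r h +
      1 / 6 * h ^ 5 * E ^ 2 - 5 / 18 * h ^ 5 * E ^ 3 - h ^ 6 * q h + h ^ 6 * r h + 4 / 3 * h ^ 6 *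
      E * q h - 3 * h ^ 6 * E * r h - 7 / 18 * h ^ 6 * E ^ 3 - h ^ 7 * q h * y7 h + h ^ 7 * r h *
      y7 h - 11 / 3 * h ^ 7 * E * q h + 3 * h ^ 7 * E * r h - 8 / 9 * h ^ 7 * E ^ 3 + h ^ 8 * q h
      * y7 h - h ^ 8 * r h * x7 h - 16 / 3 * h ^ 8 * E * r h + 1 / 6 * h ^ 8 * E ^ 2 * x7 h + h ^
      9 * r h * x7 h - h ^ 9 * E * q h + 5 / 3 * h ^ 9 * E ^ 2 * q h + 7 / 3 * h ^ 10 * E ^ 2 * q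
      h + 16 / 3 * h ^ 11 * E ^ 2 * q h - h ^ 12 * E * q h * x7 h, by fun_prop, fun h hh => ?_⟩
    rw [hc.snd 7 (by norm_num) h hh, hc.fst 7 (by norm_num) h hh, ha7 h hh, hb7 h hh]
    simp only [scaledStrength]
    field_simp
    ring
  refine ⟨fun i hi => ?_, ?_, x8, y8, hx8, hy8, fun h hh => ⟨ha8 h hh, hb8 h hh⟩⟩
  · interval_cases i
    · exact ⟨EvBdd.congr (f := fun h => h * 1) (by fun_prop) fun h hh => by
        rw [ha0 h hh],
        EvBdd.congr (f := fun h => h * 0) (by fun_prop) fun h hh => by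
        rw [hb0 h hh]⟩
    · exact ⟨EvBdd.congr (f := fun h => h - 1 / 2 * h ^ 5 * E + h ^ 7 * x1 h) (by fun_prop) fun h hh => by
        rw [ha1 h hh]; field_simp,
        EvBdd.congr (f := fun h => 1 - h - 1 / 2 * h ^ 4 * E - 1 / 2 * h ^ 5 * E + h ^ 7 * y1 h) (by fun_prop) fun h hh => by
        rw [hb1 h hh]; field_simp⟩
    · exact ⟨EvBdd.congr (f := fun h => 1 - 2 / 3 * h ^ 4 * E - 4 / 3 * h ^ 5 * E + h ^ 7 * x2 h) (by fun_prop) fun h hh => by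
        rw [ha2 h hh]; field_simp,
        EvBdd.congr (f := fun h => -(1 / 3 * h ^ 4 * E) - 1 / 3 * h ^ 5 * E - 4 / 3 * h ^ 6 * E + h ^ 7 * y2 h) (by fun_prop) fun h hh => by
        rw [hb2 h hh]; field_simp⟩
    · exact ⟨EvBdd.congr (f := fun h => 1 - 3 / 2 * h ^ 4 * E - 5 / 3 * h ^ 5 * E - 4 / 3 * h ^ 6 * E + h ^ 7 * x3 h) (by fun_prop) fun h hh => by
        rw [ha3 h hh]; field_simp,
        EvBdd.congr (f := fun h => -(1) + h + 1 / 6 * h ^ 4 * E - 1 / 6 * h ^ 5 * E - 5 / 3 * h ^ 6 * E + h ^ 7 * y3 h) (by fun_prop) fun h hh => by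
        rw [hb3 h hh]; field_simp⟩
    · exact ⟨EvBdd.congr (f := fun h => h - 5 / 3 * h ^ 4 * E - 2 * h ^ 5 * E + h ^ 6 * x4 h) (by fun_prop) fun h hh => by
        rw [ha4 h hh]; field_simp,
        EvBdd.congr (f := fun h => -(5 / 3 * h ^ 3 * E) - 2 / 3 * h ^ 4 * E - 5 / 3 * h ^ 5 * E + h ^ 6 * y4 h) (by fun_prop) fun h hh => by
        rw [hb4 h hh]; field_simp⟩
    · exact ⟨EvBdd.congr (f := fun h => h - 5 / 3 * h ^ 3 * E - 7 / 3 * h ^ 4 * E - 25 / 6 * h ^ 5 * E + h ^ 6 * x5 h) (by fun_prop) fun h hh => by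
        rw [ha5 h hh]; field_simp,
        EvBdd.congr (f := fun h => -(h) + h ^ 2 - 5 / 6 * h ^ 5 * E + h ^ 6 * y5 h) (by fun_prop) fun h hh => by
        rw [hb5 h hh]; field_simp⟩
    · exact ⟨EvBdd.congr (f := fun h => h ^ 2 - 5 / 3 * h ^ 3 * E - 7 / 3 * h ^ 4 * E + h ^ 5 * x6 h) (by fun_prop) fun h hh => by
        rw [ha6 h hh]; field_simp,
        EvBdd.congr (f := fun h => -(5 / 3 * h ^ 2 * E) - 2 / 3 * h ^ 3 * E - 3 * h ^ 4 * E + h ^ 5 * y6 h) (by fun_prop) fun h hh => by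
        rw [hb6 h hh]; field_simp⟩
    · exact ⟨EvBdd.congr (f := fun h => h ^ 2 - 5 / 3 * h ^ 2 * E - 7 / 3 * h ^ 3 * E - 16 / 3 * h ^ 4 * E + h ^ 5 * x7 h) (by fun_prop) fun h hh => by
        rw [ha7 h hh]; field_simp,
        EvBdd.congr (f := fun h => h - 5 / 3 * h * E - h ^ 2 - 7 / 3 * h ^ 2 * E - 11 / 3 * h ^ 3 * E + h ^ 4 * y7 h) (by fun_prop) fun h hh => by
        rw [hb7 h hh]; field_simp⟩
  · exact ⟨EvBdd.congr (f := fun h => -(2 / 3 * h ^ 3 * E) - 4 / 3 * h ^ 4 * E + h ^ 6 * x2 h) (by fun_prop) fun h hh => by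
        rw [ha2 h hh]; ring,
      EvBdd.congr (f := fun h => -(1 / 3 * h ^ 3 * E) - 1 / 3 * h ^ 4 * E - 4 / 3 * h ^ 5 * E + h ^ 6 * y2 h) (by fun_prop) fun h hh => by
        rw [hb2 h hh]⟩

set_option maxHeartbeats 4000000 in
-- Second column, for unit scaled derivative, that is for u' = h⁻² at the left end. After
-- multiplication by h² the value becomes 1 + 2h + O(h²) and the derivative 1 + O(h²).
theorem IsScaledCell.column_two {E : ℝ} {r q : ℝ → ℝ} {a b : ℕ → ℝ → ℝ}
    (hc : IsScaledCell E r q a b) (ha0 : ∀ h, 0 < h → a 0 h = 0) (hb0 : ∀ h, 0 < h → b 0 h = 1) :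
    (∀ i < 8, EvBdd (fun h => h ^ 3 * a i h) ∧ EvBdd fun h => h ^ 3 * b i h) ∧
    (EvBdd (fun h => h * a 2 h) ∧ EvBdd fun h => h * b 2 h) ∧
    ∃ x y, EvBdd x ∧ EvBdd y ∧ ∀ h, 0 < h →
      a 8 h = (h ^ 2)⁻¹ + 2 * h⁻¹ + x h ∧ b 8 h = 1 + h ^ 2 * y h := by
  have hr := hc.bdd_cos
  have hq := hc.bdd_sin
  obtain ⟨x1, hx1, ha1⟩ : ∃ x, EvBdd x ∧ ∀ h, 0 < h → a 1 h =
      1 + h ^ 4 * x h := by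
    refine ⟨fun h => -(1 / 6 * E) + h ^ 4 * q h, by fun_prop, fun h hh => ?_⟩
    rw [hc.fst 0 (by norm_num) h hh, ha0 h hh, hb0 h hh]
    field_simp
    ring
  obtain ⟨y1, hy1, hb1⟩ : ∃ y, EvBdd y ∧ ∀ h, 0 < h → b 1 h =
      h⁻¹ - 1 / 6 * h ^ 3 * E + h ^ 4 * y h := by
    refine ⟨fun h => -(1 / 3 * E) + h ^ 3 * q h - h ^ 4 * q h + h ^ 4 * r h, by fun_prop, fun h hh => ?_⟩
    rw [hc.snd 0 (by norm_num) h hh, hc.fst 0 (by norm_num) h hh, ha0 h hh, hb0 h hh]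
    simp only [scaledStrength]
    field_simp
    ring
  obtain ⟨x2, hx2, ha2⟩ : ∃ x, EvBdd x ∧ ∀ h, 0 < h → a 2 h =
      h⁻¹ + 1 - 1 / 3 * h ^ 3 * E + h ^ 4 * x h := by
    refine ⟨fun h => y1 h + x1 h - 1 / 2 * E + h ^ 3 * q h + 1 / 36 * h ^ 3 * E ^ 2 + h ^ 4 * r h - 1 / 6 * h ^ 4
      * E * y1 h - 1 / 2 * h ^ 4 * E * x1 h - 1 / 6 * h ^ 7 * E * q h + h ^ 8 * q h * y1 h + h ^ 8
      * r h * x1 h, by fun_prop, fun h hh => ?_⟩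
    rw [hc.fst 1 (by norm_num) h hh, ha1 h hh, hb1 h hh]
    field_simp
    ring
  obtain ⟨y2, hy2, hb2⟩ : ∃ y, EvBdd y ∧ ∀ h, 0 < h → b 2 h =
      h - 1 / 3 * h ^ 3 * E + h ^ 4 * y h := by
    refine ⟨fun h => -(x1 h) - 5 / 6 * E + h * y1 h + h * x1 h - 1 / 2 * h * E - h ^ 3 * q h + h ^ 3 * r h + 1 /
      18 * h ^ 3 * E ^ 2 + h ^ 4 * q h - h ^ 4 * r h - 1 / 3 * h ^ 4 * E * y1 h - 1 / 2 * h ^ 4 *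
      E * x1 h + 7 / 36 * h ^ 4 * E ^ 2 + h ^ 5 * r h - 1 / 6 * h ^ 5 * E * y1 h - 1 / 2 * h ^ 5 *
      E * x1 h + 1 / 6 * h ^ 7 * E * q h - 1 / 6 * h ^ 7 * E * r h - h ^ 8 * q h * y1 h + h ^ 8 *
      r h * y1 h - h ^ 8 * r h * x1 h - 7 / 6 * h ^ 8 * E * q h + 1 / 6 * h ^ 8 * E ^ 2 * x1 h + h
      ^ 9 * q h * y1 h + h ^ 9 * r h * x1 h - h ^ 12 * E * q h * x1 h, by fun_prop, fun h hh => ?_⟩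
    rw [hc.snd 1 (by norm_num) h hh, hc.fst 1 (by norm_num) h hh, ha1 h hh, hb1 h hh]
    simp only [scaledStrength]
    field_simp
    ring
  obtain ⟨x3, hx3, ha3⟩ : ∃ x, EvBdd x ∧ ∀ h, 0 < h → a 3 h =
      h⁻¹ + 1 + h - 7 / 6 * h ^ 3 * E + h ^ 4 * x h := by
    refine ⟨fun h => y2 h + x2 h - 1 / 2 * E - 1 / 6 * h * E + h ^ 3 * r h + 2 / 9 * h ^ 3 * E ^ 2 + h ^ 4 * r h
      - 1 / 6 * h ^ 4 * E * y2 h - 1 / 2 * h ^ 4 * E * x2 h + h ^ 5 * q h - 1 / 3 * h ^ 7 * E * q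
      h - 1 / 3 * h ^ 7 * E * r h + h ^ 8 * q h * y2 h + h ^ 8 * r h * x2 h, by fun_prop, fun h hh => ?_⟩
    rw [hc.fst 2 (by norm_num) h hh, ha2 h hh, hb2 h hh]
    field_simp
    ring
  obtain ⟨y3, hy3, hb3⟩ : ∃ y, EvBdd y ∧ ∀ h, 0 < h → b 3 h =
      -(h⁻¹) + h + h ^ 2 - 1 / 6 * h ^ 3 * E + h ^ 4 * y h := by
    refine ⟨fun h => -(x2 h) - 5 / 3 * E + h * y2 h + h * x2 h - 5 / 6 * h * E - 1 / 6 * h ^ 2 * E - h ^ 3 * r h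
      + 4 / 9 * h ^ 3 * E ^ 2 - 1 / 3 * h ^ 4 * E * y2 h - 1 / 2 * h ^ 4 * E * x2 h + 7 / 18 * h ^
      4 * E ^ 2 - h ^ 5 * q h + 2 * h ^ 5 * r h - 1 / 6 * h ^ 5 * E * y2 h - 1 / 2 * h ^ 5 * E *
      x2 h + h ^ 6 * q h - 2 / 3 * h ^ 7 * E * q h - 1 / 18 * h ^ 7 * E ^ 3 - h ^ 8 * q h * y2 h +
      h ^ 8 * r h * y2 h - h ^ 8 * r h * x2 h - 4 / 3 * h ^ 8 * E * q h - 1 / 3 * h ^ 8 * E * r h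
      + 1 / 6 * h ^ 8 * E ^ 2 * x2 h + h ^ 9 * q h * y2 h + h ^ 9 * r h * x2 h + 1 / 3 * h ^ 11 *
      E ^ 2 * q h - h ^ 12 * E * q h * x2 h, by fun_prop, fun h hh => ?_⟩
    rw [hc.snd 2 (by norm_num) h hh, hc.fst 2 (by norm_num) h hh, ha2 h hh, hb2 h hh]
    simp only [scaledStrength]
    field_simp
    ring
  obtain ⟨x4, hx4, ha4⟩ : ∃ x, EvBdd x ∧ ∀ h, 0 < h → a 4 h =
      1 + 2 * h + h ^ 2 + h ^ 3 * x h := by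
    refine ⟨fun h => -(5 / 3 * E) + h * y3 h + h * x3 h - 1 / 2 * h * E - 2 / 3 * h ^ 2 * E - 1 / 6 * h ^ 3 * E -
      h ^ 4 * q h + h ^ 4 * r h + 11 / 18 * h ^ 4 * E ^ 2 + h ^ 5 * r h - 1 / 6 * h ^ 5 * E * y3 h
      - 1 / 2 * h ^ 5 * E * x3 h + h ^ 6 * q h + h ^ 6 * r h + h ^ 7 * q h - 1 / 6 * h ^ 8 * E * q
      h - 7 / 6 * h ^ 8 * E * r h + h ^ 9 * q h * y3 h + h ^ 9 * r h * x3 h, by fun_prop, fun h hh => ?_⟩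
    rw [hc.fst 3 (by norm_num) h hh, ha3 h hh, hb3 h hh]
    field_simp
    ring
  obtain ⟨y4, hy4, hb4⟩ : ∃ y, EvBdd y ∧ ∀ h, 0 < h → b 4 h =
      1 - 5 / 3 * h ^ 2 * E + h ^ 3 * y h := by
    refine ⟨fun h => y3 h + x3 h + 1 / 2 * E - h * x3 h - 7 / 6 * h * E - h ^ 2 * E - h ^ 3 * q h + h ^ 3 * r h -
      1 / 3 * h ^ 3 * E + 11 / 18 * h ^ 3 * E ^ 2 + h ^ 4 * q h - h ^ 4 * r h - 1 / 6 * h ^ 4 * E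
      * y3 h - 1 / 2 * h ^ 4 * E * x3 h + 29 / 36 * h ^ 4 * E ^ 2 + h ^ 5 * q h - 1 / 3 * h ^ 5 *
      E * y3 h - 1 / 2 * h ^ 5 * E * x3 h + 1 / 6 * h ^ 5 * E ^ 2 + 1 / 6 * h ^ 6 * E ^ 2 - h ^ 7
      * q h + h ^ 7 * r h - 1 / 6 * h ^ 7 * E * q h - 7 / 6 * h ^ 7 * E * r h + h ^ 8 * q h * y3 h
      + h ^ 8 * r h * x3 h - 5 / 6 * h ^ 8 * E * q h + h ^ 8 * E * r h - 7 / 36 * h ^ 8 * E ^ 3 -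
      h ^ 9 * q h * y3 h + h ^ 9 * r h * y3 h - h ^ 9 * r h * x3 h - h ^ 9 * E * q h + 1 / 6 * h ^
      9 * E ^ 2 * x3 h - h ^ 10 * E * q h + 7 / 6 * h ^ 12 * E ^ 2 * q h - h ^ 13 * E * q h * x3 h, by fun_prop, fun h hh => ?_⟩
    rw [hc.snd 3 (by norm_num) h hh, hc.fst 3 (by norm_num) h hh, ha3 h hh, hb3 h hh]
    simp only [scaledStrength]
    field_simp
    ring
  obtain ⟨x5, hx5, ha5⟩ : ∃ x, EvBdd x ∧ ∀ h, 0 < h → a 5 h =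
      2 + 2 * h + h ^ 2 - 5 / 3 * h ^ 2 * E + h ^ 3 * x h := by
    refine ⟨fun h => y4 h + x4 h - 2 / 3 * h * E - h ^ 2 * E - 1 / 2 * h ^ 3 * E + 5 / 18 * h ^ 3 * E ^ 2 - 1 / 6
      * h ^ 4 * E * y4 h - 1 / 2 * h ^ 4 * E * x4 h + h ^ 5 * q h + h ^ 5 * r h + 2 * h ^ 6 * r h
      + h ^ 7 * r h - 5 / 3 * h ^ 7 * E * q h + h ^ 8 * q h * y4 h + h ^ 8 * r h * x4 h, by fun_prop, fun h hh => ?_⟩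
    rw [hc.fst 4 (by norm_num) h hh, ha4 h hh, hb4 h hh]
    field_simp
    ring
  obtain ⟨y5, hy5, hb5⟩ : ∃ y, EvBdd y ∧ ∀ h, 0 < h → b 5 h =
      -(1) + h ^ 2 + h ^ 3 * y h := by
    refine ⟨fun h => 1 - x4 h - 5 / 3 * E + h * y4 h + h * x4 h - 5 / 6 * h * E - 5 / 3 * h ^ 2 * E - 3 / 2 * h ^
      3 * E + 5 / 9 * h ^ 3 * E ^ 2 - 1 / 2 * h ^ 4 * E - 1 / 3 * h ^ 4 * E * y4 h - 1 / 2 * h ^ 4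
      * E * x4 h + 5 / 18 * h ^ 4 * E ^ 2 - h ^ 5 * q h - 1 / 6 * h ^ 5 * E * y4 h - 1 / 2 * h ^ 5
      * E * x4 h + 1 / 6 * h ^ 5 * E ^ 2 + h ^ 6 * q h - h ^ 6 * r h + 1 / 3 * h ^ 6 * E ^ 2 + h ^
      7 * r h + 5 / 3 * h ^ 7 * E * q h - 5 / 3 * h ^ 7 * E * r h + 1 / 6 * h ^ 7 * E ^ 2 - h ^ 8
      * q h * y4 h + h ^ 8 * r h + h ^ 8 * r h * y4 h - h ^ 8 * r h * x4 h - 5 / 3 * h ^ 8 * E * q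
      h + 1 / 6 * h ^ 8 * E ^ 2 * x4 h + h ^ 9 * q h * y4 h + h ^ 9 * r h * x4 h - h ^ 9 * E * q h
      - 2 * h ^ 10 * E * q h - h ^ 11 * E * q h - h ^ 12 * E * q h * x4 h, by fun_prop, fun h hh => ?_⟩
    rw [hc.snd 4 (by norm_num) h hh, hc.fst 4 (by norm_num) h hh, ha4 h hh, hb4 h hh]
    simp only [scaledStrength]
    field_simp
    ring
  obtain ⟨x6, hx6, ha6⟩ : ∃ x, EvBdd x ∧ ∀ h, 0 < h → a 6 h =
      1 + 2 * h + h ^ 2 * x h := by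
    refine ⟨fun h => 2 - 5 / 3 * E + h * y5 h + h * x5 h - 5 / 6 * h ^ 2 * E - h ^ 3 * E - 2 / 3 * h ^ 4 * E + 5
      / 6 * h ^ 4 * E ^ 2 - 1 / 6 * h ^ 5 * E * y5 h - 1 / 2 * h ^ 5 * E * x5 h - h ^ 6 * q h + 2
      * h ^ 6 * r h + 2 * h ^ 7 * r h + h ^ 8 * q h + h ^ 8 * r h - 5 / 3 * h ^ 8 * E * r h + h ^
      9 * q h * y5 h + h ^ 9 * r h * x5 h, by fun_prop, fun h hh => ?_⟩
    rw [hc.fst 5 (by norm_num) h hh, ha5 h hh, hb5 h hh]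
    field_simp
    ring
  obtain ⟨y6, hy6, hb6⟩ : ∃ y, EvBdd y ∧ ∀ h, 0 < h → b 6 h =
      h⁻¹ - 5 / 3 * h * E + h ^ 2 * y h := by
    refine ⟨fun h => -(1) + y5 h + x5 h + 5 / 3 * E - h * x5 h - 5 / 6 * h * E - 5 / 3 * h ^ 2 * E - 5 / 3 * h ^
      3 * E + 5 / 6 * h ^ 3 * E ^ 2 - 5 / 6 * h ^ 4 * E - 1 / 6 * h ^ 4 * E * y5 h - 1 / 2 * h ^ 4
      * E * x5 h + 5 / 6 * h ^ 4 * E ^ 2 - h ^ 5 * q h + 2 * h ^ 5 * r h - 1 / 3 * h ^ 5 * E * y5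
      h - 1 / 2 * h ^ 5 * E * x5 h + h ^ 6 * q h - h ^ 6 * r h + 1 / 3 * h ^ 6 * E ^ 2 + h ^ 7 * q
      h - h ^ 7 * r h - 5 / 3 * h ^ 7 * E * r h + 1 / 3 * h ^ 7 * E ^ 2 - h ^ 8 * q h + h ^ 8 * q
      h * y5 h + h ^ 8 * r h * x5 h + 5 / 3 * h ^ 8 * E * r h + 1 / 6 * h ^ 8 * E ^ 2 - 5 / 18 * h
      ^ 8 * E ^ 3 - h ^ 9 * q h * y5 h + h ^ 9 * r h * y5 h - h ^ 9 * r h * x5 h + 1 / 6 * h ^ 9 *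
      E ^ 2 * x5 h - 2 * h ^ 10 * E * q h - 2 * h ^ 11 * E * q h - h ^ 12 * E * q h + 5 / 3 * h ^
      12 * E ^ 2 * q h - h ^ 13 * E * q h * x5 h, by fun_prop, fun h hh => ?_⟩
    rw [hc.snd 5 (by norm_num) h hh, hc.fst 5 (by norm_num) h hh, ha5 h hh, hb5 h hh]
    simp only [scaledStrength]
    field_simp
    ring
  obtain ⟨x7, hx7, ha7⟩ : ∃ x, EvBdd x ∧ ∀ h, 0 < h → a 7 h =
      h⁻¹ + 1 + 2 * h - 5 / 3 * h * E + h ^ 2 * x h := by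
    refine ⟨fun h => y6 h + x6 h - 1 / 6 * h * E - 1 / 2 * h ^ 2 * E - h ^ 3 * E + 5 / 18 * h ^ 3 * E ^ 2 - 1 / 6
      * h ^ 4 * E * y6 h - 1 / 2 * h ^ 4 * E * x6 h + h ^ 5 * q h + h ^ 6 * r h + 2 * h ^ 7 * r h
      - 5 / 3 * h ^ 7 * E * q h + h ^ 8 * q h * y6 h + h ^ 8 * r h * x6 h, by fun_prop, fun h hh => ?_⟩
    rw [hc.fst 6 (by norm_num) h hh, ha6 h hh, hb6 h hh]
    field_simp
    ring
  obtain ⟨y7, hy7, hb7⟩ : ∃ y, EvBdd y ∧ ∀ h, 0 < h → b 7 h =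
      (h ^ 2)⁻¹ + h⁻¹ + 1 - 5 / 3 * E + h * y h := by
    refine ⟨fun h => -(2) + y6 h + x6 h - h * x6 h - 1 / 6 * h * E - 5 / 6 * h ^ 2 * E - 3 / 2 * h ^ 3 * E + 5 /
      18 * h ^ 3 * E ^ 2 - h ^ 4 * E - 1 / 6 * h ^ 4 * E * y6 h - 1 / 2 * h ^ 4 * E * x6 h + 5 / 9
      * h ^ 4 * E ^ 2 + h ^ 5 * q h - 1 / 3 * h ^ 5 * E * y6 h - 1 / 2 * h ^ 5 * E * x6 h - h ^ 6
      * q h + 2 * h ^ 6 * r h + h ^ 7 * r h - 5 / 3 * h ^ 7 * E * q h + 1 / 6 * h ^ 7 * E ^ 2 + h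
      ^ 8 * q h * y6 h - 2 * h ^ 8 * r h + h ^ 8 * r h * x6 h + 5 / 3 * h ^ 8 * E * q h - 5 / 3 *
      h ^ 8 * E * r h + 1 / 3 * h ^ 8 * E ^ 2 - h ^ 9 * q h * y6 h + h ^ 9 * r h * y6 h - h ^ 9 *
      r h * x6 h + 1 / 6 * h ^ 9 * E ^ 2 * x6 h - h ^ 11 * E * q h - 2 * h ^ 12 * E * q h - h ^ 13
      * E * q h * x6 h, by fun_prop, fun h hh => ?_⟩
    rw [hc.snd 6 (by norm_num) h hh, hc.fst 6 (by norm_num) h hh, ha6 h hh, hb6 h hh]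
    simp only [scaledStrength]
    field_simp
    ring
  obtain ⟨x8, hx8, ha8⟩ : ∃ x, EvBdd x ∧ ∀ h, 0 < h → a 8 h =
      (h ^ 2)⁻¹ + 2 * h⁻¹ + x h := by
    refine ⟨fun h => 2 - 5 / 3 * E + 2 * h + h * y7 h - 5 / 3 * h * E + h ^ 2 * x7 h - 1 / 6 * h ^ 2 * E - 2 / 3
      * h ^ 3 * E - 2 / 3 * h ^ 4 * E + 5 / 18 * h ^ 4 * E ^ 2 - h ^ 5 * E - 1 / 6 * h ^ 5 * E *
      y7 h + 5 / 6 * h ^ 5 * E ^ 2 + h ^ 6 * q h - 1 / 2 * h ^ 6 * E * x7 h + h ^ 7 * q h + h ^ 7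
      * r h + h ^ 8 * q h + h ^ 8 * r h - 5 / 3 * h ^ 8 * E * q h + h ^ 9 * q h * y7 h + 2 * h ^ 9
      * r h - 5 / 3 * h ^ 9 * E * r h + h ^ 10 * r h * x7 h, by fun_prop, fun h hh => ?_⟩
    rw [hc.fst 7 (by norm_num) h hh, ha7 h hh, hb7 h hh]
    field_simp
    ring
  obtain ⟨y8, hy8, hb8⟩ : ∃ y, EvBdd y ∧ ∀ h, 0 < h → b 8 h =
      1 + h ^ 2 * y h := by
    refine ⟨fun h => 2 + y7 h - x7 h - 2 * E + h * x7 h - h * E - 3 / 2 * h ^ 2 * E + 5 / 9 * h ^ 2 * E ^ 2 - 5 /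
      3 * h ^ 3 * E - 1 / 3 * h ^ 3 * E * y7 h + 10 / 9 * h ^ 3 * E ^ 2 - h ^ 4 * q h + h ^ 4 * r
      h - h ^ 4 * E - 1 / 6 * h ^ 4 * E * y7 h - 1 / 2 * h ^ 4 * E * x7 h + 5 / 6 * h ^ 4 * E ^ 2
      - 1 / 2 * h ^ 5 * E * x7 h + 1 / 6 * h ^ 5 * E ^ 2 + h ^ 6 * r h + 5 / 3 * h ^ 6 * E * q h -
      5 / 3 * h ^ 6 * E * r h + 1 / 6 * h ^ 6 * E ^ 2 + h ^ 7 * q h - h ^ 7 * q h * y7 h - h ^ 7 *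
      r h + h ^ 7 * r h * y7 h - 5 / 3 * h ^ 7 * E * q h + 5 / 3 * h ^ 7 * E * r h + 1 / 3 * h ^ 7
      * E ^ 2 - 5 / 18 * h ^ 7 * E ^ 3 + h ^ 8 * q h * y7 h + 2 * h ^ 8 * r h - h ^ 8 * r h * x7 h
      - 5 / 3 * h ^ 8 * E * r h + 1 / 6 * h ^ 8 * E ^ 2 * x7 h + h ^ 9 * r h * x7 h - h ^ 9 * E *
      q h - h ^ 10 * E * q h - 2 * h ^ 11 * E * q h + 5 / 3 * h ^ 11 * E ^ 2 * q h - h ^ 12 * E *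
      q h * x7 h, by fun_prop, fun h hh => ?_⟩
    rw [hc.snd 7 (by norm_num) h hh, hc.fst 7 (by norm_num) h hh, ha7 h hh, hb7 h hh]
    simp only [scaledStrength]
    field_simp
    ring
  refine ⟨fun i hi => ?_, ?_, x8, y8, hx8, hy8, fun h hh => ⟨ha8 h hh, hb8 h hh⟩⟩
  · interval_cases i
    · exact ⟨EvBdd.congr (f := fun h => h ^ 3 * 0) (by fun_prop) fun h hh => by
        rw [ha0 h hh],
        EvBdd.congr (f := fun h => h ^ 3 * 1) (by fun_prop) fun h hh => by
        rw [hb0 h hh]⟩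
    · exact ⟨EvBdd.congr (f := fun h => h ^ 3 + h ^ 7 * x1 h) (by fun_prop) fun h hh => by
        rw [ha1 h hh]; field_simp,
        EvBdd.congr (f := fun h => h ^ 2 - 1 / 6 * h ^ 6 * E + h ^ 7 * y1 h) (by fun_prop) fun h hh => by
        rw [hb1 h hh]; field_simp⟩
    · exact ⟨EvBdd.congr (f := fun h => h ^ 2 + h ^ 3 - 1 / 3 * h ^ 6 * E + h ^ 7 * x2 h) (by fun_prop) fun h hh => by
        rw [ha2 h hh]; field_simp,
        EvBdd.congr (f := fun h => h ^ 4 - 1 / 3 * h ^ 6 * E + h ^ 7 * y2 h) (by fun_prop) fun h hh => by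
        rw [hb2 h hh]; field_simp⟩
    · exact ⟨EvBdd.congr (f := fun h => h ^ 2 + h ^ 3 + h ^ 4 - 7 / 6 * h ^ 6 * E + h ^ 7 * x3 h) (by fun_prop) fun h hh => by
        rw [ha3 h hh]; field_simp,
        EvBdd.congr (f := fun h => -(h ^ 2) + h ^ 4 + h ^ 5 - 1 / 6 * h ^ 6 * E + h ^ 7 * y3 h) (by fun_prop) fun h hh => by
        rw [hb3 h hh]; field_simp⟩
    · exact ⟨EvBdd.congr (f := fun h => h ^ 3 + 2 * h ^ 4 + h ^ 5 + h ^ 6 * x4 h) (by fun_prop) fun h hh => by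
        rw [ha4 h hh]; field_simp,
        EvBdd.congr (f := fun h => h ^ 3 - 5 / 3 * h ^ 5 * E + h ^ 6 * y4 h) (by fun_prop) fun h hh => by
        rw [hb4 h hh]; field_simp⟩
    · exact ⟨EvBdd.congr (f := fun h => 2 * h ^ 3 + 2 * h ^ 4 + h ^ 5 - 5 / 3 * h ^ 5 * E + h ^ 6 * x5 h) (by fun_prop) fun h hh => by
        rw [ha5 h hh]; field_simp,
        EvBdd.congr (f := fun h => -(h ^ 3) + h ^ 5 + h ^ 6 * y5 h) (by fun_prop) fun h hh => by
        rw [hb5 h hh]; field_simp⟩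
    · exact ⟨EvBdd.congr (f := fun h => h ^ 3 + 2 * h ^ 4 + h ^ 5 * x6 h) (by fun_prop) fun h hh => by
        rw [ha6 h hh]; field_simp,
        EvBdd.congr (f := fun h => h ^ 2 - 5 / 3 * h ^ 4 * E + h ^ 5 * y6 h) (by fun_prop) fun h hh => by
        rw [hb6 h hh]; field_simp⟩
    · exact ⟨EvBdd.congr (f := fun h => h ^ 2 + h ^ 3 + 2 * h ^ 4 - 5 / 3 * h ^ 4 * E + h ^ 5 * x7 h) (by fun_prop) fun h hh => by
        rw [ha7 h hh]; field_simp,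
        EvBdd.congr (f := fun h => h + h ^ 2 + h ^ 3 - 5 / 3 * h ^ 3 * E + h ^ 4 * y7 h) (by fun_prop) fun h hh => by
        rw [hb7 h hh]; field_simp⟩
  · exact ⟨EvBdd.congr (f := fun h => 1 + h - 1 / 3 * h ^ 4 * E + h ^ 5 * x2 h) (by fun_prop) fun h hh => by
        rw [ha2 h hh]; field_simp,
      EvBdd.congr (f := fun h => h ^ 2 - 1 / 3 * h ^ 4 * E + h ^ 5 * y2 h) (by fun_prop) fun h hh => by
        rw [hb2 h hh]; ring⟩

end DeltaComb

/-! ### The actual cell matrix and its comparison with the model. -/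

namespace DeltaComb

open Filter Topology

/-- The transfer matrix from the left end of a cell of spacing `s` across its first `i` deltas. -/
noncomputable def cellPartial (k s : ℝ) : ℕ → (ℝ × ℝ) →ₗ[ℝ] (ℝ × ℝ)
  | 0 => LinearMap.id
  | i + 1 => transfer k s (cellStrength s (Fin.ofNat 8 i)) ∘ₗ cellPartial k s i

theorem cellPartial_zero (k s : ℝ) : cellPartial k s 0 = LinearMap.id := rfl

theorem cellPartial_succ (k s : ℝ) (i : ℕ) : cellPartial k s (i + 1) =
    transfer k s (cellStrength s (Fin.ofNat 8 i)) ∘ₗ cellPartial k s i := rfl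

attribute [irreducible] cellPartial

theorem sympl_cellPartial {k : ℝ} (hk : k ≠ 0) (s : ℝ) (i : ℕ) (x y : ℝ × ℝ) :
    sympl (cellPartial k s i x) (cellPartial k s i y) = sympl x y := by
  induction i with
  | zero => simp only [cellPartial_zero, LinearMap.id_apply]
  | succ i ih => simp only [cellPartial_succ, LinearMap.comp_apply, sympl_transfer hk, ih]

theorem sq_mul_cellStrength {h : ℝ} (hh : 0 < h) {i : ℕ} (hi : i < 8) :
    h ^ 2 * cellStrength (h ^ 2) (Fin.ofNat 8 i) = scaledStrength h i := by
  have e0 : ∀ x : ℝ, (h ^ 2) ^ x = h ^ (2 * x) := fun x => by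
    rw [← Real.rpow_natCast, ← Real.rpow_mul hh.le]; norm_num
  have e1 : h ^ 2 * y₁ (h ^ 2) = h⁻¹ - 1 := by
    rw [y₁, e0, e0, show (2 : ℝ) * (-(3 / 2)) = -(3 : ℕ) by norm_num,
      show (2 : ℝ) * (-1) = -(2 : ℕ) by norm_num, Real.rpow_neg hh.le, Real.rpow_neg hh.le,
      Real.rpow_natCast, Real.rpow_natCast]
    field_simp
  have e2 : h ^ 2 * y₂ (h ^ 2) = h - 1 := by
    rw [y₂, e0, e0, show (2 : ℝ) * (-(1 / 2)) = -(1 : ℕ) by norm_num,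
      show (2 : ℝ) * (-1) = -(2 : ℕ) by norm_num, Real.rpow_neg hh.le, Real.rpow_neg hh.le,
      Real.rpow_natCast, Real.rpow_natCast]
    field_simp
  interval_cases i <;> first | exact e1 | exact e2

/-- The remainder of the cosine in the transfer matrix. -/
noncomputable def cosRem (k h : ℝ) : ℝ := (Real.cos (k * h ^ 2) - 1 + 1 / 2 * h ^ 4 * k ^ 2) / h ^ 8

/-- The remainder of the sine in the transfer matrix. -/
noncomputable def sinRem (k h : ℝ) : ℝ :=
  (Real.sin (k * h ^ 2) / (k * h ^ 2) - 1 + 1 / 6 * h ^ 4 * k ^ 2) / h ^ 8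

theorem eventually_abs_mul_sq_le_one (k : ℝ) : ∀ᶠ h in 𝓝[>] (0 : ℝ), |k * h ^ 2| ≤ 1 := by
  have h1 : Tendsto (fun h : ℝ => |k * h ^ 2|) (𝓝[>] 0) (𝓝 |k * 0 ^ 2|) :=
    (Continuous.tendsto (by fun_prop) 0).mono_left nhdsWithin_le_nhds
  exact h1.eventually (ge_mem_nhds (by norm_num))

theorem evBdd_cosRem (k : ℝ) : EvBdd (cosRem k) := by
  refine ⟨k ^ 4 * (5 / 96), ?_⟩
  filter_upwards [eventually_abs_mul_sq_le_one k, self_mem_nhdsWithin] with h h1 h2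
  have h0 : (0 : ℝ) < h := h2
  have h3 := Real.cos_bound h1
  rw [cosRem, abs_div, abs_of_pos (by positivity : 0 < h ^ 8), div_le_iff₀ (by positivity)]
  calc _ = |Real.cos (k * h ^ 2) - (1 - (k * h ^ 2) ^ 2 / 2)| := by congr 1; ring
    _ ≤ _ := h3
    _ = _ := by rw [abs_mul, mul_pow, abs_of_pos (by positivity : 0 < h ^ 2), ← abs_pow,
                  abs_of_nonneg (by positivity : 0 ≤ k ^ 4)]; ring

theorem evBdd_sinRem {k : ℝ} (hk : k ≠ 0) : EvBdd (sinRem k) := by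
  refine ⟨k ^ 4 * (1 / 100), ?_⟩
  filter_upwards [eventually_abs_mul_sq_le_one k, self_mem_nhdsWithin] with h h1 h2
  have h0 : (0 : ℝ) < h := h2
  have h3 := Real.sin_bound h1
  have hx : 0 < |k * h ^ 2| := abs_pos.2 (by positivity)
  have e1 : sinRem k h = (Real.sin (k * h ^ 2) - (k * h ^ 2 - (k * h ^ 2) ^ 3 / 6)) /
      (k * h ^ 2) / h ^ 8 := by
    rw [sinRem]
    field_simp
    ring
  rw [e1, abs_div, abs_div, abs_of_pos (by positivity : 0 < h ^ 8), div_le_iff₀ (by positivity),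
    div_le_iff₀ hx]
  refine h3.trans (le_of_eq ?_)
  have e2 : |k * h ^ 2| ^ 4 = k ^ 4 * h ^ 8 := by
    rw [← abs_pow, abs_of_nonneg (by positivity)]; ring
  calc |k * h ^ 2| ^ 5 / 100 = |k * h ^ 2| ^ 4 * |k * h ^ 2| / 100 := by ring
    _ = _ := by rw [e2]; ring

/-- With E = k² and spacing h², the coefficients are cos(kh²) and sin(kh²)/(kh²), each written as
its Taylor polynomial plus h⁸ times a function bounded near 0. -/
theorem isScaledCell_cellPartial {k : ℝ} (hk : k ≠ 0) (x : ℝ → ℝ × ℝ) :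
    IsScaledCell (k ^ 2) (cosRem k) (sinRem k) (fun i h => (cellPartial k (h ^ 2) i (x h)).1)
      (fun i h => h ^ 2 * (cellPartial k (h ^ 2) i (x h)).2) := by
  have hcos : ∀ h : ℝ, 0 < h →
      1 - 1 / 2 * h ^ 4 * k ^ 2 + h ^ 8 * cosRem k h = Real.cos (k * h ^ 2) := fun h hh => by
    rw [cosRem]; field_simp; ring
  have hsin : ∀ h : ℝ, 0 < h →
      1 - 1 / 6 * h ^ 4 * k ^ 2 + h ^ 8 * sinRem k h = Real.sin (k * h ^ 2) / (k * h ^ 2) :=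
    fun h hh => by rw [sinRem]; field_simp; ring
  refine ⟨evBdd_cosRem k, evBdd_sinRem hk, fun i hi h hh => ?_, fun i hi h hh => ?_⟩
  · rw [hcos h hh, hsin h hh]
    simp only [cellPartial_succ, LinearMap.comp_apply, transfer_apply]
    field_simp
  · rw [hcos h hh, hsin h hh, ← sq_mul_cellStrength hh hi]
    simp only [cellPartial_succ, LinearMap.comp_apply, transfer_apply]
    field_simp
    ring

/-- The approximate transfer matrix of a cell of spacing `h²`. -/
noncomputable def modelCell (E h : ℝ) : (ℝ × ℝ) →ₗ[ℝ] (ℝ × ℝ) where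
  toFun x := ((1 - (1 + 2 * h) * ((5 / 3 + 2 / 3 * h) * E)) * x.1 + (1 + 2 * h) * x.2,
    -((5 / 3 + 2 / 3 * h) * E) * x.1 + x.2)
  map_add' x y := by ext <;> simp <;> ring
  map_smul' r x := by ext <;> simp <;> ring

theorem modelCell_apply (E h : ℝ) (x : ℝ × ℝ) : modelCell E h x =
    ((1 - (1 + 2 * h) * ((5 / 3 + 2 / 3 * h) * E)) * x.1 + (1 + 2 * h) * x.2,
      -((5 / 3 + 2 / 3 * h) * E) * x.1 + x.2) := rfl

theorem EvBdd.abs {f : ℝ → ℝ} (hf : EvBdd f) : EvBdd fun h => |f h| := by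
  obtain ⟨C, hC⟩ := hf
  exact ⟨C, hC.mono fun h hh => by rwa [abs_abs]⟩

theorem EvBdd.sum {ι : Type*} {s : Finset ι} {f : ι → ℝ → ℝ} (hf : ∀ i ∈ s, EvBdd (f i)) :
    EvBdd fun h => ∑ i ∈ s, f i h := by
  classical
  induction s using Finset.induction_on with
  | empty => simpa using EvBdd.const 0
  | insert i s hi ih =>
    simp only [Finset.sum_insert hi]
    exact (hf i (Finset.mem_insert_self i s)).add
      (ih fun j hj => hf j (Finset.mem_insert_of_mem hj))

/-- Asymptotics of the transfer matrices of a cell as its spacing `h²` tends to `0`. -/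
theorem exists_cell_bounds {k : ℝ} (hk : k ≠ 0) : ∃ C, 0 < C ∧ ∀ᶠ h in 𝓝[>] (0 : ℝ), ∀ x : ℝ × ℝ,
    (∀ i < 8, h * |(cellPartial k (h ^ 2) i x).1| ≤ C * ‖x‖ ∧
      h * |h ^ 2 * (cellPartial k (h ^ 2) i x).2| ≤ C * ‖x‖) ∧
    |(cellPartial k (h ^ 2) 2 x).1 - h⁻¹ * x.1| ≤ C * ‖x‖ ∧
    |h ^ 2 * (cellPartial k (h ^ 2) 2 x).2| ≤ C * ‖x‖ ∧
    ‖cellPartial k (h ^ 2) 8 x - modelCell (k ^ 2) h x‖ ≤ C * h ^ 2 * ‖x‖ := by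
  obtain ⟨A1, ⟨A2, A3⟩, X, Y, hX, hY, hXY⟩ :=
    (isScaledCell_cellPartial hk (fun _ => (1, 0))).column_one (fun h _ => by simp [cellPartial_zero])
      (fun h _ => by simp [cellPartial_zero])
  obtain ⟨B1, ⟨B2, B3⟩, X', Y', hX', hY', hXY'⟩ :=
    (isScaledCell_cellPartial hk (fun h => (0, (h ^ 2)⁻¹))).column_two (fun h _ => by simp [cellPartial_zero])
      (fun h hh => by simp only [cellPartial_zero, LinearMap.id_apply]; field_simp)
  -- The general state is a combination of the two expanded columns; the factor h² undoes the
  -- scaling of the second.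
  have hlin : ∀ (h : ℝ) (i : ℕ) (x : ℝ × ℝ), 0 < h → cellPartial k (h ^ 2) i x =
      x.1 • cellPartial k (h ^ 2) i (1, 0) +
        (x.2 * h ^ 2) • cellPartial k (h ^ 2) i (0, (h ^ 2)⁻¹) := fun h i x hh => by
    rw [← map_smul, ← map_smul, ← map_add]
    congr 1
    ext <;> simp
    field_simp
  set a := fun i h => (cellPartial k (h ^ 2) i (1, 0)).1 with ha
  set b := fun i h => h ^ 2 * (cellPartial k (h ^ 2) i (1, 0)).2 with hb
  set a' := fun i h => (cellPartial k (h ^ 2) i (0, (h ^ 2)⁻¹)).1 with ha'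
  set b' := fun i h => h ^ 2 * (cellPartial k (h ^ 2) i (0, (h ^ 2)⁻¹)).2 with hb'
  have hS : EvBdd fun h => ∑ i ∈ Finset.range 8,
      (|h * a i h| + |h * b i h| + |h ^ 3 * a' i h| + |h ^ 3 * b' i h|) :=
    EvBdd.sum fun i hi => by
      have hi := Finset.mem_range.1 hi
      exact (((A1 i hi).1.abs.add (A1 i hi).2.abs).add (B1 i hi).1.abs).add (B1 i hi).2.abs
  have hT : EvBdd fun h => |a 2 h - h⁻¹| + |b 2 h| + |h * a' 2 h| + |h * b' 2 h| + |X h| + |Y h| +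
      |X' h| + |Y' h| :=
    ((((((A2.abs.add A3.abs).add B2.abs).add B3.abs).add hX.abs).add hY.abs).add hX'.abs).add
      hY'.abs
  obtain ⟨C, hC⟩ := hS
  obtain ⟨D, hD⟩ := hT
  refine ⟨2 * (|C| + |D| + 4 / 3 * k ^ 2 + 1), by positivity, ?_⟩
  filter_upwards [hC, hD, Ioo_mem_nhdsGT (show (0 : ℝ) < 1 by norm_num)] with h h1 h2 h3 x
  have h0 : 0 < h := h3.1
  have hh1 : h ≤ 1 := h3.2.le
  have hx1 : |x.1| ≤ ‖x‖ := norm_fst_le x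
  have hx2 : |x.2| ≤ ‖x‖ := norm_snd_le x
  have hn := norm_nonneg x
  rw [abs_of_nonneg (Finset.sum_nonneg fun i _ => by positivity)] at h1
  rw [abs_of_nonneg (by positivity)] at h2
  have hCa := le_abs_self C
  have hDa := le_abs_self D
  have hk2 := sq_nonneg k
  have comb : ∀ {s t S T : ℝ}, |s| ≤ S → |t| ≤ T → |x.1 * s + x.2 * t| ≤ (S + T) * ‖x‖ := by
    intro s t S T hs ht
    calc _ ≤ |x.1| * |s| + |x.2| * |t| := by rw [← abs_mul, ← abs_mul]; exact abs_add_le _ _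
      _ ≤ ‖x‖ * S + ‖x‖ * T := by gcongr
      _ = _ := by ring
  have f1 : ∀ i, (cellPartial k (h ^ 2) i x).1 = x.1 * a i h + x.2 * (h ^ 2 * a' i h) :=
    fun i => by
      rw [hlin h i x h0]; simp only [Prod.fst_add, Prod.smul_fst, smul_eq_mul, ha, ha']; ring
  have f2 : ∀ i, h ^ 2 * (cellPartial k (h ^ 2) i x).2 = x.1 * b i h + x.2 * (h ^ 2 * b' i h) :=
    fun i => by
      rw [hlin h i x h0]; simp only [Prod.snd_add, Prod.smul_snd, smul_eq_mul, hb, hb']; ring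
  have a0 := abs_nonneg (a 2 h - h⁻¹)
  have a1 := abs_nonneg (b 2 h)
  have a2 := abs_nonneg (h * a' 2 h)
  have a3 := abs_nonneg (h * b' 2 h)
  have a4 := abs_nonneg (X h)
  have a5 := abs_nonneg (Y h)
  have a6 := abs_nonneg (X' h)
  have a7 := abs_nonneg (Y' h)
  refine ⟨fun i hi => ?_, ?_, ?_, ?_⟩
  · have h4 := Finset.single_le_sum (f := fun i =>
      |h * a i h| + |h * b i h| + |h ^ 3 * a' i h| + |h ^ 3 * b' i h|)
      (fun i _ => by positivity) (Finset.mem_range.2 hi)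
    have h5 := h4.trans h1
    have c0 := abs_nonneg (h * a i h)
    have c1 := abs_nonneg (h * b i h)
    have c2 := abs_nonneg (h ^ 3 * a' i h)
    have c3 := abs_nonneg (h ^ 3 * b' i h)
    constructor
    · rw [f1, ← abs_of_pos h0, ← abs_mul, abs_of_pos h0]
      have e : h * (x.1 * a i h + x.2 * (h ^ 2 * a' i h)) =
          x.1 * (h * a i h) + x.2 * (h ^ 3 * a' i h) := by ring
      rw [e]
      refine (comb (S := C) (T := C) (by linarith) (by linarith)).trans ?_
      gcongr
      linarith [abs_nonneg D]
    · rw [f2, ← abs_of_pos h0, ← abs_mul, abs_of_pos h0]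
      have e : h * (x.1 * b i h + x.2 * (h ^ 2 * b' i h)) =
          x.1 * (h * b i h) + x.2 * (h ^ 3 * b' i h) := by ring
      rw [e]
      refine (comb (S := C) (T := C) (by linarith) (by linarith)).trans ?_
      gcongr
      linarith [abs_nonneg D]
  · have e : x.1 * a 2 h + x.2 * (h ^ 2 * a' 2 h) - h⁻¹ * x.1 =
        x.1 * (a 2 h - h⁻¹) + x.2 * (h * (h * a' 2 h)) := by ring
    rw [f1, e]
    have h5 : |h * (h * a' 2 h)| ≤ D := by
      rw [abs_mul, abs_of_pos h0]
      nlinarith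
    refine (comb (S := D) (T := D) (by linarith) h5).trans ?_
    gcongr
    linarith [abs_nonneg C]
  · rw [f2]
    have h5 : |h ^ 2 * b' 2 h| ≤ D := by
      rw [sq, mul_assoc, abs_mul, abs_of_pos h0]
      nlinarith
    refine (comb (S := D) (T := D) (by linarith) h5).trans ?_
    gcongr
    linarith [abs_nonneg C]
  · have g1 : a 8 h = 1 - 5 / 3 * k ^ 2 - 4 * h * k ^ 2 + h ^ 2 * X h := (hXY h h0).1
    have g2 : b 8 h = -(5 / 3 * h ^ 2 * k ^ 2) - 2 / 3 * h ^ 3 * k ^ 2 + h ^ 4 * Y h :=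
      (hXY h h0).2
    have g3 : a' 8 h = (h ^ 2)⁻¹ + 2 * h⁻¹ + X' h := (hXY' h h0).1
    have g4 : b' 8 h = 1 + h ^ 2 * Y' h := (hXY' h h0).2
    have hpos : 0 < h ^ 2 := by positivity
    rw [norm_prod_le_iff]
    constructor
    · have e : (cellPartial k (h ^ 2) 8 x - modelCell (k ^ 2) h x).1 =
          h ^ 2 * (x.1 * (X h + 4 / 3 * k ^ 2) + x.2 * X' h) := by
        rw [Prod.fst_sub, f1, g1, g3, modelCell_apply]
        field_simp
        ring
      -- The 4/3 comes from the h² term that `modelCell` contains in order to have determinant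
      -- exactly 1.
      have h5 : |X h + 4 / 3 * k ^ 2| ≤ D + 4 / 3 * k ^ 2 := by
        refine (abs_add_le _ _).trans ?_
        rw [abs_of_nonneg (by positivity : 0 ≤ 4 / 3 * k ^ 2)]
        linarith
      rw [e, Real.norm_eq_abs, abs_mul, abs_of_pos hpos]
      have h6 := comb (T := D) h5 (show |X' h| ≤ D by linarith)
      calc _ ≤ h ^ 2 * ((D + 4 / 3 * k ^ 2 + D) * ‖x‖) := by gcongr
        _ ≤ h ^ 2 * (2 * (|C| + |D| + 4 / 3 * k ^ 2 + 1) * ‖x‖) := by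
          gcongr
          linarith [abs_nonneg C]
        _ = _ := by ring
    · have e : (cellPartial k (h ^ 2) 8 x - modelCell (k ^ 2) h x).2 =
          h ^ 2 * (x.1 * Y h + x.2 * Y' h) := by
        have e1 : (cellPartial k (h ^ 2) 8 x).2 =
            (x.1 * b 8 h + x.2 * (h ^ 2 * b' 8 h)) / h ^ 2 := by
          rw [← f2]; field_simp
        rw [Prod.snd_sub, e1, g2, g4, modelCell_apply]
        field_simp
        ring
      rw [e, Real.norm_eq_abs, abs_mul, abs_of_pos hpos]
      have h6 := comb (S := D) (T := D) (show |Y h| ≤ D by linarith) (show |Y' h| ≤ D by linarith)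
      calc _ ≤ h ^ 2 * ((D + D) * ‖x‖) := by gcongr
        _ ≤ h ^ 2 * (2 * (|C| + |D| + 4 / 3 * k ^ 2 + 1) * ‖x‖) := by
          gcongr
          linarith [abs_nonneg C]
        _ = _ := by ring

end DeltaComb

/-! ### Diagonalising the model: one step as a sheared rotation. -/

namespace DeltaComb

open Filter Topology MeasureTheory ProbabilityTheory

/-- The transfer matrix of a delta of strength `g`. -/
def shear (g : ℝ) : (ℝ × ℝ) →ₗ[ℝ] (ℝ × ℝ) where
  toFun x := (x.1, x.2 + g * x.1)
  map_add' x y := by ext <;> simp; ring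
  map_smul' r x := by ext <;> simp; ring

theorem shear_apply (g : ℝ) (x : ℝ × ℝ) : shear g x = (x.1, x.2 + g * x.1) := rfl

theorem sympl_shear (g : ℝ) (x y : ℝ × ℝ) : sympl (shear g x) (shear g y) = sympl x y := by
  simp only [sympl, shear_apply]
  ring

theorem norm_shear_le {g G : ℝ} (hg : |g| ≤ G) (x : ℝ × ℝ) : ‖shear g x‖ ≤ (1 + G) * ‖x‖ := by
  have h1 : |x.1| ≤ ‖x‖ := norm_fst_le x
  have h2 : |x.2| ≤ ‖x‖ := norm_snd_le x
  have h0 := norm_nonneg x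
  have hG := (abs_nonneg g).trans hg
  rw [shear_apply, norm_prod_le_iff]
  constructor
  · rw [Real.norm_eq_abs]
    nlinarith
  · calc |x.2 + g * x.1| ≤ |x.2| + |g| * |x.1| := by rw [← abs_mul]; exact abs_add_le _ _
      _ ≤ ‖x‖ + G * ‖x‖ := by gcongr
      _ = _ := by ring

/-- Half the trace of `modelCell`. -/
noncomputable def modelCos (E h : ℝ) : ℝ := 1 - (1 + 2 * h) * ((5 / 3 + 2 / 3 * h) * E) / 2

/-- The square root is 0 when |`modelCos`| ≥ 1, so positivity of `modelSin` expresses that the model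
is elliptic. -/
noncomputable def modelSin (E h : ℝ) : ℝ := √(1 - modelCos E h ^ 2)

/-- An eigenvalue of `modelCell`. -/
noncomputable def modelPhase (E h : ℝ) : ℂ := ⟨modelCos E h, modelSin E h⟩

/-- Coordinates in which `modelCell` is a rotation. -/
noncomputable def modelCoord (E h : ℝ) : (ℝ × ℝ) →ₗ[ℝ] ℂ where
  toFun x := ⟨x.1 * (-((5 / 3 + 2 / 3 * h) * E) / 2) + x.2, x.1 * (modelSin E h / (1 + 2 * h))⟩
  map_add' x y := by apply Complex.ext <;> simp <;> ring
  map_smul' r x := by apply Complex.ext <;> simp <;> ring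

theorem modelCoord_apply (E h : ℝ) (x : ℝ × ℝ) : modelCoord E h x =
    ⟨x.1 * (-((5 / 3 + 2 / 3 * h) * E) / 2) + x.2, x.1 * (modelSin E h / (1 + 2 * h))⟩ := rfl

/-- The inverse of `modelCoord`. -/
noncomputable def modelCoordInv (E h : ℝ) : ℂ →ₗ[ℝ] (ℝ × ℝ) where
  toFun p := (p.im * ((1 + 2 * h) / modelSin E h),
    p.re - p.im * ((modelCos E h - 1) / modelSin E h))
  map_add' x y := by ext <;> simp <;> ring
  map_smul' r x := by ext <;> simp <;> ring

theorem modelCoordInv_apply (E h : ℝ) (p : ℂ) : modelCoordInv E h p =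
    (p.im * ((1 + 2 * h) / modelSin E h),
      p.re - p.im * ((modelCos E h - 1) / modelSin E h)) := rfl

theorem modelCoordInv_modelCoord {E h : ℝ} (hh : 0 ≤ h) (hs : modelSin E h ≠ 0) (x : ℝ × ℝ) :
    modelCoordInv E h (modelCoord E h x) = x := by
  rw [modelCoordInv_apply, modelCoord_apply]
  have : 1 + 2 * h ≠ 0 := by positivity
  ext
  · simp only
    field_simp
  · simp only [modelCos]
    field_simp
    ring

theorem modelCoord_modelCoordInv {E h : ℝ} (hh : 0 ≤ h) (hs : modelSin E h ≠ 0) (p : ℂ) :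
    modelCoord E h (modelCoordInv E h p) = p := by
  rw [modelCoordInv_apply, modelCoord_apply]
  have : 1 + 2 * h ≠ 0 := by positivity
  apply Complex.ext
  · simp only [modelCos]
    field_simp
    ring
  · simp only
    field_simp

theorem wronskian_modelCoord (E h : ℝ) (x y : ℝ × ℝ) :
    wronskian (modelCoord E h x) (modelCoord E h y) =
      -(modelSin E h / (1 + 2 * h)) * sympl x y := by
  simp only [wronskian, modelCoord_apply, sympl]
  ring

theorem modelCos_sq_add_modelSin_sq {E h : ℝ} (hs : 0 < modelSin E h) :
    modelCos E h ^ 2 + modelSin E h ^ 2 = 1 := by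
  rw [modelSin, Real.sq_sqrt (Real.sqrt_pos.1 hs).le]
  ring

theorem norm_modelPhase {E h : ℝ} (hs : 0 < modelSin E h) : ‖modelPhase E h‖ = 1 := by
  have h1 : ‖modelPhase E h‖ ^ 2 = 1 := by
    rw [Complex.sq_norm, Complex.normSq_apply, ← modelCos_sq_add_modelSin_sq hs]
    simp only [modelPhase]
    ring
  exact (pow_eq_one_iff_of_nonneg (norm_nonneg _) two_ne_zero).1 h1

/-- `modelCoord` is x ↦ αx₁ + x₂ with (α, 1) a left eigenvector: with m = 1 + 2h the eigenvalue
equation reads αm + 1 = z, and (z - 1)/m is exactly the coefficient in its definition. -/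
theorem modelCoord_modelCell {E h : ℝ} (hh : 0 ≤ h) (hs : 0 < modelSin E h) (x : ℝ × ℝ) :
    modelCoord E h (modelCell E h x) = modelPhase E h * modelCoord E h x := by
  have h1 : 1 + 2 * h ≠ 0 := by positivity
  have h2 := modelCos_sq_add_modelSin_sq hs
  have h3 : (5 / 3 + 2 / 3 * h) * E = 2 * (1 - modelCos E h) / (1 + 2 * h) := by
    rw [modelCos]; field_simp; ring
  rw [modelCell_apply, modelCoord_apply, modelCoord_apply, modelPhase, h3]
  apply Complex.ext
  · simp only [Complex.mul_re]
    field_simp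
    linear_combination x.1 * h2
  · simp only [Complex.mul_im]
    field_simp
    ring

/-- A delta of strength g adds g x₁ to x₂, hence to the real part of the coordinate, while x₁ is a
multiple of the imaginary part. This is the origin of the form κ Im(z p) and of the factor kₙ = (1 +
2h)/`modelSin`. -/
theorem fst_modelCell {E h : ℝ} (hh : 0 ≤ h) (hs : 0 < modelSin E h) (x : ℝ × ℝ) :
    (modelCell E h x).1 =
      (1 + 2 * h) / modelSin E h * (modelPhase E h * modelCoord E h x).im := by
  rw [← modelCoord_modelCell hh hs, modelCoord_apply]
  have : 1 + 2 * h ≠ 0 := by positivity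
  have := hs.ne'
  simp only
  field_simp

section Bounds

variable {E h σ : ℝ}

theorem norm_modelCoord_le (hE : 0 < E) (hE' : E < 12 / 5) (hh : 0 ≤ h) (hh' : h ≤ 1)
    (hs : 0 < modelSin E h) (x : ℝ × ℝ) : ‖modelCoord E h x‖ ≤ 5 * ‖x‖ := by
  have h1 : |x.1| ≤ ‖x‖ := norm_fst_le x
  have h2 : |x.2| ≤ ‖x‖ := norm_snd_le x
  have hs1 : modelSin E h ≤ 1 := by
    nlinarith [modelCos_sq_add_modelSin_sq hs, sq_nonneg (modelCos E h)]
  have e1 : |-((5 / 3 + 2 / 3 * h) * E) / 2| ≤ 3 := by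
    rw [abs_le]; constructor <;> nlinarith
  have e2 : |modelSin E h / (1 + 2 * h)| ≤ 1 := by
    rw [abs_of_nonneg (by positivity), div_le_one (by positivity)]
    linarith
  refine (Complex.norm_le_abs_re_add_abs_im _).trans ?_
  rw [modelCoord_apply]
  simp only
  calc _ ≤ |x.1| * |-((5 / 3 + 2 / 3 * h) * E) / 2| + |x.2| +
        |x.1| * |modelSin E h / (1 + 2 * h)| := by
        rw [← abs_mul, ← abs_mul]; gcongr; exact abs_add_le _ _
    _ ≤ ‖x‖ * 3 + ‖x‖ + ‖x‖ * 1 := by gcongr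
    _ = _ := by ring

theorem norm_modelCoordInv_le (hh : 0 ≤ h) (hh' : h ≤ 1) (hσ : 0 < σ)
    (hs : σ ≤ modelSin E h) (p : ℂ) : ‖modelCoordInv E h p‖ ≤ 3 / σ * ‖p‖ := by
  have hs0 := hσ.trans_le hs
  have h2 := modelCos_sq_add_modelSin_sq hs0
  have hs1 : modelSin E h ≤ 1 := by nlinarith [sq_nonneg (modelCos E h)]
  have hσ1 := hs.trans hs1
  have h3 : |modelCos E h - 1| ≤ 2 := by
    have : |modelCos E h| ≤ 1 := by rw [← sq_le_one_iff_abs_le_one]; nlinarith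
    rw [abs_le] at *; constructor <;> linarith [this.1, this.2]
  have h4 := Complex.abs_re_le_norm p
  have h5 := Complex.abs_im_le_norm p
  rw [modelCoordInv_apply, norm_prod_le_iff, Real.norm_eq_abs, Real.norm_eq_abs]
  constructor
  · rw [abs_mul, abs_of_nonneg (by positivity : 0 ≤ (1 + 2 * h) / modelSin E h)]
    calc _ ≤ ‖p‖ * (3 / σ) := by gcongr; linarith
      _ = _ := by ring
  · calc _ ≤ |p.re| + |p.im| * (|modelCos E h - 1| / modelSin E h) := by
          rw [← abs_of_pos hs0, ← abs_div, ← abs_mul, abs_of_pos hs0]; exact abs_sub _ _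
      _ ≤ ‖p‖ + ‖p‖ * (2 / σ) := by gcongr
      _ ≤ ‖p‖ * (1 / σ) + ‖p‖ * (2 / σ) := by
          gcongr
          exact le_mul_of_one_le_right (norm_nonneg p) ((one_le_div hσ).2 hσ1)
      _ = _ := by ring

theorem norm_modelCell_le (hE : 0 < E) (hE' : E < 12 / 5) (hh : 0 ≤ h) (hh' : h ≤ 1)
    (x : ℝ × ℝ) : ‖modelCell E h x‖ ≤ 30 * ‖x‖ := by
  have h1 : |x.1| ≤ ‖x‖ := norm_fst_le x
  have h2 : |x.2| ≤ ‖x‖ := norm_snd_le x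
  have h3 : (5 / 3 + 2 / 3 * h) * E ≤ 6 := by nlinarith
  have h3' : 0 ≤ (5 / 3 + 2 / 3 * h) * E := by positivity
  have h4 : (1 + 2 * h) * ((5 / 3 + 2 / 3 * h) * E) ≤ 3 * 6 := by gcongr; linarith
  have h4' : 0 ≤ (1 + 2 * h) * ((5 / 3 + 2 / 3 * h) * E) := by positivity
  have e1 : |1 - (1 + 2 * h) * ((5 / 3 + 2 / 3 * h) * E)| ≤ 18 := by
    rw [abs_le]; constructor <;> linarith
  have e2 : |1 + 2 * h| ≤ 3 := by rw [abs_le]; constructor <;> linarith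
  have e3 : |-((5 / 3 + 2 / 3 * h) * E)| ≤ 6 := by rw [abs_le]; constructor <;> linarith
  have h0 := norm_nonneg x
  rw [modelCell_apply, norm_prod_le_iff, Real.norm_eq_abs, Real.norm_eq_abs]
  constructor
  · calc _ ≤ |1 - (1 + 2 * h) * ((5 / 3 + 2 / 3 * h) * E)| * |x.1| + |1 + 2 * h| * |x.2| := by
          rw [← abs_mul, ← abs_mul]; exact abs_add_le _ _
      _ ≤ 18 * ‖x‖ + 3 * ‖x‖ := by gcongr
      _ ≤ _ := by linarith
  · calc _ ≤ |-((5 / 3 + 2 / 3 * h) * E)| * |x.1| + |x.2| := by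
          rw [← abs_mul]; exact abs_add_le _ _
      _ ≤ 6 * ‖x‖ + ‖x‖ := by gcongr
      _ ≤ _ := by linarith

/-- The coordinate depends on h only through the coefficient of x₁, so its variation is measured on
(1, 0). -/
theorem norm_modelCoord_sub_le (E h h' : ℝ) (x : ℝ × ℝ) :
    ‖modelCoord E h' x - modelCoord E h x‖ ≤
      ‖modelCoord E h' (1, 0) - modelCoord E h (1, 0)‖ * ‖x‖ := by
  have : modelCoord E h' x - modelCoord E h x =
      x.1 * (modelCoord E h' (1, 0) - modelCoord E h (1, 0)) := by
    simp only [modelCoord_apply]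
    apply Complex.ext <;> simp <;> ring
  rw [this, norm_mul, mul_comm, Complex.norm_real]
  gcongr
  exact norm_fst_le x

/-- Two errors arise: the change of coordinates from h to h', acting on a vector of size at most (30
+ D)‖x‖, and the cell error δ. The shear costs 1 + G, and 3/σ converts ‖x‖ back into the norm of the
coordinate. -/
theorem norm_modelCoord_step_le {h' g G δ D : ℝ} (hE : 0 < E) (hE' : E < 12 / 5) (hh : 0 ≤ h)
    (hh' : h ≤ 1) (hσ : 0 < σ) (hs : σ ≤ modelSin E h) {M : (ℝ × ℝ) →ₗ[ℝ] (ℝ × ℝ)}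
    (hM : ∀ x, ‖M x - modelCell E h x‖ ≤ δ * ‖x‖) (hδ : 0 ≤ δ) (hδD : δ ≤ D) (hg : |g| ≤ G)
    (p : ℂ) :
    ‖modelCoord E h' (shear g (M (modelCoordInv E h p))) - (modelPhase E h * p +
      (((1 + 2 * h) / modelSin E h * g) * (modelPhase E h * p).im : ℝ))‖ ≤
    3 / σ * (1 + G) * (‖modelCoord E h' (1, 0) - modelCoord E h (1, 0)‖ * (30 + D) + 5 * δ) *
      ‖p‖ := by
  have hs0 := hσ.trans_le hs
  obtain ⟨x, rfl⟩ : ∃ x, p = modelCoord E h x :=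
    ⟨_, (modelCoord_modelCoordInv hh hs0.ne' p).symm⟩
  have hG := (abs_nonneg g).trans hg
  have hx := norm_modelCoordInv_le hh hh' hσ hs (modelCoord E h x)
  rw [modelCoordInv_modelCoord hh hs0.ne'] at hx ⊢
  have e1 : modelCoord E h (shear g (modelCell E h x)) = modelPhase E h * modelCoord E h x +
      (((1 + 2 * h) / modelSin E h * g) * (modelPhase E h * modelCoord E h x).im : ℝ) := by
    have h1 := fst_modelCell hh hs0 x
    have h2 := modelCoord_modelCell hh hs0 x
    rw [← h2] at h1 ⊢
    rw [mul_right_comm, ← h1, mul_comm, shear_apply, modelCoord_apply, modelCoord_apply]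
    apply Complex.ext <;> simp
    ring
  have e2 : modelCoord E h' (shear g (M x)) - modelCoord E h (shear g (modelCell E h x)) =
      (modelCoord E h' (shear g (M x)) - modelCoord E h (shear g (M x))) +
        modelCoord E h (shear g (M x - modelCell E h x)) := by
    simp only [map_sub]
    ring
  rw [← e1, e2]
  have hMx : ‖M x‖ ≤ (30 + D) * ‖x‖ := by
    calc ‖M x‖ = ‖modelCell E h x + (M x - modelCell E h x)‖ := by rw [add_sub_cancel]
      _ ≤ 30 * ‖x‖ + δ * ‖x‖ := (norm_add_le _ _).trans
          (add_le_add (norm_modelCell_le hE hE' hh hh' x) (hM x))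
      _ ≤ 30 * ‖x‖ + D * ‖x‖ := by gcongr
      _ = _ := by ring
  have hD := hδ.trans hδD
  calc _ ≤ ‖modelCoord E h' (1, 0) - modelCoord E h (1, 0)‖ * ‖shear g (M x)‖ +
        5 * ‖shear g (M x - modelCell E h x)‖ := (norm_add_le _ _).trans
          (add_le_add (norm_modelCoord_sub_le _ _ _ _) (norm_modelCoord_le hE hE' hh hh' hs0 _))
    _ ≤ ‖modelCoord E h' (1, 0) - modelCoord E h (1, 0)‖ * ((1 + G) * ((30 + D) * ‖x‖)) +
        5 * ((1 + G) * (δ * ‖x‖)) := by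
      gcongr
      · exact (norm_shear_le hg _).trans (by gcongr)
      · exact (norm_shear_le hg _).trans (by gcongr; exact hM x)
    _ = (1 + G) * (‖modelCoord E h' (1, 0) - modelCoord E h (1, 0)‖ * (30 + D) + 5 * δ) *
        ‖x‖ := by ring
    _ ≤ (1 + G) * (‖modelCoord E h' (1, 0) - modelCoord E h (1, 0)‖ * (30 + D) + 5 * δ) *
        (3 / σ * ‖modelCoord E h x‖) := by gcongr
    _ = _ := by ring

end Bounds

end DeltaComb

/-! ### Summability of the errors and the states at the nodes. -/

namespace DeltaComb

open Filter Topology MeasureTheory ProbabilityTheory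

theorem summable_abs_sub_of_antitone {h : ℕ → ℝ} (hh : Antitone h) (h0 : ∀ n, 0 ≤ h n) :
    Summable fun n => |h (n + 1) - h n| := by
  refine summable_of_sum_range_le (c := h 0) (fun n => abs_nonneg _) fun n => ?_
  have : ∀ i, |h (i + 1) - h i| = h i - h (i + 1) := fun i => by
    rw [abs_of_nonpos (by linarith [hh (Nat.le_succ i)])]; ring
  simp only [this, Finset.sum_range_sub']
  linarith [h0 n]

theorem contDiff_modelCos (E : ℝ) : ContDiff ℝ 1 (modelCos E) := by
  unfold modelCos
  fun_prop

theorem continuous_modelSin (E : ℝ) : Continuous (modelSin E) := by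
  unfold modelSin
  have := (contDiff_modelCos E).continuous
  fun_prop

/-- `modelSin` is C¹ near 0 as the square root of a quantity that is positive there. -/
theorem exists_lipschitzOnWith_modelCoord {E : ℝ} (hE : 0 < modelSin E 0) :
    ∃ K, ∃ t ∈ 𝓝 (0 : ℝ), LipschitzOnWith K (fun h => modelCoord E h (1, 0)) t := by
  have hc := contDiff_modelCos E
  have h0 : 1 - modelCos E 0 ^ 2 ≠ 0 := (Real.sqrt_pos.1 hE).ne'
  have hs : ContDiffAt ℝ 1 (modelSin E) 0 :=
    ContDiffAt.sqrt (contDiffAt_const.sub (hc.contDiffAt.pow 2)) h0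
  have h1 : ContDiffAt ℝ 1 (fun h : ℝ => modelSin E h / (1 + 2 * h)) 0 :=
    hs.div (by fun_prop) (by norm_num)
  have h2 : ContDiffAt ℝ 1 (fun h : ℝ => -((5 / 3 + 2 / 3 * h) * E) / 2) 0 := by fun_prop
  refine ContDiffAt.exists_lipschitzOnWith (𝕂 := ℝ) ?_
  have e : (fun h => modelCoord E h (1, 0)) = fun h : ℝ =>
      (((-((5 / 3 + 2 / 3 * h) * E) / 2 : ℝ) : ℂ) +
        ((modelSin E h / (1 + 2 * h) : ℝ) : ℂ) * Complex.I) := by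
    ext h
    simp only [modelCoord_apply, one_mul, add_zero, Complex.mk_eq_add_mul_I]
  rw [e]
  exact (Complex.ofRealCLM.contDiff.contDiffAt.comp 0 h2).add
    ((Complex.ofRealCLM.contDiff.contDiffAt.comp 0 h1).mul contDiffAt_const)

/-- Square roots of the spacings, truncated to the range where `modelCoord` is controlled. -/
theorem exists_truncated_sqrt {E : ℝ} (hE : 0 < modelSin E 0) {a : ℕ → ℝ} (ha : Antitone a)
    (hs : Summable a) : ∃ h : ℕ → ℝ, (∀ n, 0 ≤ h n) ∧ (∀ n, h n ≤ 1) ∧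
      Tendsto h atTop (𝓝 0) ∧ (∀ᶠ n in atTop, h n = √(a n)) ∧
      (∀ n, modelSin E 0 / 2 ≤ modelSin E (h n)) ∧
      Summable fun n => ‖modelCoord E (h (n + 1)) (1, 0) - modelCoord E (h n) (1, 0)‖ := by
  obtain ⟨K, t, ht, hK⟩ := exists_lipschitzOnWith_modelCoord hE
  have h1 : ∀ᶠ h in 𝓝 (0 : ℝ), modelSin E 0 / 2 ≤ modelSin E h :=
    (continuous_modelSin E).continuousAt.eventually (le_mem_nhds (by linarith))
  obtain ⟨r, hr, hrt⟩ := Metric.eventually_nhds_iff.1 (h1.and ht)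
  -- Cutting √(a n) off at m preserves monotonicity, hence summable variation, and changes only
  -- finitely many cells.
  set m := min (r / 2) 1 with hm
  have hm0 : 0 < m := by positivity
  set h : ℕ → ℝ := fun n => min √(a n) m with hh
  have hn0 : ∀ n, 0 ≤ h n := fun n => le_min (Real.sqrt_nonneg _) hm0.le
  have hnt : ∀ n, modelSin E 0 / 2 ≤ modelSin E (h n) ∧ h n ∈ t := fun n => by
    refine hrt ?_
    rw [Real.dist_eq, sub_zero, abs_of_nonneg (hn0 n)]
    exact (min_le_right _ _).trans_lt ((min_le_left _ _).trans_lt (by linarith))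
  have hlim : Tendsto (fun n => √(a n)) atTop (𝓝 0) := by
    simpa using hs.tendsto_atTop_zero.sqrt
  have hev : ∀ᶠ n in atTop, h n = √(a n) := by
    filter_upwards [hlim.eventually (ge_mem_nhds hm0)] with n hn using min_eq_left hn
  have hanti : Antitone h := fun i j hij => min_le_min_right _ (Real.sqrt_le_sqrt (ha hij))
  refine ⟨h, hn0, fun n => (min_le_right _ _).trans (min_le_right _ _),
    hlim.congr' (hev.mono fun n hn => hn.symm), hev, fun n => (hnt n).1, ?_⟩
  refine Summable.of_nonneg_of_le (fun n => norm_nonneg _) (fun n => ?_)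
    ((summable_abs_sub_of_antitone hanti hn0).mul_left (K : ℝ))
  have := hK.dist_le_mul _ (hnt (n + 1)).2 _ (hnt n).2
  rwa [dist_eq_norm, Real.dist_eq] at this

/-- The values of a solution at the nodes of the comb. -/
noncomputable def cellState (k : ℝ) (a g : ℕ → ℝ) (x : ℝ × ℝ) : ℕ → ℝ × ℝ
  | 0 => x
  | n + 1 => shear (g n) (cellPartial k (a n) 8 (cellState k a g x n))

theorem cellState_zero (k : ℝ) (a g : ℕ → ℝ) (x : ℝ × ℝ) : cellState k a g x 0 = x := by
  rw [cellState]

theorem cellState_succ (k : ℝ) (a g : ℕ → ℝ) (x : ℝ × ℝ) (n : ℕ) :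
    cellState k a g x (n + 1) = shear (g n) (cellPartial k (a n) 8 (cellState k a g x n)) := by
  rw [cellState]

theorem sympl_cellState {k : ℝ} (hk : k ≠ 0) (a g : ℕ → ℝ) (x y : ℝ × ℝ) (n : ℕ) :
    sympl (cellState k a g x n) (cellState k a g y n) = sympl x y := by
  induction n with
  | zero => simp only [cellState_zero]
  | succ n ih => rw [cellState_succ, cellState_succ, sympl_shear, sympl_cellPartial hk, ih]

/-- Pair x with its rotation by a right angle: the conserved symplectic product is x₁² + x₂². -/
theorem cellState_ne_zero {k : ℝ} (hk : k ≠ 0) (a g : ℕ → ℝ) {x : ℝ × ℝ} (hx : x ≠ 0) (n : ℕ) :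
    cellState k a g x n ≠ 0 := fun h => by
  have h1 := sympl_cellState hk a g x (-x.2, x.1) n
  rw [h] at h1
  simp only [sympl, Prod.fst_zero, Prod.snd_zero, zero_mul, sub_zero] at h1
  apply hx
  ext
  · simp only [Prod.fst_zero]; nlinarith [sq_nonneg x.1, sq_nonneg x.2]
  · simp only [Prod.snd_zero]; nlinarith [sq_nonneg x.1, sq_nonneg x.2]

theorem cellState_add_smul (k : ℝ) (a g : ℕ → ℝ) (x y : ℝ × ℝ) (r s : ℝ) (n : ℕ) :
    cellState k a g (r • x + s • y) n =
      r • cellState k a g x n + s • cellState k a g y n := by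
  induction n with
  | zero => simp only [cellState_zero]
  | succ n ih => simp only [cellState_succ, ih, map_add, map_smul]

/-- The state at node n involves g 0, …, g (n - 1) only, which is the predictability required by the
martingale arguments. -/
theorem measurable_cellState {Ω : Type*} (k : ℝ) (a : ℕ → ℝ) (g : ℕ → Ω → ℝ) (x : ℝ × ℝ)
    (n : ℕ) : Measurable[past g n] fun ω => cellState k a (fun i => g i ω) x n := by
  induction n with
  | zero =>
    simp only [cellState_zero]
    exact measurable_const
  | succ n ih =>
    have h1 : Measurable[past g (n + 1)] fun ω => cellState k a (fun i => g i ω) x n :=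
      ih.mono (past_mono g (Nat.le_succ n)) le_rfl
    have h2 : Measurable[past g (n + 1)] (g n) := measurable_past g (Nat.lt_succ_self n)
    have h3 : Measurable fun y => cellPartial k (a n) 8 y :=
      (cellPartial k (a n) 8).continuous_of_finiteDimensional.measurable
    have h4 := h3.comp h1
    simp only [cellState_succ, shear_apply]
    exact (measurable_fst.comp h4).prodMk
      ((measurable_snd.comp h4).add (h2.mul (measurable_fst.comp h4)))

/-- Operator norms provide a finite error for each cell; only the tail has to be of order aₙ, so the
finitely many cells where h differs from √(a n) do no harm. -/
theorem exists_summable_cell_error {k : ℝ} (hk : k ≠ 0) {a h : ℕ → ℝ} (ha : ∀ n, 0 < a n)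
    (hs : Summable a) (hh : ∀ᶠ n in atTop, h n = √(a n)) :
    ∃ δ : ℕ → ℝ, (∀ n, 0 ≤ δ n) ∧ Summable δ ∧
      ∀ n x, ‖cellPartial k (a n) 8 x - modelCell (k ^ 2) (h n) x‖ ≤ δ n * ‖x‖ := by
  obtain ⟨C, hC, hev⟩ := exists_cell_bounds hk
  set L := fun n => LinearMap.toContinuousLinearMap
    (cellPartial k (a n) 8 - modelCell (k ^ 2) (h n)) with hL
  refine ⟨fun n => ‖L n‖, fun n => norm_nonneg _, ?_, fun n x => (L n).le_opNorm x⟩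
  have hlim : Tendsto (fun n => √(a n)) atTop (𝓝[>] 0) := by
    refine tendsto_nhdsWithin_iff.2 ⟨by simpa using hs.tendsto_atTop_zero.sqrt, ?_⟩
    exact Eventually.of_forall fun n => Real.sqrt_pos.2 (ha n)
  refine Summable.of_norm_bounded_eventually_nat (hs.mul_left C) ?_
  filter_upwards [hlim.eventually hev, hh] with n h1 h2
  rw [norm_norm]
  refine ContinuousLinearMap.opNorm_le_bound _ (mul_nonneg hC.le (ha n).le) fun x => ?_
  have h3 := (h1 x).2.2.2
  rw [Real.sq_sqrt (ha n).le, ← h2] at h3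
  exact h3

/-- Almost surely there is an initial vector for which the solution decays like `n ^ (-β)`,
while the solution with initial vector `(1, 0)` grows like `n ^ β`. -/
theorem ae_exists_decaying_cellState {Ω : Type*} [MeasurableSpace Ω] {ν : Measure Ω}
    [IsProbabilityMeasure ν] {g : ℕ → Ω → ℝ} {lam : ℝ} (hg : IsDecayingNoise ν g lam)
    (hlam : 0 < lam) {a : ℕ → ℝ} (ha : ∀ n, 0 < a n) (ha' : Antitone a) (hs : Summable a)
    {φ : ℝ} (hφ : φ ∈ Set.Ioo 0 Real.pi) (hφ₂ : φ ≠ Real.pi / 2) {k : ℝ} (hk : k ≠ 0)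
    (hE : Real.cos φ = 1 - 5 / 6 * k ^ 2) :
    ∀ᵐ ω ∂ν, ∃ c : ℝ,
      Tendsto (fun n : ℕ => Real.log ‖cellState k a (fun i => g i ω) (1, 0) n‖ / Real.log n)
        atTop (𝓝 (lam ^ 2 / (8 * Real.sin φ ^ 2))) ∧
      Tendsto (fun n : ℕ => Real.log ‖cellState k a (fun i => g i ω) (-c, 1) n‖ / Real.log n)
        atTop (𝓝 (-(lam ^ 2 / (8 * Real.sin φ ^ 2)))) := by
  have hsin : 0 < Real.sin φ := Real.sin_pos_of_pos_of_lt_pi hφ.1 hφ.2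
  have hsc := Real.sin_sq_add_cos_sq φ
  have hE0 : 0 < k ^ 2 := by positivity
  have hE1 : k ^ 2 < 12 / 5 := by nlinarith
  have hc0 : modelCos (k ^ 2) 0 = Real.cos φ := by rw [modelCos, hE]; ring
  have hs0 : modelSin (k ^ 2) 0 = Real.sin φ := by
    rw [modelSin, hc0, ← hsc, add_sub_cancel_right, Real.sqrt_sq hsin.le]
  obtain ⟨h, h0, h1, hlim, hev, hσ, hsum⟩ :=
    exists_truncated_sqrt (E := k ^ 2) (hs0 ▸ hsin) ha' hs
  rw [hs0] at hσ
  set σ := Real.sin φ / 2 with hσdef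
  have hσ0 : 0 < σ := by positivity
  have hsn : ∀ n, 0 < modelSin (k ^ 2) (h n) := fun n => hσ0.trans_le (hσ n)
  have hsn1 : ∀ n, modelSin (k ^ 2) (h n) ≤ 1 := fun n => by
    nlinarith [modelCos_sq_add_modelSin_sq (hsn n), sq_nonneg (modelCos (k ^ 2) (h n))]
  obtain ⟨δ, hδ0, hδs, hδ⟩ := exists_summable_cell_error hk ha hs hev
  obtain ⟨D, hD⟩ := exists_abs_le_of_tendsto hδs.tendsto_atTop_zero
  obtain ⟨G, hG⟩ := hg.exists_abs_le
  set ℓ := fun n => modelCoord (k ^ 2) (h n) with hℓ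
  set X := fun (x : ℝ × ℝ) n ω => cellState k a (fun i => g i ω) x n with hX
  have hshear : IsRandomShear g (fun n => modelPhase (k ^ 2) (h n))
      (fun n => (1 + 2 * h n) / modelSin (k ^ 2) (h n))
      (fun n => 3 / σ * (1 + G) * (‖ℓ (n + 1) (1, 0) - ℓ n (1, 0)‖ * (30 + D) + 5 * δ n))
      (fun n => -(modelSin (k ^ 2) (h n) / (1 + 2 * h n)))
      (fun n ω => ℓ (n + 1) ∘ₗ shear (g n ω) ∘ₗ cellPartial k (a n) 8 ∘ₗ
        modelCoordInv (k ^ 2) (h n))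
      (fun n ω => ℓ n (X (1, 0) n ω)) (fun n ω => ℓ n (X (0, 1) n ω)) := by
    refine ⟨fun n => norm_modelPhase (hsn n), fun n ω p => ?_, fun n ω => ?_, fun n ω => ?_,
      fun n ω => ?_, fun n => ?_⟩
    · exact norm_modelCoord_step_le hE0 hE1 (h0 n) (h1 n) hσ0 (hσ n) (hδ n) (hδ0 n)
        ((le_abs_self _).trans (hD n)) (hG n ω) p
    · simp only [LinearMap.comp_apply, hℓ, modelCoordInv_modelCoord (h0 n) (hsn n).ne', hX,
        cellState_succ]
    · simp only [LinearMap.comp_apply, hℓ, modelCoordInv_modelCoord (h0 n) (hsn n).ne', hX,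
        cellState_succ]
    · simp only [hℓ, wronskian_modelCoord, hX, sympl_cellState hk]
      simp [sympl]
    · exact ((ℓ n).continuous_of_finiteDimensional.measurable).comp
        (measurable_cellState k a g (1, 0) n)
  have hcc : Continuous fun x => modelPhase (k ^ 2) x := by
    have e : (fun x => modelPhase (k ^ 2) x) = fun x =>
        (modelCos (k ^ 2) x : ℂ) + (modelSin (k ^ 2) x : ℂ) * Complex.I := by
      ext x
      apply Complex.ext <;> simp [modelPhase]
    rw [e]
    have := (contDiff_modelCos (k ^ 2)).continuous
    have := continuous_modelSin (k ^ 2)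
    fun_prop
  have hz : Tendsto (fun n => modelPhase (k ^ 2) (h n)) atTop
      (𝓝 (modelPhase (k ^ 2) 0)) := (hcc.tendsto 0).comp hlim
  have hz0 : modelPhase (k ^ 2) 0 = ⟨Real.cos φ, Real.sin φ⟩ := by rw [modelPhase, hc0, hs0]
  have hcos : Real.cos φ ≠ 0 := by
    intro h
    apply hφ₂
    exact Real.injOn_cos ⟨hφ.1.le, hφ.2.le⟩ ⟨by positivity, by linarith [Real.pi_pos]⟩
      (by rw [h, Real.cos_pi_div_two])
  have hsq : (⟨Real.cos φ, Real.sin φ⟩ : ℂ) ^ 2 =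
      ⟨Real.cos φ ^ 2 - Real.sin φ ^ 2, 2 * Real.sin φ * Real.cos φ⟩ := by
    rw [sq]
    apply Complex.ext
    · simp only [Complex.mul_re]; ring
    · simp only [Complex.mul_im]; ring
  -- The imaginary part of e^{2iφ}; since it is nonzero, e^{2iφ} is neither 1 nor -1, which excludes
  -- both resonances.
  have him : 2 * Real.sin φ * Real.cos φ ≠ 0 := by positivity
  have hz2 : modelPhase (k ^ 2) 0 ^ 2 ≠ 1 := by
    rw [hz0, hsq]
    intro h
    exact him (by simpa using congrArg Complex.im h)
  have hz4 : modelPhase (k ^ 2) 0 ^ 4 ≠ 1 := by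
    intro h
    have h5 : (modelPhase (k ^ 2) 0 ^ 2 - 1) * (modelPhase (k ^ 2) 0 ^ 2 + 1) = 0 := by
      linear_combination h
    rcases mul_eq_zero.1 h5 with h6 | h6
    · exact hz2 (sub_eq_zero.1 h6)
    · rw [hz0, hsq] at h6
      exact him (by simpa using congrArg Complex.im h6)
  have hkl : Tendsto (fun n => (1 + 2 * h n) / modelSin (k ^ 2) (h n)) atTop
      (𝓝 (1 / Real.sin φ)) := by
    have h5 := ((continuous_modelSin (k ^ 2)).tendsto 0).comp hlim
    have h6 := ((hlim.const_mul 2).const_add 1).div h5 (hs0 ▸ hsin.ne')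
    rw [hs0] at h6
    simpa [Function.comp_def, Pi.div_def] using h6
  have hes : Summable fun n =>
      3 / σ * (1 + G) * (‖ℓ (n + 1) (1, 0) - ℓ n (1, 0)‖ * (30 + D) + 5 * δ n) :=
    ((hsum.mul_right _).add (hδs.mul_left 5)).mul_left _
  have hWb : ∀ n, |-(modelSin (k ^ 2) (h n) / (1 + 2 * h n))| =
      modelSin (k ^ 2) (h n) / (1 + 2 * h n) := fun n => by
    have := h0 n
    have := hsn n
    rw [abs_neg, abs_of_nonneg (by positivity)]
  have key := hshear.ae_exists_decaying hg hz hz2 hz4 hkl hes (w₁ := σ / 3) (w₂ := 1)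
    (β := lam ^ 2 / (8 * Real.sin φ ^ 2)) (by positivity)
    (fun n => by
      have := h0 n
      rw [hWb]
      exact div_le_div₀ (hsn n).le (hσ n) (by positivity) (by linarith [h1 n]))
    (fun n => by
      have := h0 n
      rw [hWb, div_le_one (by positivity)]
      linarith [hsn1 n])
    (by positivity) (by field_simp)
  filter_upwards [key] with ω hω
  obtain ⟨hp, c, hq⟩ := hω
  -- The coordinates and their inverses are bounded uniformly in n, so they do not affect
  -- logarithmic rates.
  have comp : ∀ {x : ℝ × ℝ} {β : ℝ}, x ≠ 0 →
      Tendsto (fun n : ℕ => Real.log ‖ℓ n (X x n ω)‖ / Real.log n) atTop (𝓝 β) →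
      Tendsto (fun n : ℕ => Real.log ‖X x n ω‖ / Real.log n) atTop (𝓝 β) := by
    intro x β hx hl
    have hxn : ∀ n, X x n ω ≠ 0 := cellState_ne_zero hk a _ hx
    have hin : ∀ n, modelCoordInv (k ^ 2) (h n) (ℓ n (X x n ω)) = X x n ω := fun n =>
      modelCoordInv_modelCoord (h0 n) (hsn n).ne' _
    have l1 : ∀ n, ‖X x n ω‖ ≤ 3 / σ * ‖ℓ n (X x n ω)‖ := fun n => by
      have := norm_modelCoordInv_le (h0 n) (h1 n) hσ0 (hσ n) (ℓ n (X x n ω))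
      rwa [hin] at this
    refine tendsto_log_div_log_of_le_mul (c := 1 / 5) (C := 3 / σ) (fun n => ?_)
      (fun n => norm_pos_iff.2 (hxn n)) (by norm_num) (fun n => ?_) l1 hl
    · refine norm_pos_iff.2 fun h6 => hxn n ?_
      rw [← hin, h6, map_zero]
    · have := norm_modelCoord_le hE0 hE1 (h0 n) (h1 n) (hsn n) (X x n ω)
      change ‖ℓ n (X x n ω)‖ ≤ _ at this
      linarith
  refine ⟨c, comp (by simp) hp, comp (by simp) (hq.congr fun n => ?_)⟩
  have : X (-c, 1) n ω = (1 : ℝ) • X (0, 1) n ω + (-c) • X (1, 0) n ω := by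
    simp only [hX, ← cellState_add_smul]
    congr 1
    ext <;> simp
  rw [this, map_add, map_smul, map_smul, one_smul, Complex.real_smul]
  push_cast
  rw [neg_mul, ← sub_eq_add_neg]

end DeltaComb

/-! ### Subordinacy from cell integrals; solutions read off at the nodes. -/

namespace DeltaComb

open Set Filter Topology

/-- If the integrals of `f` over the cells of a partition tend to zero and those of `F` over pairs
of consecutive cells are bounded below, then `f` is negligible with respect to `F`. -/
theorem tendsto_integral_div_integral {b : ℝ} {t : ℕ → ℝ} (ht : StrictMono t) (ht0 : t 0 = 0)
    (htb : Tendsto t atTop (𝓝 b)) {f F : ℝ → ℝ} (hf : ContinuousOn f (Ico 0 b))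
    (hF : ContinuousOn F (Ico 0 b)) (hf0 : ∀ x, 0 ≤ f x) (hF0 : ∀ x, 0 ≤ F x)
    (h1 : Tendsto (fun n => ∫ x in t n..t (n + 1), f x) atTop (𝓝 0)) {c : ℝ} (hc : 0 < c)
    (h2 : ∀ᶠ n in atTop, c ≤ (∫ x in t n..t (n + 1), F x) + ∫ x in t (n + 1)..t (n + 2), F x) :
    Tendsto (fun L => (∫ x in (0 : ℝ)..L, f x) / ∫ x in (0 : ℝ)..L, F x) (𝓝[<] b) (𝓝 0) := by
  have htlt := lt_of_strictMono_of_tendsto ht htb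
  have htn : ∀ n, 0 ≤ t n := fun n => ht0 ▸ ht.monotone (Nat.zero_le n)
  have hint : ∀ {G : ℝ → ℝ}, ContinuousOn G (Ico 0 b) → ∀ {x y : ℝ}, 0 ≤ x → x ≤ y → y < b →
      IntervalIntegrable G MeasureTheory.volume x y := fun hG x y hx hxy hy =>
    (hG.mono fun z hz => by
      rw [uIcc_of_le hxy] at hz; exact ⟨hx.trans hz.1, hz.2.trans_lt hy⟩).intervalIntegrable
  have hsum : ∀ {G : ℝ → ℝ}, ContinuousOn G (Ico 0 b) → ∀ n,
      ∑ i ∈ Finset.range n, ∫ x in t i..t (i + 1), G x = ∫ x in (0 : ℝ)..t n, G x := by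
    intro G hG n
    rw [intervalIntegral.sum_integral_adjacent_intervals fun i _ =>
      hint hG (htn i) (ht (Nat.lt_succ_self i)).le (htlt _), ht0]
  have hmono : ∀ {G : ℝ → ℝ}, ContinuousOn G (Ico 0 b) → (∀ x, 0 ≤ G x) → ∀ {x y : ℝ}, 0 ≤ x →
      x ≤ y → y < b → ∫ z in (0 : ℝ)..x, G z ≤ ∫ z in (0 : ℝ)..y, G z := by
    intro G hG hG0 x y hx hxy hy
    rw [← intervalIntegral.integral_add_adjacent_intervals
      (hint hG le_rfl hx (hxy.trans_lt hy)) (hint hG hx hxy hy)]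
    linarith [intervalIntegral.integral_nonneg (μ := MeasureTheory.volume) hxy fun z _ => hG0 z]
  set U : ℕ → ℝ := fun n => ∫ x in (0 : ℝ)..t n, f x with hU
  set V : ℕ → ℝ := fun n => ∫ x in (0 : ℝ)..t n, F x with hV
  have hU1 : Tendsto (fun n : ℕ => (n : ℝ)⁻¹ * U n) atTop (𝓝 0) := by
    have := h1.cesaro
    simpa only [hsum hf] using this
  obtain ⟨N, hN⟩ := eventually_atTop.1 h2
  -- In the sum over consecutive pairs each cell is counted at most twice.
  have hV1 : ∀ m, c * (m - N) ≤ 2 * V (m + 1) := by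
    intro m
    have e1 : ∑ i ∈ Finset.range m,
        ((∫ x in t i..t (i + 1), F x) + ∫ x in t (i + 1)..t (i + 2), F x) ≤ 2 * V (m + 1) := by
      rw [Finset.sum_add_distrib, hsum hF]
      have e2 : ∑ i ∈ Finset.range m, ∫ x in t (i + 1)..t (i + 2), F x ≤ V (m + 1) := by
        rw [hV]
        simp only
        rw [← hsum hF, Finset.sum_range_succ']
        linarith [intervalIntegral.integral_nonneg (μ := MeasureTheory.volume)
          (ht (Nat.lt_succ_self 0)).le fun z (_ : z ∈ Icc (t 0) (t (0 + 1))) => hF0 z]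
      have e3 := hmono hF hF0 (htn m) (ht (Nat.lt_succ_self m)).le (htlt (m + 1))
      linarith
    refine le_trans ?_ e1
    clear e1
    have e0 : ∀ i, 0 ≤ (∫ x in t i..t (i + 1), F x) + ∫ x in t (i + 1)..t (i + 2), F x :=
      fun i => add_nonneg
        (intervalIntegral.integral_nonneg (ht (Nat.lt_succ_self i)).le fun z _ => hF0 z)
        (intervalIntegral.integral_nonneg (ht (Nat.lt_succ_self (i + 1))).le fun z _ => hF0 z)
    induction m with
    | zero =>
      simp only [Nat.cast_zero, Finset.range_zero, Finset.sum_empty]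
      nlinarith [N.cast_nonneg (α := ℝ)]
    | succ m ih =>
      rw [Finset.sum_range_succ]
      rcases le_or_gt N m with h | h
      · have := hN m h
        push_cast
        linarith [ih]
      · have h5 : ((m + 1 : ℕ) : ℝ) ≤ N := by exact_mod_cast h
        have h6 := Finset.sum_nonneg fun i (_ : i ∈ Finset.range m) => e0 i
        nlinarith [e0 m]
  rw [Metric.tendsto_nhds]
  intro ε hε
  have h5 : ∀ᶠ n : ℕ in atTop, (n : ℝ)⁻¹ * U n < ε * c / 16 := by
    have h6 := hU1.eventually (gt_mem_nhds (show 0 < ε * c / 16 by positivity))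
    exact h6
  obtain ⟨M, hM⟩ := eventually_atTop.1 (h5.and (eventually_ge_atTop (2 * N + 4)))
  have hev : ∀ᶠ L in 𝓝[<] b, L ∈ Ioo (t (M + 2)) b := Ioo_mem_nhdsLT (htlt _)
  filter_upwards [hev] with L hL
  obtain ⟨j, hj⟩ := exists_mem_Ico_of_tendsto htb
    ⟨(ht.monotone (Nat.zero_le _)).trans hL.1.le, hL.2⟩
  have hMj : M + 2 < j + 1 := ht.lt_iff_lt.1 (hL.1.trans hj.2)
  obtain ⟨m, rfl⟩ : ∃ m, j = m + 1 := ⟨j - 1, by omega⟩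
  have hL0 : 0 ≤ L := (htn _).trans hj.1
  -- L lies in the cell from t (m + 1) to t (m + 2): round up for f and down for F. The constants
  -- are such that m ≥ 2N gives V (m + 1) ≥ cm/4, and m + 2 ≤ 4m absorbs the extra cells.
  have k1 : ∫ x in (0 : ℝ)..L, f x ≤ U (m + 2) := hmono hf hf0 hL0 hj.2.le (htlt _)
  have k2 : V (m + 1) ≤ ∫ x in (0 : ℝ)..L, F x := hmono hF hF0 (htn _) hj.1 hL.2
  have k3 : 0 ≤ ∫ x in (0 : ℝ)..L, f x := intervalIntegral.integral_nonneg hL0 fun x _ => hf0 x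
  obtain ⟨k4, k5⟩ := hM (m + 2) (by omega)
  have hm2 : (0 : ℝ) < ((m + 2 : ℕ) : ℝ) := by positivity
  rw [inv_mul_lt_iff₀ hm2] at k4
  have k6 := hV1 m
  obtain ⟨_, k7⟩ := hM M le_rfl
  have k8 : (2 * N + 4 : ℝ) ≤ m := by
    have : 2 * N + 4 ≤ m := by omega
    exact_mod_cast this
  push_cast at k4
  have k9 : c * m / 4 ≤ V (m + 1) := by nlinarith
  have hVp : 0 < ∫ x in (0 : ℝ)..L, F x := by
    have : 0 < c * m / 4 := by
      have : (0 : ℝ) < m := by linarith [N.cast_nonneg (α := ℝ)]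
      positivity
    linarith
  rw [Real.dist_eq, sub_zero, abs_of_nonneg (by positivity), div_lt_iff₀ hVp]
  have k10 : ((m : ℝ) + 2) * (ε * c / 16) ≤ ε * (c * m / 4) := by
    have : (m : ℝ) + 2 ≤ 4 * m := by linarith [N.cast_nonneg (α := ℝ)]
    have := mul_le_mul_of_nonneg_left this (by positivity : 0 ≤ ε * c / 16)
    linarith
  calc _ ≤ U (m + 2) := k1
    _ < _ := k4
    _ ≤ _ := k10
    _ ≤ ε * V (m + 1) := by gcongr
    _ ≤ _ := by gcongr

section Nodes

variable {a g : ℕ → ℝ} {k : ℝ} {v v' : ℝ → ℝ}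

/-- This separates the random delta, located on the last point of a cell, from the deterministic
cell matrix. -/
theorem transfer_add (k s y g : ℝ) (x : ℝ × ℝ) :
    transfer k s (y + g) x = shear g (transfer k s y x) := by
  rw [shear_apply, transfer_apply, transfer_apply]
  ext <;> simp only
  ring

theorem divModEquiv_cell (n : ℕ) {i : ℕ} (hi : i < 8) :
    Nat.divModEquiv 8 (8 * n + i) = (n, Fin.ofNat 8 i) := by
  have h1 : (8 * n + i) / 8 = n := by omega
  have h2 : (8 * n + i) % 8 = i % 8 := by omega
  ext
  · exact h1
  · exact h2

theorem IsCombSolution.apply_flatNode (h : IsCombSolution a g (k ^ 2) v v') (hk : k ≠ 0)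
    (ha : ∀ n, 0 < a n) (hs : Summable a) (n : ℕ) {i : ℕ} (hi : i < 8) :
    (v (flatNode a (8 * n + i)), v' (flatNode a (8 * n + i))) =
      cellPartial k (a n) i (v (combNode a n), v' (combNode a n)) := by
  induction i with
  | zero => simp only [add_zero, flatNode_mul, cellPartial_zero, LinearMap.id_apply]
  | succ i ih =>
    have h1 := (isCombSolution_iff.1 h).apply_succ hk (flatNode_strictMono ha) (flatNode_zero a)
      (tendsto_flatNode ha hs) (8 * n + i)
    rw [flatNode_succ_sub, ih (by omega), divModEquiv_cell n (by omega), combStrength, if_neg,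
      add_zero, show (8 * n + i) / 8 = n by omega] at h1
    · rw [cellPartial_succ, LinearMap.comp_apply, ← h1, add_assoc]
    · simp only
      rw [Fin.ext_iff]
      simp only [Fin.ofNat]
      have : (7 : Fin 8).val = 7 := rfl
      omega

theorem IsCombSolution.apply_combNode (h : IsCombSolution a g (k ^ 2) v v') (hk : k ≠ 0)
    (ha : ∀ n, 0 < a n) (hs : Summable a) (n : ℕ) :
    (v (combNode a n), v' (combNode a n)) = cellState k a g (v 0, v' 0) n := by
  induction n with
  | zero => simp [combNode, cellState_zero]
  | succ n ih =>
    have h1 := (isCombSolution_iff.1 h).apply_succ hk (flatNode_strictMono ha) (flatNode_zero a)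
      (tendsto_flatNode ha hs) (8 * n + 7)
    rw [flatNode_succ_sub, h.apply_flatNode hk ha hs n (by omega), ih,
      divModEquiv_cell n (by omega), combStrength, if_pos, transfer_add,
      show (8 * n + 7) / 8 = n by omega, show 8 * n + 7 + 1 = 8 * (n + 1) by ring,
      flatNode_mul] at h1
    · rw [h1, cellState_succ, cellPartial_succ k (a n) 7, LinearMap.comp_apply]
    · rfl

theorem IsCombSolution.eq_freeSol (h : IsCombSolution a g (k ^ 2) v v') (hk : k ≠ 0)
    (ha : ∀ n, 0 < a n) (hs : Summable a) (n : ℕ) {i : ℕ} (hi : i < 8) {x : ℝ}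
    (hx : x ∈ Ico (combNode a n + i * a n) (combNode a n + (i + 1 : ℕ) * a n)) :
    v x = freeSol k (combNode a n + i * a n)
      (cellPartial k (a n) i (cellState k a g (v 0, v' 0) n)).1
      (cellPartial k (a n) i (cellState k a g (v 0, v' 0) n)).2 x := by
  rw [← flatNode_cell a n (by omega : i ≤ 8), ← flatNode_cell a n (by omega : i + 1 ≤ 8)] at hx
  have h1 := ((isCombSolution_iff.1 h).eq_freeSol hk (flatNode_strictMono ha) (flatNode_zero a)
    (tendsto_flatNode ha hs) hx).1
  rw [← h.apply_combNode hk ha hs, ← h.apply_flatNode hk ha hs n hi, h1,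
    flatNode_cell a n (by omega : i ≤ 8)]

/-- A solution is determined by its initial values. -/
theorem IsCombSolution.eqOn {w w' : ℝ → ℝ} (h : IsCombSolution a g (k ^ 2) v v')
    (h' : IsCombSolution a g (k ^ 2) w w') (hk : k ≠ 0) (ha : ∀ n, 0 < a n) (hs : Summable a)
    {r : ℝ} (h0 : (w 0, w' 0) = r • (v 0, v' 0)) : ∀ x ∈ Ico 0 (combEnd a), w x = r * v x := by
  intro x hx
  obtain ⟨j, hj⟩ := exists_mem_Ico_of_tendsto (tendsto_flatNode ha hs)
    (x := x) (by rwa [flatNode_zero])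
  obtain ⟨n, i, hi, rfl⟩ : ∃ n i, i < 8 ∧ j = 8 * n + i :=
    ⟨j / 8, j % 8, by omega, by omega⟩
  rw [flatNode_cell a n (by omega : i ≤ 8), add_assoc,
    flatNode_cell a n (by omega : i + 1 ≤ 8)] at hj
  have hlin : cellState k a g (r • (v 0, v' 0)) n = r • cellState k a g (v 0, v' 0) n := by
    simpa using cellState_add_smul k a g (v 0, v' 0) 0 r 0 n
  rw [h.eq_freeSol hk ha hs n hi hj, h'.eq_freeSol hk ha hs n hi hj, h0, hlin, map_smul]
  simp only [freeSol, Prod.smul_fst, Prod.smul_snd, smul_eq_mul]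
  ring

end Nodes

end DeltaComb

/-! ### Integrals of squared solutions over cells. -/

namespace DeltaComb

open Set Filter Topology

theorem abs_sin_mul_div_le (k y : ℝ) : |Real.sin (k * y) / k| ≤ |y| := by
  rcases eq_or_ne k 0 with rfl | hk
  · simp
  rw [abs_div, div_le_iff₀ (abs_pos.2 hk), mul_comm, ← abs_mul]
  exact Real.abs_sin_le_abs

theorem abs_freeSol_le (k t α β x : ℝ) : |freeSol k t α β x| ≤ |α| + |β| * |x - t| := by
  rw [freeSol]
  refine (abs_add_le _ _).trans ?_
  rw [abs_mul, abs_mul]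
  exact add_le_add (mul_le_of_le_one_right (abs_nonneg _) (Real.abs_cos_le_one _))
    (mul_le_mul_of_nonneg_left (abs_sin_mul_div_le k _) (abs_nonneg _))

theorem abs_freeSol_sub_le (k t α β x : ℝ) :
    |freeSol k t α β x - α| ≤ |α| * ((k * (x - t)) ^ 2 / 2) + |β| * |x - t| := by
  have e : freeSol k t α β x - α =
      α * (Real.cos (k * (x - t)) - 1) + β * (Real.sin (k * (x - t)) / k) := by
    rw [freeSol]; ring
  rw [e]
  refine (abs_add_le _ _).trans ?_
  rw [abs_mul, abs_mul]
  refine add_le_add (mul_le_mul_of_nonneg_left ?_ (abs_nonneg _))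
    (mul_le_mul_of_nonneg_left (abs_sin_mul_div_le k _) (abs_nonneg _))
  rw [abs_of_nonpos (by linarith [Real.cos_le_one (k * (x - t))])]
  linarith [Real.one_sub_sq_div_two_le_cos (x := k * (x - t))]

/-- Bounds for the transfer matrices of a cell of spacing `h²`. -/
def HasCellBounds (k C h : ℝ) : Prop := ∀ x : ℝ × ℝ,
  (∀ i < 8, h * |(cellPartial k (h ^ 2) i x).1| ≤ C * ‖x‖ ∧
    h * |h ^ 2 * (cellPartial k (h ^ 2) i x).2| ≤ C * ‖x‖) ∧
  |(cellPartial k (h ^ 2) 2 x).1 - h⁻¹ * x.1| ≤ C * ‖x‖ ∧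
  |h ^ 2 * (cellPartial k (h ^ 2) 2 x).2| ≤ C * ‖x‖ ∧
  ‖cellPartial k (h ^ 2) 8 x - modelCell (k ^ 2) h x‖ ≤ C * h ^ 2 * ‖x‖

theorem exists_mem_piece {t s x : ℝ} (hs : 0 < s) (hx : x ∈ Ico t (t + 8 * s)) :
    ∃ i : ℕ, i < 8 ∧ x ∈ Ico (t + i * s) (t + (i + 1 : ℕ) * s) := by
  have h0 : 0 ≤ (x - t) / s := div_nonneg (by linarith [hx.1]) hs.le
  refine ⟨⌊(x - t) / s⌋₊, ?_, ?_, ?_⟩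
  · rw [Nat.floor_lt h0, div_lt_iff₀ hs]
    push_cast
    linarith [hx.2]
  · have := Nat.floor_le h0
    rw [le_div_iff₀ hs] at this
    linarith
  · have := Nat.lt_floor_add_one ((x - t) / s)
    rw [div_lt_iff₀ hs] at this
    push_cast
    linarith

section Cell

variable {a g : ℕ → ℝ} {k C : ℝ} {v v' : ℝ → ℝ}

theorem IsCombSolution.continuousOn_sq (h : IsCombSolution a g (k ^ 2) v v') :
    ContinuousOn (fun x => |v x| ^ 2) (Ico 0 (combEnd a)) := by
  have := h.continuousOn
  fun_prop

theorem combNode_strictMono (ha : ∀ n, 0 < a n) : StrictMono (combNode a) :=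
  strictMono_nat_of_lt_succ fun n => by
    rw [combNode_succ]
    linarith [ha n]

theorem IsCombSolution.intervalIntegrable_sq (h : IsCombSolution a g (k ^ 2) v v')
    (ha : ∀ n, 0 < a n) (hs : Summable a) {n : ℕ} {x y : ℝ} (hx : combNode a n ≤ x) (hxy : x ≤ y)
    (hy : y ≤ combNode a (n + 1)) :
    IntervalIntegrable (fun x => |v x| ^ 2) MeasureTheory.volume x y := by
  have h0 : 0 ≤ combNode a n := by
    have := (combNode_strictMono ha).monotone (Nat.zero_le n)
    simpa [combNode] using this
  have h1 := lt_of_strictMono_of_tendsto (combNode_strictMono ha) (tendsto_combNode hs) (n + 1)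
  refine (h.continuousOn_sq.mono fun z hz => ?_).intervalIntegrable
  rw [uIcc_of_le hxy] at hz
  exact ⟨h0.trans (hx.trans hz.1), (hz.2.trans hy).trans_lt h1⟩

/-- On the whole cell |v| ≤ 2C‖X‖/√aₙ, and the cell has length 8aₙ; the powers of aₙ cancel and
leave 8 · 4C². -/
theorem IsCombSolution.integral_cell_le (h : IsCombSolution a g (k ^ 2) v v') (hk : k ≠ 0)
    (ha : ∀ n, 0 < a n) (hs : Summable a) {n : ℕ} (hC : HasCellBounds k C √(a n)) :
    ∫ x in combNode a n..combNode a (n + 1), |v x| ^ 2 ≤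
      32 * C ^ 2 * ‖cellState k a g (v 0, v' 0) n‖ ^ 2 := by
  set X := cellState k a g (v 0, v' 0) n with hX
  set s := √(a n) with hsdef
  have hs0 : 0 < s := Real.sqrt_pos.2 (ha n)
  have hs2 : s ^ 2 = a n := Real.sq_sqrt (ha n).le
  have hle : combNode a n ≤ combNode a (n + 1) := (combNode_strictMono ha (Nat.lt_succ_self n)).le
  have key : ∀ x ∈ Ioo (combNode a n) (combNode a (n + 1)), |v x| ^ 2 ≤ 4 * C ^ 2 * ‖X‖ ^ 2 / a n := by
    intro x hx
    rw [combNode_succ] at hx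
    obtain ⟨i, hi, hxi⟩ := exists_mem_piece (ha n) ⟨hx.1.le, hx.2⟩
    have hv := h.eq_freeSol hk ha hs n hi hxi
    rw [← hX] at hv
    obtain ⟨b1, b2⟩ := (hC X).1 i hi
    rw [hs2] at b1 b2
    set P := cellPartial k (a n) i X
    have hxt : |x - (combNode a n + i * a n)| ≤ a n := by
      have h1 := hxi.1
      have h2 := hxi.2
      push_cast at h2
      rw [abs_of_nonneg (by linarith)]
      linarith
    have h3 : s * |v x| ≤ 2 * C * ‖X‖ := by
      rw [abs_mul, abs_of_pos (ha n)] at b2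
      calc s * |v x| ≤ s * (|P.1| + |P.2| * a n) := by
            rw [hv]
            gcongr
            exact (abs_freeSol_le _ _ _ _ _).trans (by gcongr)
        _ = s * |P.1| + s * (a n * |P.2|) := by ring
        _ ≤ _ := by linarith
    rw [le_div_iff₀ (ha n), ← hs2, ← mul_pow, mul_comm]
    calc (s * |v x|) ^ 2 ≤ (2 * C * ‖X‖) ^ 2 := by gcongr
      _ = _ := by ring
  refine (intervalIntegral.integral_mono_on_of_le_Ioo hle
    (h.intervalIntegrable_sq ha hs le_rfl hle le_rfl) intervalIntegrable_const key).trans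
    (le_of_eq ?_)
  have := (ha n).ne'
  rw [intervalIntegral.integral_const, combNode_succ, smul_eq_mul]
  field_simp
  ring

/-- Between the second and the third delta v is close to X₁/√aₙ, on an interval of length aₙ. The
deviation is at most C(2 + k²/2)‖X‖: one C from the state after two deltas, one from the slope and
k²/2 from the cosine. -/
theorem IsCombSolution.le_integral_cell (h : IsCombSolution a g (k ^ 2) v v') (hk : k ≠ 0)
    (ha : ∀ n, 0 < a n) (hs : Summable a) {n : ℕ} (hC : HasCellBounds k C √(a n))
    (ha1 : a n ≤ 1) :
    (cellState k a g (v 0, v' 0) n).1 ^ 2 / 2 -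
        (C * (2 + k ^ 2 / 2)) ^ 2 * a n * ‖cellState k a g (v 0, v' 0) n‖ ^ 2 ≤
      ∫ x in combNode a n..combNode a (n + 1), |v x| ^ 2 := by
  set X := cellState k a g (v 0, v' 0) n with hX
  set s := √(a n) with hsdef
  have hs0 : 0 < s := Real.sqrt_pos.2 (ha n)
  have hs1 : s ≤ 1 := Real.sqrt_le_one.2 ha1
  have hs2 : s ^ 2 = a n := Real.sq_sqrt (ha n).le
  have han := ha n
  set t := combNode a n + (2 : ℕ) * a n with ht
  have htt : combNode a n + (2 + 1 : ℕ) * a n = t + a n := by rw [ht]; push_cast; ring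
  have h1 : combNode a n ≤ t := by rw [ht]; push_cast; linarith
  have h2 : t + a n ≤ combNode a (n + 1) := by rw [ht, combNode_succ]; push_cast; linarith
  have key : ∀ x ∈ Ioo t (t + a n),
      X.1 ^ 2 / (2 * a n) - (C * (2 + k ^ 2 / 2)) ^ 2 * ‖X‖ ^ 2 ≤ |v x| ^ 2 := by
    intro x hx
    have hv := h.eq_freeSol hk ha hs n (i := 2) (x := x) (by norm_num)
      ⟨hx.1.le, by rw [htt]; exact hx.2⟩
    rw [← hX, ← ht] at hv
    obtain ⟨b1, b2, b3, -⟩ := hC X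
    have b1 := (b1 2 (by norm_num)).1
    rw [hs2] at b1 b2 b3
    set P := cellPartial k (a n) 2 X
    have hxt : |x - t| ≤ a n := by
      rw [abs_of_nonneg (by linarith [hx.1])]
      linarith [hx.2]
    rw [abs_mul, abs_of_pos han] at b3
    have hCX : 0 ≤ C * ‖X‖ := (abs_nonneg _).trans b2
    have h3 : |v x - s⁻¹ * X.1| ≤ C * (2 + k ^ 2 / 2) * ‖X‖ := by
      have h4 := abs_freeSol_sub_le k t P.1 P.2 x
      rw [← hv] at h4
      have h5 : |P.1| * ((k * (x - t)) ^ 2 / 2) ≤ C * ‖X‖ * (k ^ 2 / 2) := by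
        calc |P.1| * ((k * (x - t)) ^ 2 / 2) = |P.1| * |x - t| ^ 2 * (k ^ 2 / 2) := by
              rw [sq_abs]; ring
          _ ≤ |P.1| * (a n) ^ 2 * (k ^ 2 / 2) := by gcongr
          _ = s * |P.1| * s ^ 3 * (k ^ 2 / 2) := by rw [← hs2]; ring
          _ ≤ C * ‖X‖ * 1 * (k ^ 2 / 2) := by gcongr; exact pow_le_one₀ hs0.le hs1
          _ = _ := by ring
      have h6 : |P.2| * |x - t| ≤ C * ‖X‖ := by
        calc _ ≤ |P.2| * a n := by gcongr
          _ = a n * |P.2| := mul_comm _ _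
          _ ≤ _ := b3
      have h7 := abs_sub_le (v x) P.1 (s⁻¹ * X.1)
      linarith
    have h8 : (s⁻¹ * X.1) ^ 2 = X.1 ^ 2 / a n := by rw [mul_pow, inv_pow, hs2]; ring
    have h9 : (v x - s⁻¹ * X.1) ^ 2 ≤ (C * (2 + k ^ 2 / 2)) ^ 2 * ‖X‖ ^ 2 := by
      rw [← mul_pow, ← sq_abs]
      gcongr
    rw [sq_abs]
    have h10 : X.1 ^ 2 / (2 * a n) = (s⁻¹ * X.1) ^ 2 / 2 := by rw [h8]; ring
    rw [h10]
    -- With w = s⁻¹ X₁, this square being nonnegative says v² ≥ w²/2 - (v - w)².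
    nlinarith [sq_nonneg (2 * v x - s⁻¹ * X.1)]
  have hle : t ≤ t + a n := by linarith
  have h4 := intervalIntegral.integral_mono_on_of_le_Ioo hle intervalIntegrable_const
    (h.intervalIntegrable_sq ha hs h1 hle h2) key
  have h5 := intervalIntegral.integral_mono_interval h1 hle h2
    (Eventually.of_forall fun x => by positivity)
    (h.intervalIntegrable_sq ha hs le_rfl (h1.trans (hle.trans h2)) le_rfl)
  refine le_trans (le_of_eq ?_) (h4.trans h5)
  rw [intervalIntegral.integral_const, smul_eq_mul]
  field_simp
  ring

/-- One value can vanish at a node, but not two in a row: if |X₁| < ‖X‖/100, then |X₂| = ‖X‖, and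
the next value (1 + 2h)X₂, perturbed by at most 18/100 + 1/4 times ‖X‖, is at least ‖X‖/2. This is
why cells are taken in pairs. -/
theorem le_fst_sq_add_fst_sq {h : ℝ} {X Y : ℝ × ℝ} (hk : k ≠ 0) (hk2 : k ^ 2 < 12 / 5)
    (h0 : 0 ≤ h) (h1 : h ≤ 1) (hY : |Y.1 - (modelCell (k ^ 2) h X).1| ≤ 1 / 4 * ‖X‖) :
    1 / 10000 * ‖X‖ ^ 2 ≤ X.1 ^ 2 + Y.1 ^ 2 := by
  have hX0 := norm_nonneg X
  rcases le_or_gt (1 / 100 * ‖X‖) |X.1| with hc | hc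
  · have := mul_self_le_mul_self (by positivity) hc
    rw [abs_mul_abs_self] at this
    nlinarith [sq_nonneg Y.1]
  · have hX2 : |X.2| = ‖X‖ := by
      rw [Prod.norm_def, Real.norm_eq_abs, Real.norm_eq_abs] at *
      rcases le_total |X.1| |X.2| with h2 | h2
      · rw [max_eq_right h2]
      · rw [max_eq_left h2] at hc
        linarith [abs_nonneg X.1]
    have hk0 : 0 < k ^ 2 := by positivity
    have h3 : (5 / 3 + 2 / 3 * h) * k ^ 2 ≤ 6 := by nlinarith
    have h4 : (1 + 2 * h) * ((5 / 3 + 2 / 3 * h) * k ^ 2) ≤ 3 * 6 := by gcongr; linarith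
    have h4' : 0 ≤ (1 + 2 * h) * ((5 / 3 + 2 / 3 * h) * k ^ 2) := by positivity
    have e1 : |1 - (1 + 2 * h) * ((5 / 3 + 2 / 3 * h) * k ^ 2)| ≤ 18 := by
      rw [abs_le]; constructor <;> linarith
    have h5 : ‖X‖ ≤ |(1 + 2 * h) * X.2| := by
      rw [abs_mul, hX2, abs_of_nonneg (by positivity)]
      nlinarith
    have h6 : |(1 - (1 + 2 * h) * ((5 / 3 + 2 / 3 * h) * k ^ 2)) * X.1| ≤ 18 * (1 / 100 * ‖X‖) := by
      rw [abs_mul]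
      gcongr
    rw [modelCell_apply] at hY
    simp only at hY
    have h7 : (1 + 2 * h) * X.2 = Y.1 + -(Y.1 - ((1 - (1 + 2 * h) * ((5 / 3 + 2 / 3 * h) * k ^ 2)) *
        X.1 + (1 + 2 * h) * X.2)) + -((1 - (1 + 2 * h) * ((5 / 3 + 2 / 3 * h) * k ^ 2)) * X.1) := by
      ring
    rw [h7] at h5
    have h8 := h5.trans (abs_add_three _ _ _)
    rw [abs_neg, abs_neg] at h8
    have h9 : 1 / 2 * ‖X‖ ≤ |Y.1| := by linarith
    have := mul_self_le_mul_self (by positivity) h9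
    rw [abs_mul_abs_self] at this
    nlinarith [sq_nonneg X.1]

/-- Two-sided bounds for the integral of the square of a solution over a cell. -/
theorem exists_integral_bounds (hk : k ≠ 0) (hk2 : k ^ 2 < 12 / 5) (ha : ∀ n, 0 < a n)
    (hs : Summable a) {G : ℝ} (hg : ∀ n, |g n| ≤ G) :
    ∃ C, ∀ᶠ n in atTop, ∀ v v' : ℝ → ℝ, IsCombSolution a g (k ^ 2) v v' →
      ∫ x in combNode a n..combNode a (n + 1), |v x| ^ 2 ≤
        C * ‖cellState k a g (v 0, v' 0) n‖ ^ 2 ∧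
      1 / 100000 * ‖cellState k a g (v 0, v' 0) n‖ ^ 2 ≤
        (∫ x in combNode a n..combNode a (n + 1), |v x| ^ 2) +
          ∫ x in combNode a (n + 1)..combNode a (n + 2), |v x| ^ 2 := by
  obtain ⟨C, hC, hev⟩ := exists_cell_bounds hk
  have hG : 0 ≤ G := (abs_nonneg _).trans (hg 0)
  have hlim : Tendsto (fun n => √(a n)) atTop (𝓝[>] 0) := by
    refine tendsto_nhdsWithin_iff.2 ⟨by simpa using hs.tendsto_atTop_zero.sqrt, ?_⟩
    exact Eventually.of_forall fun n => Real.sqrt_pos.2 (ha n)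
  have hB : ∀ᶠ n in atTop, HasCellBounds k C √(a n) := hlim.eventually hev
  have ha0 := hs.tendsto_atTop_zero
  have ha0' := ha0.comp (tendsto_add_atTop_nat 1)
  set D := (C * (2 + k ^ 2 / 2)) ^ 2 with hD
  set L := (1 + G) * (30 + C) with hL
  -- Half of 1/10000 is 5/100000; giving up 4/100000 to the errors leaves the stated 1/100000.
  have hsmall : ∀ᶠ n in atTop, D * a n + D * L ^ 2 * a (n + 1) ≤ 4 / 100000 := by
    have h1 := (ha0.const_mul D).add (ha0'.const_mul (D * L ^ 2))
    rw [mul_zero, mul_zero, add_zero] at h1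
    exact h1.eventually (ge_mem_nhds (by norm_num))
  have hsmall2 : ∀ᶠ n in atTop, C * a n ≤ 1 / 4 := by
    have h1 := ha0.const_mul C
    rw [mul_zero] at h1
    exact h1.eventually (ge_mem_nhds (by norm_num))
  have hone : ∀ᶠ n in atTop, a n ≤ 1 := ha0.eventually (ge_mem_nhds (by norm_num))
  refine ⟨32 * C ^ 2, ?_⟩
  filter_upwards [hB, (tendsto_add_atTop_nat 1).eventually hB, hsmall, hsmall2, hone,
    (tendsto_add_atTop_nat 1).eventually hone] with n b1 b2 s1 s2 o1 o2 v v' h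
  refine ⟨h.integral_cell_le hk ha hs b1, ?_⟩
  have l1 := h.le_integral_cell hk ha hs b1 o1
  have l2 := h.le_integral_cell hk ha hs b2 o2
  rw [← hD] at l1 l2
  set X := cellState k a g (v 0, v' 0) n with hX
  set Y := cellState k a g (v 0, v' 0) (n + 1) with hY
  have hXY : Y = shear (g n) (cellPartial k (a n) 8 X) := cellState_succ _ _ _ _ _
  have hsq : √(a n) ^ 2 = a n := Real.sq_sqrt (ha n).le
  have hc := (b1 X).2.2.2
  rw [hsq] at hc
  have hs1 : √(a n) ≤ 1 := Real.sqrt_le_one.2 o1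
  have hX0 := norm_nonneg X
  have hfst : |Y.1 - (modelCell (k ^ 2) √(a n) X).1| ≤ 1 / 4 * ‖X‖ := by
    have h1 : |(cellPartial k (a n) 8 X - modelCell (k ^ 2) √(a n) X).1| ≤ _ :=
      (norm_fst_le _).trans hc
    rw [hXY, shear_apply]
    exact h1.trans (by gcongr)
  have l3 := le_fst_sq_add_fst_sq hk hk2 (Real.sqrt_nonneg _) hs1 hfst
  have hYn : ‖Y‖ ≤ L * ‖X‖ := by
    rw [hXY, hL, mul_assoc]
    refine (norm_shear_le (hg n) _).trans ?_
    gcongr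
    calc ‖cellPartial k (a n) 8 X‖ = ‖modelCell (k ^ 2) √(a n) X +
          (cellPartial k (a n) 8 X - modelCell (k ^ 2) √(a n) X)‖ := by rw [add_sub_cancel]
      _ ≤ 30 * ‖X‖ + C * 1 * ‖X‖ := (norm_add_le _ _).trans (add_le_add
          (norm_modelCell_le (by positivity) hk2 (Real.sqrt_nonneg _) hs1 X)
          (hc.trans (by gcongr)))
      _ = _ := by ring
  have hD0 : 0 ≤ D := by positivity
  have h5 : D * a (n + 1) * ‖Y‖ ^ 2 ≤ D * L ^ 2 * a (n + 1) * ‖X‖ ^ 2 := by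
    have := (ha (n + 1)).le
    calc _ ≤ D * a (n + 1) * (L * ‖X‖) ^ 2 := by gcongr
      _ = _ := by ring
  have h6 := mul_le_mul_of_nonneg_right s1 (sq_nonneg ‖X‖)
  have e2 : n + 1 + 1 = n + 2 := rfl
  rw [e2] at l2
  linarith

end Cell

end DeltaComb

/-! ### From a decaying trajectory to a subordinate solution. -/

namespace DeltaComb

open Set Filter Topology

theorem IsCombSolution.isSubordinate {a g : ℕ → ℝ} {k : ℝ} {u u' : ℝ → ℝ}
    (hu : IsCombSolution a g (k ^ 2) u u') (hk : k ≠ 0) (hk2 : k ^ 2 < 12 / 5)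
    (ha : ∀ n, 0 < a n) (hs : Summable a) {G : ℝ} (hg : ∀ n, |g n| ≤ G)
    (hu0 : Tendsto (fun n => ‖cellState k a g (u 0, u' 0) n‖) atTop (𝓝 0)) {e : ℝ × ℝ}
    (he : Tendsto (fun n => ‖cellState k a g e n‖) atTop atTop)
    (hW : sympl (u 0, u' 0) e ≠ 0) : IsSubordinate a g (k ^ 2) u := by
  intro v v' hv hind
  -- Cramer's rule in the basis formed by the initial vectors of the decaying and the growing
  -- solution. Independence of v and u forces γ ≠ 0.
  obtain ⟨α, γ, hy⟩ : ∃ α γ : ℝ, (v 0, v' 0) = α • (u 0, u' 0) + γ • e := by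
    refine ⟨sympl (v 0, v' 0) e / sympl (u 0, u' 0) e,
      sympl (u 0, u' 0) (v 0, v' 0) / sympl (u 0, u' 0) e, ?_⟩
    ext
    · simp only [sympl, Prod.fst_add, Prod.smul_fst, smul_eq_mul] at hW ⊢
      rw [div_mul_eq_mul_div, div_mul_eq_mul_div, ← add_div, eq_div_iff hW]
      ring
    · simp only [sympl, Prod.snd_add, Prod.smul_snd, smul_eq_mul] at hW ⊢
      rw [div_mul_eq_mul_div, div_mul_eq_mul_div, ← add_div, eq_div_iff hW]
      ring
  have hγ : γ ≠ 0 := by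
    rintro rfl
    rw [zero_smul, add_zero] at hy
    have h1 := hu.eqOn hv hk ha hs hy
    have h2 := LinearIndependent.pair_iff.1 hind α (-1) (by
      ext x
      simp [h1 x.1 x.2])
    norm_num at h2
  have hvn : ∀ᶠ n in atTop, 1 ≤ ‖cellState k a g (v 0, v' 0) n‖ := by
    have h1 : Tendsto (fun n => |γ| * ‖cellState k a g e n‖ +
        -(|α| * ‖cellState k a g (u 0, u' 0) n‖)) atTop atTop :=
      (he.const_mul_atTop (abs_pos.2 hγ)).atTop_add (hu0.const_mul |α|).neg
    filter_upwards [h1.eventually_ge_atTop 1] with n hn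
    rw [hy, cellState_add_smul, add_comm]
    refine hn.trans ?_
    have := norm_sub_le_norm_add (γ • cellState k a g e n) (α • cellState k a g (u 0, u' 0) n)
    rw [norm_smul, norm_smul, Real.norm_eq_abs, Real.norm_eq_abs] at this
    linarith
  obtain ⟨C, hC⟩ := exists_integral_bounds hk hk2 ha hs hg
  have hmono := combNode_strictMono ha
  have h0 : combNode a 0 = 0 := by simp [combNode]
  have key := tendsto_integral_div_integral hmono h0 (tendsto_combNode hs)
    (f := fun x => |u x| ^ 2) (F := fun x => |v x| ^ 2) hu.continuousOn_sq hv.continuousOn_sq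
    (fun x => by positivity) (fun x => by positivity)
    (squeeze_zero' (Eventually.of_forall fun n => intervalIntegral.integral_nonneg
      (hmono (Nat.lt_succ_self n)).le fun x _ => by positivity)
      (hC.mono fun n hn => (hn u u' hu).1) (by simpa using (hu0.pow 2).const_mul C))
    (c := 1 / 100000) (by norm_num) (by
      filter_upwards [hC, hvn] with n h1 h2
      refine le_trans ?_ (h1 v v' hv).2
      have := one_le_pow₀ h2 (n := 2)
      linarith)
  have hpos : 0 < combEnd a := by
    have := lt_of_strictMono_of_tendsto hmono (tendsto_combNode hs) 0
    rwa [h0] at this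
  have h5 := key.sqrt
  rw [Real.sqrt_zero] at h5
  refine h5.congr' ?_
  filter_upwards [Ioo_mem_nhdsLT hpos] with L hL
  rw [normUpTo, normUpTo, Real.sqrt_div (intervalIntegral.integral_nonneg hL.1.le
    fun x _ => by positivity)]

/-! ### Prüfer variables -/

/-- The coefficient of `fPlus φ` in the expansion of a real vector. -/
noncomputable def pruferCoeff (φ : ℝ) (x : ℝ × ℝ) : ℂ :=
  ⟨x.1 / 2, (x.1 * (1 - Real.cos φ) - x.2) / (2 * Real.sin φ)⟩

/-- The vectors `fPlus φ` and `fMinus φ` are complex conjugate, so a real vector has conjugate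
coefficients; this is why one radius and one angle suffice. -/
theorem pruferCoeff_spec {φ : ℝ} (hφ : Real.sin φ ≠ 0) (x : ℝ × ℝ) :
    (![(x.1 : ℂ), (x.2 : ℂ)] : Fin 2 → ℂ) = pruferCoeff φ x • fPlus φ +
      (starRingEnd ℂ) (pruferCoeff φ x) • fMinus φ := by
  have e1 : Complex.exp (Complex.I * φ) = ⟨Real.cos φ, Real.sin φ⟩ := by
    rw [mul_comm, Complex.exp_mul_I, ← Complex.ofReal_cos, ← Complex.ofReal_sin,
      Complex.mk_eq_add_mul_I]
  have e2 : Complex.exp (-(Complex.I * φ)) = ⟨Real.cos φ, -Real.sin φ⟩ := by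
    rw [mul_comm, ← neg_mul, Complex.exp_mul_I, Complex.cos_neg, Complex.sin_neg,
      ← Complex.ofReal_cos, ← Complex.ofReal_sin, Complex.mk_eq_add_mul_I]
    push_cast
    ring
  ext i
  fin_cases i
  · apply Complex.ext <;> simp [fPlus, fMinus, pruferCoeff]
  · simp only [fPlus, fMinus, e1, e2]
    apply Complex.ext
    · simp [pruferCoeff]
      field_simp
      ring
    · simp [pruferCoeff]
      ring

theorem norm_pruferCoeff_le {φ : ℝ} (hφ : 0 < Real.sin φ) (x : ℝ × ℝ) :
    ‖pruferCoeff φ x‖ ≤ (1 / 2 + 3 / (2 * Real.sin φ)) * ‖x‖ := by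
  have h1 : |x.1| ≤ ‖x‖ := norm_fst_le x
  have h2 : |x.2| ≤ ‖x‖ := norm_snd_le x
  have h3 : |1 - Real.cos φ| ≤ 2 := by
    rw [abs_le]; constructor <;> linarith [Real.cos_le_one φ, Real.neg_one_le_cos φ]
  refine (Complex.norm_le_abs_re_add_abs_im _).trans ?_
  simp only [pruferCoeff]
  rw [abs_div, abs_div, abs_of_pos (by positivity : 0 < 2 * Real.sin φ), abs_two]
  calc _ ≤ ‖x‖ / 2 + (‖x‖ * 2 + ‖x‖) / (2 * Real.sin φ) := by
        gcongr
        refine (abs_sub _ _).trans ?_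
        rw [abs_mul]
        gcongr
    _ = _ := by ring

/-- With the upper bound, this makes Prüfer radii and norms of states comparable, so their
logarithmic rates agree. -/
theorem norm_le_norm_pruferCoeff {φ : ℝ} (hφ : Real.sin φ ≠ 0) (x : ℝ × ℝ) :
    1 / 6 * ‖x‖ ≤ ‖pruferCoeff φ x‖ := by
  have h1 : |x.1 / 2| ≤ ‖pruferCoeff φ x‖ :=
    Complex.abs_re_le_norm (pruferCoeff φ x)
  have h2 : |(x.1 * (1 - Real.cos φ) - x.2) / (2 * Real.sin φ)| ≤ ‖pruferCoeff φ x‖ :=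
    Complex.abs_im_le_norm (pruferCoeff φ x)
  set r := ‖pruferCoeff φ x‖
  have hr : 0 ≤ r := norm_nonneg _
  rw [abs_div, abs_two] at h1
  have h3 : |x.1 * (1 - Real.cos φ) - x.2| ≤ 2 * r := by
    rw [abs_div, div_le_iff₀ (by positivity), abs_mul, abs_two] at h2
    nlinarith [Real.abs_sin_le_one φ]
  have h4 : |1 - Real.cos φ| ≤ 2 := by
    rw [abs_le]; constructor <;> linarith [Real.cos_le_one φ, Real.neg_one_le_cos φ]
  have h5 : |x.2| ≤ 6 * r := by
    calc |x.2| = |x.1 * (1 - Real.cos φ) - (x.1 * (1 - Real.cos φ) - x.2)| := by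
          rw [sub_sub_cancel]
      _ ≤ |x.1| * |1 - Real.cos φ| + 2 * r := by
          refine (abs_sub _ _).trans ?_
          rw [abs_mul]
          gcongr
      _ ≤ (2 * r) * 2 + 2 * r := by gcongr; linarith
      _ = _ := by ring
  have h6 : ‖x‖ ≤ 6 * r := norm_prod_le_iff.2 ⟨by rw [Real.norm_eq_abs]; linarith, h5⟩
  linarith

theorem exists_angle (p : ℂ) : ∃ θ ∈ Ico 0 (2 * Real.pi),
    p = Complex.I * ‖p‖ * Complex.exp (Complex.I * (θ : ℝ)) := by
  have hper : Function.Periodic (fun t : ℝ => Complex.exp (Complex.I * t)) (2 * Real.pi) := by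
    intro t
    simp only
    rw [← Complex.exp_periodic (Complex.I * t)]
    congr 1
    push_cast
    ring
  -- Dividing by i accounts for the factor i in the definition of the Prüfer variables.
  set t := (p / Complex.I).arg with ht
  refine ⟨toIcoMod Real.two_pi_pos 0 t, ?_, ?_⟩
  · simpa using toIcoMod_mem_Ico Real.two_pi_pos 0 t
  · have h1 : Complex.exp (Complex.I * (toIcoMod Real.two_pi_pos 0 t : ℝ)) =
        Complex.exp (Complex.I * t) := hper.sub_zsmul_eq _
    have h2 := Complex.norm_mul_exp_arg_mul_I (p / Complex.I)
    rw [norm_div, Complex.norm_I, div_one, ← ht, mul_comm (t : ℂ)] at h2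
    rw [h1, mul_assoc, h2, mul_div_cancel₀ _ Complex.I_ne_zero]

/-- Every nowhere vanishing solution has Prüfer variables. -/
theorem exists_isPrufer {a : ℕ → ℝ} {φ : ℝ} (hφ : Real.sin φ ≠ 0) {u u' : ℝ → ℝ}
    (hu : ∀ n, (u (combNode a n), u' (combNode a n)) ≠ 0) :
    ∃ θ : ℕ → ℝ, (∀ n, θ n ∈ Ico 0 (2 * Real.pi)) ∧
      IsPrufer a φ u u' (fun n => ‖pruferCoeff φ (u (combNode a n), u' (combNode a n))‖) θ := by
  set p : ℕ → ℂ := fun n => pruferCoeff φ (u (combNode a n), u' (combNode a n))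
  have hpos : ∀ n, 0 < ‖p n‖ := fun n => lt_of_lt_of_le
    (mul_pos (by norm_num) (norm_pos_iff.2 (hu n))) (norm_le_norm_pruferCoeff hφ _)
  choose θ hθ hpθ using fun n => exists_angle (p n)
  refine ⟨θ, hθ, fun n => ⟨hpos n, ?_⟩⟩
  have h1 := pruferCoeff_spec hφ (u (combNode a n), u' (combNode a n))
  have h2 : (starRingEnd ℂ) (p n) =
      -Complex.I * ‖p n‖ * Complex.exp (-(Complex.I * (θ n : ℝ))) := by
    conv_lhs => rw [hpθ n]
    rw [map_mul, map_mul, ← Complex.exp_conj, map_mul, Complex.conj_I, Complex.conj_ofReal,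
      Complex.conj_ofReal]
    simp only [neg_mul]
  change _ = p n • fPlus φ + (starRingEnd ℂ) (p n) • fMinus φ at h1
  rw [h2] at h1
  rw [h1]
  congr 2
  exact hpθ n

theorem tendsto_zero_of_tendsto_log_div_log {x : ℕ → ℝ} (hx : ∀ n, 0 < x n) {β : ℝ} (hβ : 0 < β)
    (h : Tendsto (fun n : ℕ => Real.log (x n) / Real.log n) atTop (𝓝 (-β))) :
    Tendsto x atTop (𝓝 0) := by
  have h1 := ((tendsto_log_div_log_iff hx).1 h).2 (-(β / 2)) (by linarith)
  exact squeeze_zero' (Eventually.of_forall fun n => (hx n).le) h1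
    ((tendsto_rpow_neg_atTop (half_pos hβ)).comp tendsto_natCast_atTop_atTop)

theorem tendsto_atTop_of_tendsto_log_div_log {x : ℕ → ℝ} (hx : ∀ n, 0 < x n) {β : ℝ} (hβ : 0 < β)
    (h : Tendsto (fun n : ℕ => Real.log (x n) / Real.log n) atTop (𝓝 β)) :
    Tendsto x atTop atTop := by
  have h1 := ((tendsto_log_div_log_iff hx).1 h).1 (β / 2) (by linarith)
  exact tendsto_atTop_mono' _ h1
    ((tendsto_rpow_atTop (half_pos hβ)).comp tendsto_natCast_atTop_atTop)

/-- A decaying trajectory of the transfer matrices yields a decaying subordinate solution. -/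
theorem exists_subordinate_solution {a g : ℕ → ℝ} {k : ℝ} (hk : k ≠ 0) (hk2 : k ^ 2 < 12 / 5)
    (ha : ∀ n, 0 < a n) (hs : Summable a) {G : ℝ} (hg : ∀ n, |g n| ≤ G) {φ : ℝ}
    (hφ : 0 < Real.sin φ) {β : ℝ} (hβ : 0 < β) {c : ℝ}
    (h₁ : Tendsto (fun n : ℕ => Real.log ‖cellState k a g (1, 0) n‖ / Real.log n) atTop (𝓝 β))
    (h₂ : Tendsto (fun n : ℕ => Real.log ‖cellState k a g (-c, 1) n‖ / Real.log n) atTop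
      (𝓝 (-β))) :
    ∃ θω ∈ Ico (0 : ℝ) (2 * Real.pi), ∃ (u u' : ℝ → ℝ) (R θ : ℕ → ℝ),
      IsCombSolution a g (k ^ 2) u u' ∧ u 0 ^ 2 + u' 0 ^ 2 = 1 ∧ IsPrufer a φ u u' R θ ∧
      θ 0 = θω ∧ Tendsto (fun n : ℕ => Real.log (R n) / Real.log n) atTop (𝓝 (-β)) ∧
      Tendsto R atTop (𝓝 0) ∧ IsSubordinate a g (k ^ 2) u := by
  set r : ℝ := (√(c ^ 2 + 1))⁻¹ with hr
  have hr0 : 0 < r := by positivity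
  have hr2 : r ^ 2 * (c ^ 2 + 1) = 1 := by
    rw [hr, inv_pow, Real.sq_sqrt (by positivity), inv_mul_cancel₀ (by positivity)]
  -- The decaying direction, scaled by r to a unit initial vector.
  set x₀ : ℝ × ℝ := r • (-c, 1) with hx₀
  set s : ℕ → ℝ := fun j => combStrength a g (Nat.divModEquiv 8 j) with hsdef
  set u := combSol k (flatNode a) s x₀ with hu
  set u' := combSolDeriv k (flatNode a) s x₀ with hu'
  have hsol : IsCombSolution a g (k ^ 2) u u' := isCombSolution_iff.2
    (isSolution_combSol hk (flatNode_strictMono ha) (flatNode_zero a) (tendsto_flatNode ha hs) x₀)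
  have hinit : (u 0, u' 0) = x₀ := by
    have := combSol_node (k := k) (c := s) (flatNode_strictMono ha) x₀ 0
    rwa [flatNode_zero] at this
  have hst : ∀ n, cellState k a g x₀ n = r • cellState k a g (-c, 1) n := fun n => by
    have := cellState_add_smul k a g (-c, 1) 0 r 0 n
    simpa only [zero_smul, add_zero] using this
  have hne : ∀ n, cellState k a g x₀ n ≠ 0 := cellState_ne_zero hk a g (by
    intro h
    have := congrArg Prod.snd h
    simp [hx₀, hr0.ne'] at this)
  have hnode : ∀ n, (u (combNode a n), u' (combNode a n)) = cellState k a g x₀ n := fun n => by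
    rw [hsol.apply_combNode hk ha hs, hinit]
  obtain ⟨θ, hθ, hpr⟩ := exists_isPrufer (a := a) (u := u) (u' := u') hφ.ne'
    fun n => by rw [hnode]; exact hne n
  have hpos : ∀ n, 0 < ‖pruferCoeff φ (u (combNode a n), u' (combNode a n))‖ := fun n => (hpr n).1
  have hlog : Tendsto (fun n : ℕ => Real.log ‖pruferCoeff φ (u (combNode a n), u' (combNode a n))‖ /
      Real.log n) atTop (𝓝 (-β)) := by
    refine tendsto_log_div_log_of_le_mul (c := 1 / 6 * r)
      (C := (1 / 2 + 3 / (2 * Real.sin φ)) * r)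
      (fun n => norm_pos_iff.2 (cellState_ne_zero hk a g (by simp) n)) hpos (by positivity)
      (fun n => ?_) (fun n => ?_) h₂
    · refine le_trans (le_of_eq ?_) (norm_le_norm_pruferCoeff hφ.ne' _)
      rw [hnode, hst, norm_smul, Real.norm_of_nonneg hr0.le, mul_assoc]
    · refine (norm_pruferCoeff_le hφ _).trans (le_of_eq ?_)
      rw [hnode, hst, norm_smul, Real.norm_of_nonneg hr0.le, mul_assoc]
  refine ⟨θ 0, hθ 0, u, u', _, θ, hsol, ?_, hpr, rfl, hlog,
    tendsto_zero_of_tendsto_log_div_log hpos hβ hlog, ?_⟩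
  · have e1 : u 0 = r * -c := congrArg Prod.fst hinit
    have e2 : u' 0 = r * 1 := congrArg Prod.snd hinit
    rw [e1, e2]
    linear_combination hr2
  · refine hsol.isSubordinate hk hk2 ha hs hg ?_ (tendsto_atTop_of_tendsto_log_div_log
      (fun n => norm_pos_iff.2 (cellState_ne_zero hk a g (by simp) n)) hβ h₁) ?_
    · have h3 := tendsto_zero_of_tendsto_log_div_log
        (fun n => norm_pos_iff.2 (cellState_ne_zero hk a g (by simp) n)) hβ h₂
      have h4 := h3.const_mul r
      rw [mul_zero] at h4
      refine h4.congr fun n => ?_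
      rw [hinit, hst, norm_smul, Real.norm_of_nonneg hr0.le]
    · rw [hinit, hx₀]
      simp [sympl, hr0.ne']

end DeltaComb

/-! ### The proposition. -/

theorem mainTheorem8
    -- the spacings: a decreasing summable sequence of positive numbers
    (a : ℕ → ℝ) (ha_pos : ∀ n, 0 < a n) (ha_anti : Antitone a) (ha_sum : Summable a)
    -- the random coupling constants; `g n` is the coupling constant number `n + 1`
    {Ω : Type*} [MeasurableSpace Ω] (ν : MeasureTheory.Measure Ω)
    [MeasureTheory.IsProbabilityMeasure ν]
    (g : ℕ → Ω → ℝ) (hg_meas : ∀ n, Measurable (g n))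
    (hg_indep : ProbabilityTheory.iIndepFun g ν)
    (lam : ℝ) (hlam : 0 < lam)
    (hg_second : ∀ n : ℕ, ∫ ω, g n ω ^ 2 ∂ν = lam ^ 2 / ((n : ℝ) + 1))
    (hg_fourth : ∃ C₄ : ℝ, 0 < C₄ ∧
      ∀ n : ℕ, ∫ ω, g n ω ^ 4 ∂ν ≤ C₄ * lam ^ 4 / ((n : ℝ) + 1) ^ 2)
    (hg_mean : ∀ n : ℕ, ∫ ω, g n ω ∂ν = 0)
    (hg_bound : ∃ ε : ℝ, 0 < ε ∧ ∃ C₁ : ℝ, 0 < C₁ ∧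
      ∀ (n : ℕ) (ω : Ω), |g n ω| ≤ C₁ * ((n : ℝ) + 1) ^ (-(1 / 3) - ε))
    -- the quasi-momentum and the energy
    (φ : ℝ) (hφ : φ ∈ Set.Ioo 0 Real.pi) (hφ₁ : φ ≠ Real.pi / 4) (hφ₂ : φ ≠ Real.pi / 2)
    (hφ₃ : φ ≠ 3 * Real.pi / 4)
    (E : ℝ) (hE : Real.cos φ = 1 - 5 / 6 * E) :
    ∀ᵐ ω ∂ν, ∃ θω ∈ Set.Ico (0 : ℝ) (2 * Real.pi),
      ∃ (u u' : ℝ → ℝ) (R θ : ℕ → ℝ),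
        DeltaComb.IsCombSolution a (fun n => g n ω) E u u' ∧
        u 0 ^ 2 + u' 0 ^ 2 = 1 ∧
        DeltaComb.IsPrufer a φ u u' R θ ∧ θ 0 = θω ∧
        Filter.Tendsto (fun n : ℕ => Real.log (R n) / Real.log n) Filter.atTop
          (nhds (-(lam ^ 2 / (8 * Real.sin φ ^ 2)))) ∧
        Filter.Tendsto R Filter.atTop (nhds 0) ∧
        DeltaComb.IsSubordinate a (fun n => g n ω) E u := by
  have hsin : 0 < Real.sin φ := Real.sin_pos_of_pos_of_lt_pi hφ.1 hφ.2
  have hsc := Real.sin_sq_add_cos_sq φ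
  -- Since |cos φ| < 1, the energy lies in (0, 12/5). In particular E = k² with k real and nonzero,
  -- as used in the transfer matrices.
  have hE0 : 0 < E := by nlinarith
  have hE1 : E < 12 / 5 := by nlinarith
  obtain ⟨k, hk, rfl⟩ : ∃ k : ℝ, k ≠ 0 ∧ k ^ 2 = E :=
    ⟨√E, (Real.sqrt_pos.2 hE0).ne', Real.sq_sqrt hE0.le⟩
  have hg : DeltaComb.IsDecayingNoise ν g lam :=
    ⟨hg_meas, hg_indep, hg_second, hg_fourth, hg_mean, hg_bound⟩
  obtain ⟨G, hG⟩ := hg.exists_abs_le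
  filter_upwards [DeltaComb.ae_exists_decaying_cellState hg hlam ha_pos ha_anti ha_sum hφ hφ₂ hk hE]
    with ω hω
  obtain ⟨c, h₁, h₂⟩ := hω
  exact DeltaComb.exists_subordinate_solution hk hE1 ha_pos ha_sum (fun n => hG n ω) hsin
    (by positivity) h₁ h₂
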